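/- **Model.** There are $n\ge 1$ agents $N=\{1,\dots,n\}$ and $m$ identical items. The type of agent $i$ is $(a_i,d_i,v_i,b_i)$: arrival and departure time $a_i\le d_i$, value $v_i\ge 0$ per item, budget $b_i\ge 0$. All four are private, and any of them can be misreported. An agent who receives $x$ items for a total payment $q$ has utility $-\infty$ if $q>b_i$; otherwise her utility is $v_ix-q$ if the items are received at a time in $[a_i,d_i]$, and $-q$ if not. An adversary chooses time frames $[a_i,d_i]$ with $a_1<\dots<a_n$ and pairs $(v_1,b_1),\dots,(v_n,b_n)$; a uniformly random permutation $\pi$ gives agent $i$ the type $(a_i,d_i,v_{\pi(i)},b_{\pi(i)})$. A mechanism is *truthful* if, for every agent and all reports of the others (with distinct arrival times), reporting her real type maximizes her expected utility over the coins of the mechanism. Mechanisms are also required to be feasible (at most $m$ items are allocated) and individually rational (a truthful agent has expected utility at least $0$). **Benchmarks.** For a set $S$ of agents, an amount $k$ and a price $p>0$ let $R_{S,k}(p)=\min\bigl(\sum_{i\in S,\,v_i\ge p} b_i/p,\;k\bigr)\cdot p$. Let $OPT(S,k)=\max_{p>0}R_{S,k}(p)$, and let $p^*_{S,k}$ be a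 maximizer (ties broken arbitrarily, depending only on $S$ and the reports of its members). Let $OPT^*(S,k)$ be the optimal revenue at heterogeneous prices: the maximum of $\sum_{i\in S} q_ix_i$ over $0\le q_i\le v_i$, $x_i\ge 0$ with $q_ix_i\le b_i$ and $\sum_{i\in S} x_i\le k$. The market parameter is $\epsilon=\max_{i\in N} b_i/OPT(N,m)$, for $OPT(N,m)>0$. **Allocation procedures** (they return an allocation $x$ and a charged allocation $\tilde x$). Both go through the agents of $S$ in uniformly random order, start with $k'=k$, skip agents with $v_i<p$ (for whom $x_i=\tilde x_i=0$), and after each agent $i$ replace $k'$ by $k'-x_i$. - $\mathrm{Div\_Alloc}(S,p,k)$: $x_i=\tilde x_i=\min\{b_i/p,k'\}$. - $\mathrm{Indiv\_Alloc}(S,p,k)$: if $k'\le b_i/p$ then $x_i=\tilde x_i=k'$; otherwise $\tilde x_i=b_i/p$, and $x_i$ is $\lceil b_i/p\rceil$ with probability $b_i/p-\lfloor b_i/p\rfloor$ and $\lfloor b_i/p\rfloor$ otherwise, by an independent lottery. **Mechanism.** Given an allocation procedure $\mathrm{Alloc}$, with $P(S)=p^*_{S,m/4}$ and with all types as reported: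 1. Toss $n-1$ fair coins and let $j$ be the number of tails plus one. $A$ is the set of the first $j$ agents by arrival time, $t_0$ is the arrival time of the last of them (called $j$ as well), and $B=N\setminus A$. 2. At time $t_0$ split $A$ into $A_1$ and $A_2$ by independent fair coins, naming the part that contains agent $j$ $A_2$. Run $\mathrm{Alloc}(A_1,P(A_2),m/4)$ and $\mathrm{Alloc}(A_2,P(A_1),m/4)$. Each agent of $A$ whose departure time is at least $t_0$ receives her $x_i$ at time $t_0$ and pays $\tilde x_i$ times the price used; the other agents of $A$ receive and pay nothing. 3. Let $m_1=m_2=m/4$. Each agent $i\in B$, upon her arrival, tosses a fair coin. On heads, let $(x',\tilde x')$ be returned by $\mathrm{Alloc}(A_1\cup\{i\},P(A_2\setminus\{j\}),m/4)$; she receives $x_i=\min\{x'_i,m_1\}$ items, pays $\min\{\tilde x'_i,m_1\}\cdot P(A_2\setminus\{j\})$, and $m_1$ becomes $m_1-x_i$. On tails the same is done with $\mathrm{Alloc}((A_2\setminus\{j\})\cup\{i\},P(A_1),m/4)$, price $P(A_1)$ and $m_2$. $\mathrm{Rev\_Indiv}$ is this mechanism with $\mathrm{Indiv\_Alloc}$,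 for a positive integer $m$ divisible by $4$; $\mathrm{Rev\_Div}$ is this mechanism with $\mathrm{Div\_Alloc}$, for a real amount $m>0$. **Theorem.** 1. $\mathrm{Rev\_Indiv}$ allocates integral numbers of items, is feasible, individually rational and truthful, and gives a $32$-approximation to the optimal heterogeneous-price revenue as $\epsilon\to 0$: for every $\eta>0$ there is $\epsilon_0>0$, depending only on $\eta$, such that for all $n$, $m$ and all choices of the adversary with $\epsilon\le\epsilon_0$, the expected revenue under truthful reports (over $\pi$ and the coins of the mechanism) is at least $(1-\eta)\,OPT^*(N,m)/32$. 2. $\mathrm{Rev\_Div}$ is feasible, individually rational and truthful, and gives a $16$-approximation in the same sense: the expected revenue is at least $(1-\eta)\,OPT^*(N,m)/16$ whenever $\epsilon\le\epsilon_0$. -/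

import Mathlib

noncomputable section

namespace BudgetAuction

/-! ### Agents, outcomes, utilities -/

/-- The (reported or real) type of an agent: arrival time, departure time, value for a single item
within the time frame `[arrival, departure]`, and budget. -/
structure AgentType where
  arrival : ℝ
  departure : ℝ
  value : ℝ
  budget : ℝ

/-- The type space. -/
def AgentType.Valid (t : AgentType) : Prop :=
  t.arrival ≤ t.departure ∧ 0 ≤ t.value ∧ 0 ≤ t.budget

/-- An outcome: for every agent the number of items she gets, what she pays, and the moment at which
she is served. -/
structure Outcome (ι : Type) where
  amount : ι → ℝ
  payment : ι → ℝ
  time : ι → ℝ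

/-- A (randomized, direct) mechanism: from the profile of reported types to a random outcome. -/
abbrev Mechanism (ι : Type) := (ι → AgentType) → PMF (Outcome ι)

/-- Expected value of a real function under a discrete distribution. All random draws below are made
from finite sets, so that the sum is finite (see `finite_support_rsOnline`). -/
def expectation {α : Type} (μ : PMF α) (f : α → ℝ) : ℝ :=
  ∑' a, (μ a).toReal * f a

open scoped Classical in
/-- Utility, apart from the budget, of an agent of real type `t` in the role `i`: items are worth
something to her only if she receives them within her real time frame. -/
def netValue {ι : Type} (t : AgentType) (i : ι) (o : Outcome ι) : ℝ :=
  (if t.arrival ≤ o.time i ∧ o.time i ≤ t.departure then t.value * o.amount i else 0)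
    - o.payment i

open scoped Classical in
/-- Expected utility of an agent of real type `t` in the role `i`. A payment above the budget has
utility `-∞`, so one such outcome of positive probability makes the expectation `-∞`. -/
def expectedUtility {ι : Type} (t : AgentType) (i : ι) (μ : PMF (Outcome ι)) : EReal :=
  if ∃ o ∈ μ.support, t.budget < o.payment i then ⊥
  else ((expectation μ (netValue t i) : ℝ) : EReal)

/-- The profiles considered: types in the type space, pairwise distinct arrival times. -/
def ValidProfile {ι : Type} (θ : ι → AgentType) : Prop :=
  (∀ i, (θ i).Valid) ∧ Function.Injective fun i => (θ i).arrival

/-- Never more than `m` items are handed out. -/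
def Feasible {ι : Type} [Fintype ι] (M : Mechanism ι) (m : ℝ) : Prop :=
  ∀ θ, ValidProfile θ → ∀ o ∈ (M θ).support, (∀ i, 0 ≤ o.amount i) ∧ ∑ i, o.amount i ≤ m

/-- Items are never split. -/
def AllocatesIndivisibleItems {ι : Type} (M : Mechanism ι) : Prop :=
  ∀ θ, ValidProfile θ → ∀ o ∈ (M θ).support, ∀ i, ∃ z : ℕ, o.amount i = z

/-- The expected utility of an agent who reports her type truthfully is non-negative, whatever the
other agents report. -/
def IndividuallyRational {ι : Type} (M : Mechanism ι) : Prop :=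
  ∀ θ, ValidProfile θ → ∀ i, 0 ≤ expectedUtility (θ i) i (M θ)

/-- Whatever the other agents report, agent `i`, whose real type is `θ i`, maximizes her expected
utility by reporting `θ i`: no other report `r` (with any arrival time, departure time, value and
budget) gives her more. -/
def Truthful {ι : Type} [DecidableEq ι] (M : Mechanism ι) : Prop :=
  ∀ θ, ValidProfile θ → ∀ i, ∀ r : AgentType, r.Valid →
    expectedUtility (θ i) i (M (Function.update θ i r)) ≤ expectedUtility (θ i) i (M θ)

/-! ### Revenue benchmarks -/

open scoped Classical in
/-- Revenue from selling at most `k` items to the agents in `S` at the uniform price `p`. -/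
def uniformRevenue {ι : Type} (v b : ι → ℝ) (S : Finset ι) (k p : ℝ) : ℝ :=
  min (∑ i ∈ S with p ≤ v i, b i / p) k * p

/-- `p` is a price that maximizes the revenue of selling at most `k` items to `S` at a uniform
price. -/
def IsOptimalPrice {ι : Type} (v b : ι → ℝ) (S : Finset ι) (k p : ℝ) : Prop :=
  0 < p ∧ ∀ q, 0 < q → uniformRevenue v b S k q ≤ uniformRevenue v b S k p

/-- `OPT(S, k)`: the optimal revenue from selling at most `k` items to `S` at a uniform price. -/
def uniformOPT {ι : Type} (v b : ι → ℝ) (S : Finset ι) (k : ℝ) : ℝ :=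
  sSup (uniformRevenue v b S k '' Set.Ioi 0)

/-- `OPT*(S, k)`: the optimal revenue from selling at most `k` items to `S` at heterogeneous prices.
Agent `i` buys `x i` items at a price `q i` per item that is at most her value, within her budget.
Fractional amounts are allowed (so this also bounds what can be had from indivisible items). -/
def heterogeneousOPT {ι : Type} (v b : ι → ℝ) (S : Finset ι) (k : ℝ) : ℝ :=
  sSup {R : ℝ | ∃ q x : ι → ℝ,
    (∀ i ∈ S, 0 ≤ q i ∧ q i ≤ v i ∧ 0 ≤ x i ∧ x i * q i ≤ b i) ∧
    ∑ i ∈ S, x i ≤ k ∧ R = ∑ i ∈ S, x i * q i}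

/-! ### The allocation procedures -/

/-- A uniformly random ordering of the elements of `S`. -/
def randomOrder {ι : Type} [DecidableEq ι] (S : Finset ι) : PMF (List ι) :=
  haveI : Nonempty (Fin S.card ≃ S) := ⟨S.equivFin.symm⟩
  (PMF.uniformOfFintype (Fin S.card ≃ S)).map fun π => List.ofFn fun t => (π t : ι)

/-- The number `r` rounded up with probability `r - ⌊r⌋`, and down otherwise. -/
def randomRounding (r : ℝ) : PMF ℝ :=
  (PMF.ofFintype
    (fun up : Bool => ENNReal.ofReal (if up then Int.fract r else 1 - Int.fract r))
    (by
      have h0 := Int.fract_nonneg r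
      have h1 := (Int.fract_lt_one r).le
      simp only [Fintype.sum_bool, if_true, Bool.false_eq_true, if_false]
      rw [← ENNReal.ofReal_add h0 (by linarith)]
      simp)).map
    fun up => if up then (⌈r⌉ : ℝ) else (⌊r⌋ : ℝ)

/-- An allocation procedure receives the reports, a set of agents, a price per item and an amount of
items, and returns two vectors: the actual allocation, and the allocation that is charged. -/
abbrev AllocationRule (ι : Type) :=
  (ι → AgentType) → Finset ι → ℝ → ℝ → PMF ((ι → ℝ) × (ι → ℝ))

open scoped Classical in
/-- Greedy sale of `k` divisible items at price `p` to the agents in a list, one after the other. -/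
def divLoop {ι : Type} (θ : ι → AgentType) (p : ℝ) : List ι → ℝ → (ι → ℝ)
  | [], _ => 0
  | i :: l, k =>
    if p ≤ (θ i).value then
      Function.update (divLoop θ p l (k - min ((θ i).budget / p) k)) i (min ((θ i).budget / p) k)
    else divLoop θ p l k

/-- `Div_Alloc`. -/
def divAlloc {ι : Type} [DecidableEq ι] : AllocationRule ι := fun θ S p k => do
  let order ← randomOrder S
  let x := divLoop θ p order k
  return (x, x)

open scoped Classical in
/-- Greedy sale of `k` indivisible items at price `p` to the agents in a list, one after the other,
with an independent lottery for the fractional part of the demand of each of them. -/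
def indivLoop {ι : Type} (θ : ι → AgentType) (p : ℝ) :
    List ι → ℝ → PMF ((ι → ℝ) × (ι → ℝ))
  | [], _ => PMF.pure (0, 0)
  | i :: l, k =>
    if p ≤ (θ i).value then
      if k ≤ (θ i).budget / p then
        (indivLoop θ p l (k - k)).bind fun y =>
          PMF.pure (Function.update y.1 i k, Function.update y.2 i k)
      else
        (randomRounding ((θ i).budget / p)).bind fun z =>
          (indivLoop θ p l (k - z)).bind fun y =>
            PMF.pure (Function.update y.1 i z, Function.update y.2 i ((θ i).budget / p))
    else indivLoop θ p l k

/-- `Indiv_Alloc`. -/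
def indivAlloc {ι : Type} [DecidableEq ι] : AllocationRule ι := fun θ S p k => do
  let order ← randomOrder S
  indivLoop θ p order k

/-! ### The online mechanism -/

/-- A pricing function receives a set of agents, with what they reported, and returns a price. -/
abbrev PricingRule (ι : Type) := (S : Finset ι) → (S → AgentType) → ℝ

/-- The price computed from the set `S` and the reports of its members. -/
def PricingRule.price {ι : Type} (P : PricingRule ι) (θ : ι → AgentType) (S : Finset ι) : ℝ :=
  P S fun i => θ i

/-- `P` is a version of the pricing function `P_rev^m`: a price that is optimal for selling at most
`m / 4` items to `S` at a uniform price, ties between optimal prices being broken in any way. -/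
def IsRevenuePricing {ι : Type} (m : ℝ) (P : PricingRule ι) : Prop :=
  ∀ θ : ι → AgentType, (∀ i, (θ i).Valid) → ∀ S : Finset ι,
    IsOptimalPrice (fun i => (θ i).value) (fun i => (θ i).budget) S (m / 4) (P.price θ S)

/-- The number of tails (`false`) in a sequence of `n` coin tosses. -/
def tailCount {n : ℕ} (c : Fin n → Bool) : Fin (n + 1) :=
  ⟨(Finset.univ.filter fun t => c t = false).card,
    Nat.lt_succ_of_le ((Finset.card_le_univ _).trans (by simp))⟩

/-- `arrivalOrder θ t` is the agent in place `t` (counted from `0`) by reported arrival time. -/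
def arrivalOrder {n : ℕ} (θ : Fin n → AgentType) : Equiv.Perm (Fin n) :=
  Tuple.sort fun i => (θ i).arrival

/-- The revenue collection phase, for the list of agents of `B` in order of arrival. `A₁` and `A₂'`
are the two halves of the sampling set without its last agent; `m₁` and `m₂` are the remaining
amounts. A fair coin puts an arriving agent into `B₁` (heads, `true`) or `B₂`. Returned are the items
allocated and the payments. -/
def collectionPhase {ι : Type} [DecidableEq ι] (m : ℝ) (P : PricingRule ι)
    (alloc : AllocationRule ι) (θ : ι → AgentType) (A₁ A₂' : Finset ι) :
    List ι → ℝ → ℝ → PMF ((ι → ℝ) × (ι → ℝ))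
  | [], _, _ => PMF.pure (0, 0)
  | i :: l, m₁, m₂ =>
    (PMF.uniformOfFintype Bool).bind fun heads =>
      if heads then
        (alloc θ (insert i A₁) (P.price θ A₂') (m / 4)).bind fun x' =>
          (collectionPhase m P alloc θ A₁ A₂' l (m₁ - min (x'.1 i) m₁) m₂).bind fun y =>
            PMF.pure (Function.update y.1 i (min (x'.1 i) m₁),
              Function.update y.2 i (min (x'.2 i) m₁ * P.price θ A₂'))
      else
        (alloc θ (insert i A₂') (P.price θ A₁) (m / 4)).bind fun x' =>
          (collectionPhase m P alloc θ A₁ A₂' l m₁ (m₂ - min (x'.1 i) m₂)).bind fun y =>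
            PMF.pure (Function.update y.1 i (min (x'.1 i) m₂),
              Function.update y.2 i (min (x'.2 i) m₂ * P.price θ A₁))

/-- The mechanism `RS_Online(N, m, P, Alloc)` for the `n + 1` agents `Fin (n + 1)`. -/
def rsOnline {n : ℕ} (m : ℝ) (P : PricingRule (Fin (n + 1)))
    (alloc : AllocationRule (Fin (n + 1))) : Mechanism (Fin (n + 1)) := fun θ => do
  -- partition: `last` is the last agent of the sampling set `A`, the agent number `#tails + 1`
  let tosses ← PMF.uniformOfFintype (Fin n → Bool)
  let T := tailCount tosses
  let last := arrivalOrder θ T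
  let t₀ := (θ last).arrival
  let A := (Finset.univ.filter fun t => t ≤ T).map (arrivalOrder θ).toEmbedding
  let B := ((List.finRange (n + 1)).filter fun t => T < t).map (arrivalOrder θ)
  -- sampling phase: fair coins split `A`, and the half that contains `last` is named `A₂`
  let side ← PMF.uniformOfFintype (Fin (n + 1) → Bool)
  let A₁ := A.filter fun i => side i ≠ side last
  let A₂ := A.filter fun i => side i = side last
  let x ← alloc θ A₁ (P.price θ A₂) (m / 4)
  let x' ← alloc θ A₂ (P.price θ A₁) (m / 4)
  -- revenue collection phase
  let y ← collectionPhase m P alloc θ A₁ (A₂.erase last) B (m / 4) (m / 4)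
  return {
    amount := fun i =>
      if i ∈ A then
        if (θ i).departure < t₀ then 0 else if i ∈ A₁ then x.1 i else x'.1 i
      else y.1 i
    payment := fun i =>
      if i ∈ A then
        if (θ i).departure < t₀ then 0
        else if i ∈ A₁ then x.2 i * P.price θ A₂ else x'.2 i * P.price θ A₁
      else y.2 i
    time := fun i => if i ∈ A then t₀ else (θ i).arrival }

/-- `Rev_Div`. -/
def revDiv {n : ℕ} (m : ℝ) (P : PricingRule (Fin (n + 1))) : Mechanism (Fin (n + 1)) :=
  rsOnline m P divAlloc

/-- `Rev_Indiv`. -/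
def revIndiv {n : ℕ} (m : ℝ) (P : PricingRule (Fin (n + 1))) : Mechanism (Fin (n + 1)) :=
  rsOnline m P indivAlloc

/-! ### The definitions make sense: finitely many outcomes, existence of optimal prices -/

theorem finite_support_bind {α β : Type} {μ : PMF α} {f : α → PMF β}
    (h : μ.support.Finite) (hf : ∀ a, (f a).support.Finite) : (μ.bind f).support.Finite := by
  rw [PMF.support_bind]
  exact h.biUnion fun a _ => hf a

theorem finite_support_map {α β : Type} {μ : PMF α} (f : α → β)
    (h : μ.support.Finite) : (μ.map f).support.Finite := by
  rw [PMF.support_map]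
  exact h.image f

theorem finite_support_pure {α : Type} (a : α) : (PMF.pure a).support.Finite := by
  simp

theorem finite_support_randomOrder {ι : Type} [DecidableEq ι] (S : Finset ι) :
    (randomOrder S).support.Finite :=
  finite_support_map _ (Set.toFinite _)

theorem finite_support_divAlloc {ι : Type} [DecidableEq ι] (θ : ι → AgentType) (S : Finset ι)
    (p k : ℝ) : (divAlloc θ S p k).support.Finite :=
  finite_support_bind (finite_support_randomOrder S) fun _ => finite_support_pure _

theorem finite_support_indivLoop {ι : Type} (θ : ι → AgentType) (p : ℝ) (l : List ι) :
    ∀ k : ℝ, (indivLoop θ p l k).support.Finite := by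
  induction l with
  | nil => intro k; exact finite_support_pure _
  | cons i l ih =>
    intro k
    unfold indivLoop
    split_ifs
    · exact finite_support_bind (ih _) fun _ => finite_support_pure _
    · exact finite_support_bind (finite_support_map _ (Set.toFinite _)) fun _ =>
        finite_support_bind (ih _) fun _ => finite_support_pure _
    · exact ih k

theorem finite_support_indivAlloc {ι : Type} [DecidableEq ι] (θ : ι → AgentType) (S : Finset ι)
    (p k : ℝ) : (indivAlloc θ S p k).support.Finite :=
  finite_support_bind (finite_support_randomOrder S) fun _ => finite_support_indivLoop _ _ _ _

theorem finite_support_collectionPhase {ι : Type} [DecidableEq ι] (m : ℝ) (P : PricingRule ι)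
    (alloc : AllocationRule ι) (h : ∀ θ S p k, (alloc θ S p k).support.Finite)
    (θ : ι → AgentType) (A₁ A₂' : Finset ι) (l : List ι) :
    ∀ m₁ m₂ : ℝ, (collectionPhase m P alloc θ A₁ A₂' l m₁ m₂).support.Finite := by
  induction l with
  | nil => intro m₁ m₂; exact finite_support_pure _
  | cons i l ih =>
    intro m₁ m₂
    unfold collectionPhase
    refine finite_support_bind (Set.toFinite _) fun heads => ?_
    split_ifs
    · exact finite_support_bind (h _ _ _ _) fun _ =>
        finite_support_bind (ih _ _) fun _ => finite_support_pure _
    · exact finite_support_bind (h _ _ _ _) fun _ =>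
        finite_support_bind (ih _ _) fun _ => finite_support_pure _

theorem finite_support_rsOnline {n : ℕ} (m : ℝ) (P : PricingRule (Fin (n + 1)))
    (alloc : AllocationRule (Fin (n + 1))) (h : ∀ θ S p k, (alloc θ S p k).support.Finite)
    (θ : Fin (n + 1) → AgentType) : (rsOnline m P alloc θ).support.Finite :=
  finite_support_bind (Set.toFinite _) fun _ =>
    finite_support_bind (Set.toFinite _) fun _ =>
      finite_support_bind (h _ _ _ _) fun _ =>
        finite_support_bind (h _ _ _ _) fun _ =>
          finite_support_bind (finite_support_collectionPhase _ _ _ h _ _ _ _ _ _) fun _ =>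
            finite_support_pure _

theorem exists_isOptimalPrice {ι : Type} (v b : ι → ℝ) (S : Finset ι) (k : ℝ)
    (hb : ∀ i ∈ S, 0 ≤ b i) (hk : 0 ≤ k) : ∃ p, IsOptimalPrice v b S k p := by
  classical
  have nonneg : ∀ q, 0 < q → 0 ≤ uniformRevenue v b S k q := by
    intro q hq
    unfold uniformRevenue
    refine mul_nonneg (le_min (Finset.sum_nonneg fun i hi => ?_) hk) hq.le
    exact div_nonneg (hb i (Finset.mem_filter.1 hi).1) hq.le
  have zero : ∀ q, (∀ i ∈ S, ¬ q ≤ v i) → uniformRevenue v b S k q = 0 := by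
    intro q hq
    unfold uniformRevenue
    rw [Finset.filter_eq_empty_iff.2 (fun i hi => hq i hi)]
    simp [hk]
  let C := S.filter fun i => 0 < v i
  rcases C.eq_empty_or_nonempty with hC | hC
  · refine ⟨1, one_pos, fun q hq => ?_⟩
    rw [zero q]
    · exact nonneg 1 one_pos
    · intro i hi hqi
      exact Finset.notMem_empty i (hC ▸ Finset.mem_filter.2 ⟨hi, hq.trans_le hqi⟩)
  · obtain ⟨j, hj, hmax⟩ := C.exists_max_image (fun i => uniformRevenue v b S k (v i)) hC
    have hj0 : 0 < v j := (Finset.mem_filter.1 hj).2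
    refine ⟨v j, hj0, fun q hq => ?_⟩
    rcases (S.filter fun i => q ≤ v i).eq_empty_or_nonempty with hD | hD
    · rw [zero q fun i hi => Finset.filter_eq_empty_iff.1 hD hi]
      exact nonneg _ hj0
    · obtain ⟨t, ht, hmin⟩ := Finset.exists_min_image _ v hD
      obtain ⟨htS, hqt⟩ := Finset.mem_filter.1 ht
      have ht0 : 0 < v t := hq.trans_le hqt
      refine le_trans ?_ (hmax t (Finset.mem_filter.2 ⟨htS, ht0⟩))
      have hset : S.filter (fun i => v t ≤ v i) = S.filter fun i => q ≤ v i := by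
        ext i
        simp only [Finset.mem_filter, and_congr_right_iff]
        exact fun hi => ⟨hqt.trans, fun h => hmin i (Finset.mem_filter.2 ⟨hi, h⟩)⟩
      unfold uniformRevenue
      rw [hset, ← Finset.sum_div, ← Finset.sum_div, min_mul_of_nonneg _ _ hq.le,
        min_mul_of_nonneg _ _ ht0.le, div_mul_cancel₀ _ hq.ne', div_mul_cancel₀ _ ht0.ne']
      exact min_le_min le_rfl (mul_le_mul_of_nonneg_left hqt hk)

theorem uniformOPT_eq_of_isOptimalPrice {ι : Type} {v b : ι → ℝ} {S : Finset ι} {k p : ℝ}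
    (h : IsOptimalPrice v b S k p) : uniformOPT v b S k = uniformRevenue v b S k p := by
  refine IsGreatest.csSup_eq ⟨⟨p, h.1, rfl⟩, ?_⟩
  rintro _ ⟨q, hq, rfl⟩
  exact h.2 q hq

theorem exists_isRevenuePricing {ι : Type} (m : ℝ) (hm : 0 ≤ m) :
    ∃ P : PricingRule ι, IsRevenuePricing m P := by
  classical
  have key : ∀ (S : Finset ι) (r : S → AgentType), ∃ p, (∀ i, (r i).Valid) →
      ∀ θ : ι → AgentType, (∀ i : S, θ i = r i) →
        IsOptimalPrice (fun i => (θ i).value) (fun i => (θ i).budget) S (m / 4) p := by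
    intro S r
    by_cases hr : ∀ i, (r i).Valid
    · let θ₀ : ι → AgentType := fun i => if h : i ∈ S then r ⟨i, h⟩ else ⟨0, 0, 0, 0⟩
      have hθ₀ : ∀ i : S, θ₀ i = r i := fun i => by simp [θ₀]
      obtain ⟨p, hp0, hp⟩ := exists_isOptimalPrice (fun i => (θ₀ i).value)
        (fun i => (θ₀ i).budget) S (m / 4)
        (fun i hi => by
          have := hθ₀ ⟨i, hi⟩
          simp only at this
          simpa only [this] using (hr ⟨i, hi⟩).2.2)
        (by positivity)
      refine ⟨p, fun _ θ hθ => ?_⟩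
      have heq : ∀ q, uniformRevenue (fun i => (θ i).value) (fun i => (θ i).budget) S (m / 4) q
          = uniformRevenue (fun i => (θ₀ i).value) (fun i => (θ₀ i).budget) S (m / 4) q := by
        have hag : ∀ i ∈ S, θ i = θ₀ i := fun i hi => (hθ ⟨i, hi⟩).trans (hθ₀ ⟨i, hi⟩).symm
        intro q
        unfold uniformRevenue
        rw [Finset.sum_filter, Finset.sum_filter]
        congr 2
        exact Finset.sum_congr rfl fun i hi => by simp only [hag i hi]
      refine ⟨hp0, fun q hq => ?_⟩
      rw [heq, heq]
      exact hp q hq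
    · exact ⟨0, fun h => (hr h).elim⟩
  choose P hP using key
  exact ⟨P, fun θ hθ S => hP S _ (fun i => hθ i) θ fun _ => rfl⟩

/-! ### The random-order model -/

/-- What the adversary chooses for `n + 1` agents: time frames, in order of arrival, and pairs
(value, budget). -/
structure Market (n : ℕ) where
  arrival : Fin (n + 1) → ℝ
  departure : Fin (n + 1) → ℝ
  value : Fin (n + 1) → ℝ
  budget : Fin (n + 1) → ℝ
  arrival_strictMono : StrictMono arrival
  arrival_le_departure : ∀ i, arrival i ≤ departure i
  value_nonneg : ∀ i, 0 ≤ value i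
  budget_nonneg : ∀ i, 0 ≤ budget i

namespace Market

variable {n : ℕ} (E : Market n)

/-- The types that result when the pairs (value, budget) are matched by `π` to the time frames. -/
def profile (π : Equiv.Perm (Fin (n + 1))) : Fin (n + 1) → AgentType := fun i =>
  { arrival := E.arrival i
    departure := E.departure i
    value := E.value (π i)
    budget := E.budget (π i) }

/-- Expected revenue of a mechanism under truthful reports, over the uniformly random matching and
the coins of the mechanism. -/
def expectedRevenue (M : Mechanism (Fin (n + 1))) : ℝ :=
  expectation ((PMF.uniformOfFintype (Equiv.Perm (Fin (n + 1)))).bind fun π => M (E.profile π))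
    fun o => ∑ i, o.payment i

/-- `OPT(N, m)`. -/
def OPT (m : ℝ) : ℝ := uniformOPT E.value E.budget Finset.univ m

/-- `OPT*(N, m)`. -/
def OPTstar (m : ℝ) : ℝ := heterogeneousOPT E.value E.budget Finset.univ m

/-- The market parameter `ε(N, m) = b_max / OPT(N, m)`. -/
def eps (m : ℝ) : ℝ := Finset.univ.sup' Finset.univ_nonempty E.budget / E.OPT m

end Market

end BudgetAuction

end

/-!
Both mechanisms are instances of one mechanism with a lottery `ρ` in place of the demand: no rounding
at all for divisible items, randomized rounding for indivisible ones. All that is used about the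
lottery is `IsRounding`: it has the demand as its mean and does not jump over an admissible amount
of stock. Therefore the amount charged is the expectation of the amount received, even when both are
cut off at the remaining stock (`IsRounding.expectation_sale`).

*Feasibility.* Each of the four sales, two in each phase, has its own stock of `m / 4` items.

*Truthfulness.* The number `T` of tails is drawn before anyone arrives. The first `T` agents other
than `i` are in the sampling set whatever `i` reports (`others_update`), and `i` is compared with one
half of them at a price computed from the other half. Whether she is in the sampling set or arrives
later, these two halves have the same distribution (`expectation_halves`), and neither depends on
her report. For a fixed price the best report is the truth (`IsRounding.expectation_offer_update_le`),
a later arrival only reduces the stock, and an earlier arrival or a later departure only makes her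
be served outside of her time frame (`IsRounding.expectation_view_update_le`).

*Revenue.* The optimal revenue at heterogeneous prices is at most twice the optimal revenue `R` at a
uniform price (`heterogeneousOPT_le`), so that it suffices to collect `R / 8`; the collection phase
alone does so as soon as all budgets are at most `10⁻⁹ * R`. It consists of two channels, in which
agents who arrive with a price `p` computed from a set `Y` are compared with a set `X`.
The total request of the agents of a channel is a sum of independent amounts up to `m / 4`; its
second moment controls the loss from the limited stock (`IsRounding.le_expectation_min_requested`).
Its mean is controlled by the random order of the sale, which gives an agent in expectation at least
the part `1 / (2 * max D 1)` of her demand, where `D` is the demand of `X` in units of the stock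
(`inv_le_expectation_order`).

With high probability `X` and `Y` each have about a quarter of the places and the arriving agents
have about a half (`expectation_sum_sign_deviation_le`). Since types are assigned to places by a
uniformly random permutation, wealth is then divided in the same proportions, by Chebyshev's
inequality for sampling without replacement (`expectation_perm_deviation_le`). The price depends on
`Y`, so this is not applied to all prices at once. For `Y` two prices fixed in advance suffice: an
optimal one and a threshold `c` above which the total wealth is too small for the price to be chosen
(`Market.exists_threshold`). For `X` and the arriving agents it is applied at the price `p`,
conditionally on the types of the agents in `Y` (`expectation_conditional_deviation_le`).
-/

noncomputable section

namespace BudgetAuction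

/-! ### Expectations under finitely supported distributions -/

/-- The distribution `μ` charges only finitely many points, so that `expectation μ` is a finite
sum. -/
class FinitelySupported {α : Type} (μ : PMF α) : Prop where
  finite : μ.support.Finite

section Instances

variable {α β : Type}

instance (a : α) : FinitelySupported (PMF.pure a) := ⟨finite_support_pure a⟩

instance [Fintype α] [Nonempty α] : FinitelySupported (PMF.uniformOfFintype α) :=
  ⟨Set.toFinite _⟩

instance (μ : PMF α) (κ : α → PMF β) [h : FinitelySupported μ]
    [hκ : ∀ a, FinitelySupported (κ a)] : FinitelySupported (μ.bind κ) :=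
  ⟨finite_support_bind h.finite fun a => (hκ a).finite⟩

instance (μ : PMF α) (f : α → β) [h : FinitelySupported μ] : FinitelySupported (μ.map f) :=
  ⟨finite_support_map f h.finite⟩

instance (c : Prop) [Decidable c] (μ ν : PMF α) [FinitelySupported μ] [FinitelySupported ν] :
    FinitelySupported (if c then μ else ν) := by
  split_ifs <;> infer_instance

end Instances

section Expectation

variable {α β : Type}

theorem expectation_eq_sum {μ : PMF α} {s : Finset α} (hs : μ.support ⊆ s) (f : α → ℝ) :
    expectation μ f = ∑ a ∈ s, (μ a).toReal * f a := by
  refine tsum_eq_sum fun a ha => ?_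
  have : μ a = 0 := by
    by_contra h
    exact ha (hs ((PMF.mem_support_iff μ a).2 h))
  simp [this]

theorem sum_toReal_eq_one {μ : PMF α} {s : Finset α} (hs : μ.support ⊆ s) :
    ∑ a ∈ s, (μ a).toReal = 1 := by
  rw [← ENNReal.toReal_sum fun a _ => μ.apply_ne_top a]
  have h : ∑ a ∈ s, μ a = 1 := by
    rw [← μ.tsum_coe]
    refine (tsum_eq_sum fun a ha => ?_).symm
    by_contra h
    exact ha (hs ((PMF.mem_support_iff μ a).2 h))
  simp [h]

theorem expectation_congr {μ : PMF α} {f g : α → ℝ} (h : ∀ a ∈ μ.support, f a = g a) :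
    expectation μ f = expectation μ g := by
  refine tsum_congr fun a => ?_
  by_cases ha : a ∈ μ.support
  · rw [h a ha]
  · have : μ a = 0 := by simpa [PMF.mem_support_iff] using ha
    simp [this]

theorem expectation_mono {μ : PMF α} [hμ : FinitelySupported μ] {f g : α → ℝ}
    (h : ∀ a ∈ μ.support, f a ≤ g a) : expectation μ f ≤ expectation μ g := by
  have hs : μ.support ⊆ hμ.finite.toFinset := by simp
  rw [expectation_eq_sum hs, expectation_eq_sum hs]
  refine Finset.sum_le_sum fun a ha => ?_
  exact mul_le_mul_of_nonneg_left (h a (by simpa using ha)) ENNReal.toReal_nonneg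

theorem expectation_nonneg {μ : PMF α} {f : α → ℝ} (h : ∀ a ∈ μ.support, 0 ≤ f a) :
    0 ≤ expectation μ f := by
  refine tsum_nonneg fun a => ?_
  by_cases ha : a ∈ μ.support
  · exact mul_nonneg ENNReal.toReal_nonneg (h a ha)
  · have : μ a = 0 := by simpa [PMF.mem_support_iff] using ha
    simp [this]

theorem expectation_const (μ : PMF α) [hμ : FinitelySupported μ] (c : ℝ) :
    expectation μ (fun _ => c) = c := by
  have hs : μ.support ⊆ hμ.finite.toFinset := by simp
  rw [expectation_eq_sum hs, ← Finset.sum_mul, sum_toReal_eq_one hs, one_mul]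

theorem expectation_add (μ : PMF α) [hμ : FinitelySupported μ] (f g : α → ℝ) :
    expectation μ (fun a => f a + g a) = expectation μ f + expectation μ g := by
  have hs : μ.support ⊆ hμ.finite.toFinset := by simp
  simp only [expectation_eq_sum hs, mul_add, Finset.sum_add_distrib]

theorem expectation_const_add (μ : PMF α) [FinitelySupported μ] (c : ℝ) (f : α → ℝ) :
    expectation μ (fun a => c + f a) = c + expectation μ f := by
  rw [expectation_add, expectation_const]

theorem expectation_const_mul (μ : PMF α) (c : ℝ) (f : α → ℝ) :
    expectation μ (fun a => c * f a) = c * expectation μ f := by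
  unfold expectation
  rw [← tsum_mul_left]
  exact tsum_congr fun a => by ring

theorem expectation_mul_const (μ : PMF α) (f : α → ℝ) (c : ℝ) :
    expectation μ (fun a => f a * c) = expectation μ f * c := by
  simp only [mul_comm _ c, expectation_const_mul]

theorem expectation_sub (μ : PMF α) [FinitelySupported μ] (f g : α → ℝ) :
    expectation μ (fun a => f a - g a) = expectation μ f - expectation μ g := by
  have := expectation_add μ f (fun a => (-1) * g a)
  rw [expectation_const_mul] at this
  simp only [sub_eq_add_neg]
  simpa using this

theorem expectation_sum {κ : Type} (μ : PMF α) [FinitelySupported μ] (s : Finset κ)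
    (f : κ → α → ℝ) :
    expectation μ (fun a => ∑ j ∈ s, f j a) = ∑ j ∈ s, expectation μ (f j) := by
  classical
  induction s using Finset.induction_on with
  | empty => simpa using expectation_const μ 0
  | insert j s hj ih => simp only [Finset.sum_insert hj, expectation_add, ih]

@[simp]
theorem expectation_pure (a : α) (f : α → ℝ) : expectation (PMF.pure a) f = f a := by
  rw [expectation_eq_sum (s := {a}) (by simp)]
  simp

theorem expectation_bind (μ : PMF α) [hμ : FinitelySupported μ] (κ : α → PMF β)
    [hκ : ∀ a, FinitelySupported (κ a)] (f : β → ℝ) :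
    expectation (μ.bind κ) f = expectation μ fun a => expectation (κ a) f := by
  classical
  set s := hμ.finite.toFinset with hs
  set t := s.biUnion fun a => (hκ a).finite.toFinset with ht
  have hs' : μ.support ⊆ s := by simp [hs]
  have h1 : (μ.bind κ).support ⊆ t := by
    intro b hb
    obtain ⟨a, ha, hb⟩ := (PMF.mem_support_bind_iff _ _ _).1 hb
    simp only [ht, Finset.coe_biUnion, Set.mem_iUnion]
    exact ⟨a, by simpa [hs] using ha, by simpa using hb⟩
  have h2 : ∀ a ∈ s, (κ a).support ⊆ t := fun a ha b hb => by
    simp only [ht, Finset.coe_biUnion, Set.mem_iUnion]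
    exact ⟨a, ha, by simpa using hb⟩
  have h3 : ∀ b, (μ.bind κ b).toReal = ∑ a ∈ s, (μ a).toReal * (κ a b).toReal := by
    intro b
    rw [PMF.bind_apply, tsum_eq_sum (s := s), ENNReal.toReal_sum]
    · simp
    · exact fun a _ => ENNReal.mul_ne_top (μ.apply_ne_top a) ((κ a).apply_ne_top b)
    · intro a ha
      have : μ a = 0 := by
        by_contra h
        exact ha (hs' ((PMF.mem_support_iff μ a).2 h))
      simp [this]
  rw [expectation_eq_sum h1, expectation_eq_sum hs']
  simp only [h3, Finset.sum_mul]
  rw [Finset.sum_comm]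
  refine Finset.sum_congr rfl fun a ha => ?_
  rw [expectation_eq_sum (h2 a ha), Finset.mul_sum]
  exact Finset.sum_congr rfl fun b _ => by ring

@[simp]
theorem expectation_map (μ : PMF α) [hμ : FinitelySupported μ] (g : α → β) (f : β → ℝ) :
    expectation (μ.map g) f = expectation μ fun a => f (g a) := by
  unfold PMF.map
  rw [expectation_bind μ (PMF.pure ∘ g) (hκ := fun a => by simp only [Function.comp]; infer_instance)]
  simp

theorem expectation_uniform [Fintype α] [Nonempty α] (f : α → ℝ) :
    expectation (PMF.uniformOfFintype α) f = (∑ a, f a) / Fintype.card α := by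
  rw [expectation_eq_sum (s := Finset.univ) (by simp), Finset.sum_div]
  refine Finset.sum_congr rfl fun a _ => ?_
  rw [PMF.uniformOfFintype_apply, ENNReal.toReal_inv, ENNReal.toReal_natCast]
  ring

theorem expectation_coin (f : Bool → ℝ) :
    expectation (PMF.uniformOfFintype Bool) f = (f true + f false) / 2 := by
  rw [expectation_uniform]
  simp

/-- Invariance of a uniform distribution under a bijection. -/
theorem expectation_uniform_equiv [Fintype α] [Nonempty α] (e : α ≃ α) (f : α → ℝ) :
    expectation (PMF.uniformOfFintype α) (fun a => f (e a)) =
      expectation (PMF.uniformOfFintype α) f := by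
  rw [expectation_uniform, expectation_uniform, Equiv.sum_comp e f]

theorem expectation_comm (μ : PMF α) [FinitelySupported μ] (ν : PMF β)
    [FinitelySupported ν] (f : α → β → ℝ) :
    expectation μ (fun a => expectation ν (f a)) =
      expectation ν fun b => expectation μ fun a => f a b := by
  have h1 := expectation_bind μ (fun a => ν.map fun b => (a, b)) fun x => f x.1 x.2
  have h2 := expectation_bind ν (fun b => μ.map fun a => (a, b)) fun x => f x.1 x.2
  simp only [expectation_map] at h1 h2
  rw [← h1, ← h2]
  congr 1
  exact PMF.bind_comm μ ν fun a b => PMF.pure (a, b)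

theorem bind_congr_support {μ : PMF α} {κ κ' : α → PMF β} (h : ∀ a ∈ μ.support, κ a = κ' a) :
    μ.bind κ = μ.bind κ' := by
  ext b
  simp only [PMF.bind_apply]
  refine tsum_congr fun a => ?_
  by_cases ha : a ∈ μ.support
  · rw [h a ha]
  · have : μ a = 0 := by simpa [PMF.mem_support_iff] using ha
    simp [this]

theorem map_congr_support {μ : PMF α} {f g : α → β} (h : ∀ a ∈ μ.support, f a = g a) :
    μ.map f = μ.map g :=
  bind_congr_support fun a ha => by simp [h a ha]

end Expectation

/-! ### Sequential sale with a rounded demand -/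

/-- A lottery `ρ r` for every demand `r`, whose outcomes lie in the set `Q` of admissible amounts:
the lottery has mean `r`, and stays on the same side of every admissible amount as `r`. The two
examples are no rounding at all, with all nonnegative amounts admissible, and randomized rounding
to one of the neighbouring integers, with the natural numbers as admissible amounts. -/
structure IsRounding (ρ : ℝ → PMF ℝ) (Q : ℝ → Prop) : Prop where
  finite : ∀ r, FinitelySupported (ρ r)
  mean : ∀ r, 0 ≤ r → expectation (ρ r) (fun z => z) = r
  zero : Q 0
  nonneg : ∀ k, Q k → 0 ≤ k
  sub : ∀ a b, Q a → Q b → a ≤ b → Q (b - a)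
  mem : ∀ r, 0 ≤ r → ∀ z ∈ (ρ r).support, Q z
  le : ∀ r, 0 ≤ r → ∀ z ∈ (ρ r).support, ∀ k, Q k → r ≤ k → z ≤ k
  ge : ∀ r, 0 ≤ r → ∀ z ∈ (ρ r).support, ∀ k, Q k → k ≤ r → k ≤ z

theorem isRounding_pure : IsRounding PMF.pure fun k => 0 ≤ k where
  finite r := inferInstance
  mean r _ := by simp
  zero := le_rfl
  nonneg _ h := h
  sub a b _ _ h := by simpa using h
  mem r hr z hz := by
    obtain rfl : z = r := by simpa using hz
    exact hr
  le r _ z hz k _ h := by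
    obtain rfl : z = r := by simpa using hz
    exact h
  ge r _ z hz k _ h := by
    obtain rfl : z = r := by simpa using hz
    exact h

theorem mem_support_randomRounding {r z : ℝ} (hz : z ∈ (randomRounding r).support) :
    z = ⌈r⌉ ∨ z = ⌊r⌋ := by
  unfold randomRounding at hz
  rw [PMF.mem_support_map_iff] at hz
  obtain ⟨up, -, rfl⟩ := hz
  cases up <;> simp

instance (r : ℝ) : FinitelySupported (randomRounding r) :=
  ⟨finite_support_map _ (Set.toFinite _)⟩

theorem expectation_randomRounding (r : ℝ) :
    expectation (randomRounding r) (fun z => z) = r := by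
  unfold randomRounding
  rw [expectation_map (hμ := ⟨Set.toFinite _⟩), expectation_eq_sum (s := Finset.univ) (by simp)]
  simp only [PMF.ofFintype_apply, Fintype.sum_bool, if_true, Bool.false_eq_true, if_false]
  rw [ENNReal.toReal_ofReal (Int.fract_nonneg r),
    ENNReal.toReal_ofReal (by linarith [Int.fract_lt_one r])]
  by_cases h : Int.fract r = 0
  · rw [h]
    have := Int.self_sub_floor r
    linarith
  · have h1 : (⌈r⌉ : ℝ) = ⌊r⌋ + 1 := by
      have := Int.ceil_eq_add_one_sub_fract h
      have h2 := Int.self_sub_floor r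
      linarith
    rw [h1]
    have h2 := Int.self_sub_floor r
    linarith

theorem isRounding_randomRounding : IsRounding randomRounding fun k => ∃ z : ℕ, k = z where
  finite r := inferInstance
  mean r _ := expectation_randomRounding r
  zero := ⟨0, by simp⟩
  nonneg := by
    rintro _ ⟨z, rfl⟩
    positivity
  sub := by
    rintro _ _ ⟨x, rfl⟩ ⟨y, rfl⟩ h
    exact ⟨y - x, (Nat.cast_sub (by exact_mod_cast h)).symm⟩
  mem r hr z hz := by
    rcases mem_support_randomRounding hz with rfl | rfl
    · exact ⟨⌈r⌉.toNat, by exact_mod_cast (Int.toNat_of_nonneg (Int.ceil_nonneg hr)).symm⟩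
    · exact ⟨⌊r⌋.toNat, by exact_mod_cast (Int.toNat_of_nonneg (Int.floor_nonneg.2 hr)).symm⟩
  le := by
    rintro r _ z hz _ ⟨k, rfl⟩ h
    rcases mem_support_randomRounding hz with rfl | rfl
    · exact_mod_cast Int.ceil_le.2 (by exact_mod_cast h)
    · exact (Int.floor_le r).trans h
  ge := by
    rintro r _ z hz _ ⟨k, rfl⟩ h
    rcases mem_support_randomRounding hz with rfl | rfl
    · exact h.trans (Int.le_ceil r)
    · exact_mod_cast Int.le_floor.2 (by exact_mod_cast h)

open scoped Classical in
/-- The law of what an agent of type `t` receives and is charged for when she is offered a stock `k`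
at price `p`. -/
def sale (ρ : ℝ → PMF ℝ) (t : AgentType) (p k : ℝ) : PMF (ℝ × ℝ) :=
  if p ≤ t.value then
    if k ≤ t.budget / p then PMF.pure (k, k)
    else (ρ (t.budget / p)).map fun z => (z, t.budget / p)
  else PMF.pure (0, 0)

open scoped Classical in
/-- The amount for which an agent of type `t` is charged when she is offered a stock `k` at
price `p`. -/
def charge (t : AgentType) (p k : ℝ) : ℝ := if p ≤ t.value then min (t.budget / p) k else 0

section Sale

variable {ρ : ℝ → PMF ℝ} {Q : ℝ → Prop} {t : AgentType} {p k : ℝ}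

theorem IsRounding.finitelySupported_sale (hρ : IsRounding ρ Q) (t : AgentType) (p k : ℝ) :
    FinitelySupported (sale ρ t p k) := by
  have := hρ.finite
  unfold sale
  infer_instance

theorem min_of_mem {a b : ℝ} (ha : Q a) (hb : Q b) :
    Q (min a b) := by
  rcases min_choice a b with h | h <;> rwa [h]

theorem snd_of_mem_support_sale {z : ℝ × ℝ} (hz : z ∈ (sale ρ t p k).support) :
    z.2 = charge t p k := by
  unfold sale at hz
  unfold charge
  split_ifs at hz ⊢ with h1 h2
  · simp only [PMF.support_pure, Set.mem_singleton_iff] at hz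
    simp [hz, h2]
  · obtain ⟨y, -, rfl⟩ := (PMF.mem_support_map_iff _ _ _).1 hz
    simp [(not_le.1 h2).le]
  · simp only [PMF.support_pure, Set.mem_singleton_iff] at hz
    simp [hz]

theorem charge_nonneg (hp : 0 < p) (hb : 0 ≤ t.budget) (hk : 0 ≤ k) : 0 ≤ charge t p k := by
  unfold charge
  split_ifs
  · exact le_min (div_nonneg hb hp.le) hk
  · exact le_rfl

theorem charge_le (hk : 0 ≤ k) : charge t p k ≤ k := by
  unfold charge
  split_ifs
  · exact min_le_right _ _
  · exact hk

theorem charge_mul_le (hp : 0 < p) (hb : 0 ≤ t.budget) : charge t p k * p ≤ t.budget := by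
  unfold charge
  split_ifs
  · calc min (t.budget / p) k * p ≤ t.budget / p * p :=
        mul_le_mul_of_nonneg_right (min_le_left _ _) hp.le
      _ = t.budget := div_mul_cancel₀ _ hp.ne'
  · simpa using hb

/-- What an agent receives from an admissible stock is admissible, and not more than the stock. -/
theorem IsRounding.fst_of_mem_support_sale (hρ : IsRounding ρ Q) (hp : 0 < p)
    (hb : 0 ≤ t.budget) (hk : Q k) {z : ℝ × ℝ} (hz : z ∈ (sale ρ t p k).support) :
    Q z.1 ∧ z.1 ≤ k := by
  have hr : 0 ≤ t.budget / p := div_nonneg hb hp.le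
  unfold sale at hz
  split_ifs at hz with h1 h2
  · simp only [PMF.support_pure, Set.mem_singleton_iff] at hz
    simp [hz, hk]
  · obtain ⟨y, hy, rfl⟩ := (PMF.mem_support_map_iff _ _ _).1 hz
    exact ⟨hρ.mem _ hr _ hy, hρ.le _ hr _ hy _ hk (not_le.1 h2).le⟩
  · simp only [PMF.support_pure, Set.mem_singleton_iff] at hz
    simp [hz, hρ.zero, hρ.nonneg k hk]

/-- The amount charged is the expectation of the amount received. This remains true when both are
cut off at an admissible amount `c`, since the lottery does not jump over `c`. -/
theorem IsRounding.expectation_sale (hρ : IsRounding ρ Q) (hp : 0 < p) (hb : 0 ≤ t.budget)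
    {c : ℝ} (hc : Q c) :
    expectation (sale ρ t p k) (fun z => min z.1 c) = min (charge t p k) c := by
  have hr : 0 ≤ t.budget / p := div_nonneg hb hp.le
  have := hρ.finite
  unfold sale charge
  split_ifs with h1 h2
  · simp [h2]
  · rw [expectation_map, min_eq_left (not_le.1 h2).le]
    rcases le_total (t.budget / p) c with h | h
    · rw [min_eq_left h]
      refine Eq.trans ?_ (hρ.mean _ hr)
      exact expectation_congr fun z hz => min_eq_left (hρ.le _ hr _ hz _ hc h)
    · rw [min_eq_right h]
      refine (expectation_congr fun z hz => min_eq_right (hρ.ge _ hr _ hz _ hc h)).trans ?_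
      exact expectation_const _ _
  · simp

theorem IsRounding.expectation_sale_fst (hρ : IsRounding ρ Q) (hp : 0 < p) (hb : 0 ≤ t.budget)
    (hk : Q k) : expectation (sale ρ t p k) (fun z => z.1) = charge t p k := by
  have h := hρ.expectation_sale (t := t) (k := k) hp hb hk
  rw [min_eq_left (charge_le (hρ.nonneg k hk))] at h
  rw [← h]
  exact expectation_congr fun z hz => (min_eq_left (hρ.fst_of_mem_support_sale hp hb hk hz).2).symm

end Sale

open scoped Classical in
/-- Sale of the stock `k` at price `p` to the agents of a list, one after the other: the law of the
vectors of amounts received and of amounts charged. -/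
def saleLoop {ι : Type} (ρ : ℝ → PMF ℝ) (θ : ι → AgentType) (p : ℝ) :
    List ι → ℝ → PMF ((ι → ℝ) × (ι → ℝ))
  | [], _ => PMF.pure (0, 0)
  | i :: l, k => (sale ρ (θ i) p k).bind fun z => (saleLoop ρ θ p l (k - z.1)).map fun y =>
      (Function.update y.1 i z.1, Function.update y.2 i z.2)

/-- Sale of the stock `k` at price `p` to the agents of `S` in random order. -/
def saleAlloc {ι : Type} [DecidableEq ι] (ρ : ℝ → PMF ℝ) : AllocationRule ι :=
  fun θ S p k => (randomOrder S).bind fun l => saleLoop ρ θ p l k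

open scoped Classical in
/-- The law of the stock that is left when it is the turn of agent `i`. -/
def stockBefore {ι : Type} (ρ : ℝ → PMF ℝ) (θ : ι → AgentType) (p : ℝ) (i : ι) :
    List ι → ℝ → PMF ℝ
  | [], k => PMF.pure k
  | j :: l, k => if j = i then PMF.pure k else
      (sale ρ (θ j) p k).bind fun z => stockBefore ρ θ p i l (k - z.1)

section Loop

variable {ι : Type} {ρ : ℝ → PMF ℝ} {Q : ℝ → Prop} {θ : ι → AgentType} {p : ℝ}

theorem IsRounding.finitelySupported_saleLoop (hρ : IsRounding ρ Q) (θ : ι → AgentType) (p : ℝ)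
    (l : List ι) : ∀ k, FinitelySupported (saleLoop ρ θ p l k) := by
  have := hρ.finitelySupported_sale
  induction l with
  | nil => intro k; unfold saleLoop; infer_instance
  | cons i l ih => intro k; unfold saleLoop; infer_instance

theorem IsRounding.finitelySupported_stockBefore (hρ : IsRounding ρ Q) (θ : ι → AgentType)
    (p : ℝ) (i : ι) (l : List ι) : ∀ k, FinitelySupported (stockBefore ρ θ p i l k) := by
  have := hρ.finitelySupported_sale
  induction l with
  | nil => intro k; unfold stockBefore; infer_instance
  | cons i l ih => intro k; unfold stockBefore; infer_instance

theorem saleLoop_eq_zero {l : List ι} {i : ι} (hi : i ∉ l) : ∀ {k : ℝ} {y : (ι → ℝ) × (ι → ℝ)},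
    y ∈ (saleLoop ρ θ p l k).support → y.1 i = 0 ∧ y.2 i = 0 := by
  classical
  induction l with
  | nil =>
    intro k y hy
    simp only [saleLoop, PMF.support_pure, Set.mem_singleton_iff] at hy
    simp [hy]
  | cons j l ih =>
    intro k y hy
    simp only [saleLoop, PMF.mem_support_bind_iff, PMF.mem_support_map_iff] at hy
    obtain ⟨z, -, y', hy', rfl⟩ := hy
    have hij : i ≠ j := fun h => hi (h ▸ List.mem_cons_self)
    simp only [Function.update_of_ne hij]
    exact ih (fun h => hi (List.mem_cons_of_mem _ h)) hy'

theorem indivLoop_eq_saleLoop {l : List ι} (hl : l.Nodup) :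
    ∀ k, indivLoop θ p l k = saleLoop randomRounding θ p l k := by
  classical
  induction l with
  | nil => intro k; rfl
  | cons i l ih =>
    intro k
    obtain ⟨hi, hl⟩ := List.nodup_cons.1 hl
    unfold indivLoop saleLoop sale
    split_ifs with h1 h2
    · rw [PMF.pure_bind, ih hl]
      rfl
    · rw [PMF.bind_map]
      simp only [ih hl]
      rfl
    · rw [PMF.pure_bind, ih hl, sub_zero]
      conv_lhs => rw [← PMF.map_id (saleLoop randomRounding θ p l k)]
      refine map_congr_support fun y hy => ?_
      obtain ⟨h3, h4⟩ := saleLoop_eq_zero hi hy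
      exact Prod.ext (Function.update_eq_self_iff.2 h3.symm).symm
        (Function.update_eq_self_iff.2 h4.symm).symm

theorem divLoop_eq_saleLoop {l : List ι} (hl : l.Nodup) :
    ∀ k, PMF.pure (divLoop θ p l k, divLoop θ p l k) = saleLoop PMF.pure θ p l k := by
  classical
  induction l with
  | nil => intro k; rfl
  | cons i l ih =>
    intro k
    obtain ⟨hi, hl⟩ := List.nodup_cons.1 hl
    unfold divLoop saleLoop sale
    split_ifs with h1 h2
    · rw [PMF.pure_bind, ← ih hl, PMF.pure_map, min_eq_right h2]
    · rw [PMF.pure_map, PMF.pure_bind, ← ih hl, PMF.pure_map, min_eq_left (not_le.1 h2).le]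
    · rw [PMF.pure_bind, ← ih hl, sub_zero, PMF.pure_map]
      have h0 : divLoop θ p l k i = 0 := by
        refine (saleLoop_eq_zero (ρ := PMF.pure) (θ := θ) (p := p) (k := k)
          (y := (divLoop θ p l k, divLoop θ p l k)) hi ?_).1
        rw [← ih hl]
        simp
      congr 1
      exact Prod.ext (Function.update_eq_self_iff.2 h0.symm).symm
        (Function.update_eq_self_iff.2 h0.symm).symm

/-- Only the types of the agents in the list matter. -/
theorem saleLoop_congr {θ' : ι → AgentType} {l : List ι} (h : ∀ j ∈ l, θ j = θ' j) :
    ∀ k, saleLoop ρ θ p l k = saleLoop ρ θ' p l k := by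
  induction l with
  | nil => intro k; rfl
  | cons i l ih =>
    intro k
    unfold saleLoop
    rw [h i List.mem_cons_self]
    simp only [ih fun j hj => h j (List.mem_cons_of_mem _ hj)]

/-- Only the types of the other agents matter. -/
theorem stockBefore_congr {θ' : ι → AgentType} {i : ι} {l : List ι}
    (h : ∀ j ∈ l, j ≠ i → θ j = θ' j) :
    ∀ k, stockBefore ρ θ p i l k = stockBefore ρ θ' p i l k := by
  induction l with
  | nil => intro k; rfl
  | cons j l ih =>
    intro k
    unfold stockBefore
    split_ifs with hji
    · rfl
    · rw [h j List.mem_cons_self hji]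
      simp only [ih fun j hj => h j (List.mem_cons_of_mem _ hj)]

/-- The share of agent `i` in a sequential sale: she is offered the stock that is left to her. -/
theorem saleLoop_map_apply {l : List ι} (hl : l.Nodup) {i : ι} (hi : i ∈ l) :
    ∀ k, (saleLoop ρ θ p l k).map (fun y => (y.1 i, y.2 i)) =
      (stockBefore ρ θ p i l k).bind (sale ρ (θ i) p) := by
  classical
  induction l with
  | nil => simp at hi
  | cons j l ih =>
    intro k
    obtain ⟨hj, hl⟩ := List.nodup_cons.1 hl
    unfold saleLoop stockBefore
    rw [PMF.map_bind]
    simp only [PMF.map_comp]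
    by_cases hji : j = i
    · subst hji
      rw [if_pos rfl, PMF.pure_bind]
      conv_rhs => rw [← PMF.bind_pure (sale ρ (θ j) p k)]
      congr 1
      funext z
      have : (fun y : (ι → ℝ) × (ι → ℝ) => (y.1 j, y.2 j)) ∘
          (fun y : (ι → ℝ) × (ι → ℝ) => (Function.update y.1 j z.1, Function.update y.2 j z.2)) =
          Function.const _ z := by
        funext y
        simp
      rw [this, PMF.map_const]
    · rw [if_neg hji, PMF.bind_bind]
      have hi' : i ∈ l := by
        rcases List.mem_cons.1 hi with h | h
        · exact absurd h.symm hji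
        · exact h
      congr 1
      funext z
      rw [← ih hl hi']
      congr 1
      funext y
      have h : i ≠ j := Ne.symm hji
      simp [h]

theorem IsRounding.mem_of_mem_support_stockBefore (hρ : IsRounding ρ Q) (hp : 0 < p)
    (hb : ∀ j, 0 ≤ (θ j).budget) {i : ι} {l : List ι} :
    ∀ {k}, Q k → ∀ k' ∈ (stockBefore ρ θ p i l k).support, Q k' ∧ k' ≤ k := by
  induction l with
  | nil =>
    intro k hk k' hk'
    obtain rfl : k' = k := by simpa [stockBefore] using hk'
    exact ⟨hk, le_rfl⟩
  | cons j l ih =>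
    intro k hk k' hk'
    unfold stockBefore at hk'
    split_ifs at hk' with h
    · obtain rfl : k' = k := by simpa using hk'
      exact ⟨hk, le_rfl⟩
    · obtain ⟨z, hz, hk'⟩ := (PMF.mem_support_bind_iff _ _ _).1 hk'
      obtain ⟨h1, h2⟩ := hρ.fst_of_mem_support_sale hp (hb j) hk hz
      obtain ⟨h3, h4⟩ := ih (hρ.sub _ _ h1 hk h2) k' hk'
      exact ⟨h3, h4.trans (by linarith [hρ.nonneg _ h1])⟩

/-- All amounts received in a sequential sale are admissible, and the stock suffices. -/
theorem IsRounding.of_mem_support_saleLoop (hρ : IsRounding ρ Q) (hp : 0 < p)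
    (hb : ∀ j, 0 ≤ (θ j).budget) {l : List ι} (hl : l.Nodup) :
    ∀ {k}, Q k → ∀ y ∈ (saleLoop ρ θ p l k).support,
      (∀ i, Q (y.1 i)) ∧ (l.map y.1).sum ≤ k := by
  classical
  induction l with
  | nil =>
    intro k hk y hy
    simp only [saleLoop, PMF.support_pure, Set.mem_singleton_iff] at hy
    simp [hy, hρ.zero, hρ.nonneg k hk]
  | cons j l ih =>
    intro k hk y hy
    obtain ⟨hj, hl⟩ := List.nodup_cons.1 hl
    simp only [saleLoop, PMF.mem_support_bind_iff, PMF.mem_support_map_iff] at hy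
    obtain ⟨z, hz, y', hy', rfl⟩ := hy
    obtain ⟨h1, h2⟩ := hρ.fst_of_mem_support_sale hp (hb j) hk hz
    obtain ⟨h3, h4⟩ := ih hl (hρ.sub _ _ h1 hk h2) y' hy'
    constructor
    · intro i
      by_cases hij : i = j
      · subst hij; simpa using h1
      · simpa [Function.update_of_ne hij] using h3 i
    · have : l.map (Function.update y'.1 j z.1) = l.map y'.1 := by
        refine List.map_congr_left fun i hi => Function.update_of_ne ?_ _ _
        rintro rfl
        exact hj hi
      rw [List.map_cons, List.sum_cons, this]
      simp only [Function.update_self]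
      linarith

open scoped Classical in
/-- The sum of `d` over the part of a list before the first occurrence of `i`. -/
def sumBefore (d : ι → ℝ) (i : ι) : List ι → ℝ
  | [] => 0
  | j :: l => if j = i then 0 else d j + sumBefore d i l

open scoped Classical in
/-- The demand of agent `j` at price `p`. -/
def demand (θ : ι → AgentType) (p : ℝ) (j : ι) : ℝ :=
  if p ≤ (θ j).value then (θ j).budget / p else 0

theorem demand_nonneg (hp : 0 < p) (hb : ∀ j, 0 ≤ (θ j).budget) (j : ι) : 0 ≤ demand θ p j := by
  unfold demand
  split_ifs
  · exact div_nonneg (hb j) hp.le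
  · exact le_rfl

theorem charge_le_demand (j : ι) (k : ℝ) : charge (θ j) p k ≤ demand θ p j := by
  unfold charge demand
  split_ifs
  · exact min_le_left _ _
  · exact le_rfl

/-- On average, the agents before `i` reduce the stock at most by their demand. -/
theorem IsRounding.sub_sumBefore_le (hρ : IsRounding ρ Q) (hp : 0 < p)
    (hb : ∀ j, 0 ≤ (θ j).budget) {i : ι} {l : List ι} :
    ∀ {k}, Q k → k - sumBefore (demand θ p) i l ≤
      expectation (stockBefore ρ θ p i l k) fun k' => k' := by
  have := hρ.finitelySupported_sale
  have := hρ.finitelySupported_stockBefore (ι := ι)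
  induction l with
  | nil => intro k hk; simp [stockBefore, sumBefore]
  | cons j l ih =>
    intro k hk
    unfold stockBefore sumBefore
    split_ifs with h
    · simp
    · rw [expectation_bind]
      have h1 : expectation (sale ρ (θ j) p k)
          (fun z => k - z.1 - sumBefore (demand θ p) i l) ≤ expectation (sale ρ (θ j) p k)
          (fun z => expectation (stockBefore ρ θ p i l (k - z.1)) fun k' => k') := by
        refine expectation_mono fun z hz => ih ?_
        obtain ⟨h1, h2⟩ := hρ.fst_of_mem_support_sale hp (hb j) hk hz
        exact hρ.sub _ _ h1 hk h2
      refine le_trans ?_ h1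
      rw [expectation_sub, expectation_sub, expectation_const, expectation_const,
        hρ.expectation_sale_fst hp (hb j) hk]
      linarith [charge_le_demand (θ := θ) (p := p) j k]

end Loop

/-! ### Random order -/

section RandomOrder

variable {α : Type} [Fintype α] [DecidableEq α] {K : ℕ} [Nonempty (Fin K ≃ α)]

theorem expectation_position (hK : 0 < K) (i : α) (s : Fin K) :
    expectation (PMF.uniformOfFintype (Fin K ≃ α)) (fun π => if π s = i then (1 : ℝ) else 0) =
      1 / K := by
  set A : Fin K → ℝ := fun s => expectation (PMF.uniformOfFintype (Fin K ≃ α))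
    (fun π => if π s = i then (1 : ℝ) else 0) with hA
  have h1 : ∀ s', A s' = A s := by
    intro s'
    have := expectation_uniform_equiv (Equiv.equivCongr (Equiv.swap s' s) (Equiv.refl α))
      (fun π : Fin K ≃ α => if π s = i then (1 : ℝ) else 0)
    simpa [hA] using this
  have h2 : ∑ s', A s' = 1 := by
    rw [hA, ← expectation_sum]
    refine (expectation_congr fun π _ => ?_).trans
      (expectation_const (PMF.uniformOfFintype (Fin K ≃ α)) 1)
    rw [Finset.sum_eq_single (π.symm i)]
    · simp
    · intro t _ ht
      rw [if_neg]
      rintro rfl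
      simp at ht
    · simp
  simp only [h1, Finset.sum_const, Finset.card_univ, Fintype.card_fin, nsmul_eq_mul] at h2
  have : (K : ℝ) ≠ 0 := by positivity
  field_simp
  linarith

theorem expectation_two_positions (i : α) (d : α → ℝ) (s t : Fin K) (hst : t ≠ s) :
    expectation (PMF.uniformOfFintype (Fin K ≃ α))
      (fun π => if π s = i then d (π t) else 0) =
      (∑ j ∈ Finset.univ.erase i, d j) / (K * (K - 1)) := by
  have hK : 1 < K := by
    by_contra h
    have : K = 0 ∨ K = 1 := by omega
    rcases this with rfl | rfl
    · exact s.elim0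
    · exact hst (Subsingleton.elim _ _)
  set B : Fin K → ℝ := fun t => expectation (PMF.uniformOfFintype (Fin K ≃ α))
    (fun π => if π s = i then d (π t) else 0) with hB
  have h1 : ∀ t' ∈ Finset.univ.erase s, B t' = B t := by
    intro t' ht'
    have ht' := Finset.ne_of_mem_erase ht'
    have := expectation_uniform_equiv (Equiv.equivCongr (Equiv.swap t' t) (Equiv.refl α))
      (fun π : Fin K ≃ α => if π s = i then d (π t) else 0)
    simpa [hB, Equiv.swap_apply_of_ne_of_ne ht'.symm hst.symm] using this
  have h2 : ∑ t' ∈ Finset.univ.erase s, B t' = (∑ j ∈ Finset.univ.erase i, d j) * (1 / K) := by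
    rw [hB, ← expectation_sum, ← expectation_position (by omega) i s, ← expectation_const_mul]
    congr 1
    funext π
    split_ifs with h
    · rw [mul_one]
      refine Finset.sum_bij (fun t _ => π t) ?_ ?_ ?_ ?_
      · intro t ht
        simp only [Finset.mem_erase, Finset.mem_univ, and_true, ne_eq] at ht ⊢
        rwa [← h, EmbeddingLike.apply_eq_iff_eq]
      · intro a _ b _ hab
        exact π.injective hab
      · intro j hj
        refine ⟨π.symm j, ?_, by simp⟩
        simp only [Finset.mem_erase, Finset.mem_univ, and_true, ne_eq] at hj ⊢
        rintro rfl
        exact hj (by rw [← h]; simp)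
      · intro t _
        rfl
    · simp
  rw [Finset.sum_congr rfl h1, Finset.sum_const, Finset.card_erase_of_mem (Finset.mem_univ _),
    Finset.card_univ, Fintype.card_fin, nsmul_eq_mul, Nat.cast_sub hK.le, Nat.cast_one] at h2
  have h3 : (K : ℝ) ≠ 0 := by positivity
  have h4 : (K : ℝ) - 1 ≠ 0 := by
    have : (1 : ℝ) < K := by exact_mod_cast hK
    linarith
  change B t = _
  field_simp at h2 ⊢
  linarith

/-- Lower bound for the expected part of a unit stock that is left to `i` when the others take `d`.
If `i` is in place `s`, those before her have expected weight `s / (K - 1)` times the weight of all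
others; the orders in which `s > L` are estimated by `0`. -/
theorem sum_le_expectation_order (i : α) (d : α → ℝ) (L : ℕ) (hL : L < K) :
    (((L : ℝ) + 1) - (∑ j ∈ Finset.univ.erase i, d j) / (K - 1) * (L * (L + 1) / 2)) / K ≤
      expectation (PMF.uniformOfFintype (Fin K ≃ α)) fun π =>
        max 0 (1 - ∑ t with t < π.symm i, d (π t)) := by
  set D := ∑ j ∈ Finset.univ.erase i, d j with hD
  have hK : 0 < K := by omega
  have h1 : expectation (PMF.uniformOfFintype (Fin K ≃ α)) (fun π =>
      ∑ s with s.val ≤ L, ((if π s = i then (1 : ℝ) else 0) -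
        ∑ t with t < s, if π s = i then d (π t) else 0)) ≤
      expectation (PMF.uniformOfFintype (Fin K ≃ α)) fun π =>
        max 0 (1 - ∑ t with t < π.symm i, d (π t)) := by
    refine expectation_mono fun π _ => ?_
    have h : ∀ s : Fin K, ((if π s = i then (1 : ℝ) else 0) -
        ∑ t with t < s, if π s = i then d (π t) else 0) =
        if s = π.symm i then 1 - ∑ t with t < π.symm i, d (π t) else 0 := by
      intro s
      by_cases hs : π s = i
      · have : s = π.symm i := by rw [← hs]; simp
        subst this
        simp
      · have : s ≠ π.symm i := by
          rintro rfl
          simp at hs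
        simp [hs, this]
    simp only [h]
    rw [Finset.sum_ite_eq']
    split_ifs
    · exact le_max_right _ _
    · exact le_max_left _ _
  refine le_trans (le_of_eq ?_) h1
  rw [expectation_sum]
  have h2 : ∀ s : Fin K, expectation (PMF.uniformOfFintype (Fin K ≃ α)) (fun π =>
      (if π s = i then (1 : ℝ) else 0) - ∑ t with t < s, if π s = i then d (π t) else 0) =
      1 / K - (s : ℕ) * (D / (K * (K - 1))) := by
    intro s
    rw [expectation_sub, expectation_position hK, expectation_sum]
    congr 1
    rw [Finset.sum_congr rfl fun t ht =>
      expectation_two_positions i d s t (ne_of_lt (Finset.mem_filter.1 ht).2)]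
    rw [Finset.sum_const, nsmul_eq_mul]
    congr 2
    rw [← Fin.card_Iio s]
    congr 1
    ext t
    simp
  simp only [h2]
  have h3 : ∑ s : Fin K with s.val ≤ L, (1 / (K : ℝ) - (s : ℕ) * (D / (K * (K - 1)))) =
      ∑ s ∈ Finset.range (L + 1), (1 / (K : ℝ) - (s : ℕ) * (D / (K * (K - 1)))) := by
    refine Finset.sum_bij (fun s _ => s.val) ?_ ?_ ?_ ?_
    · intro s hs
      simp only [Finset.mem_filter, Finset.mem_univ, true_and] at hs
      simp only [Finset.mem_range]
      omega
    · intro a _ b _ hab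
      exact Fin.ext hab
    · intro s hs
      simp only [Finset.mem_range] at hs
      exact ⟨⟨s, by omega⟩, by simp; omega, rfl⟩
    · intro s _
      rfl
  have h4 : ∑ s ∈ Finset.range (L + 1), (s : ℝ) = L * (L + 1) / 2 := by
    have := Finset.sum_range_id_mul_two (L + 1)
    have h5 : ((∑ s ∈ Finset.range (L + 1), s : ℕ) : ℝ) * 2 = (L + 1) * L := by
      exact_mod_cast this
    push_cast at h5
    linarith
  rw [h3, Finset.sum_sub_distrib, ← Finset.sum_mul, h4, Finset.sum_const, Finset.card_range,
    nsmul_eq_mul]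
  push_cast
  have h5 : (K : ℝ) ≠ 0 := by positivity
  rcases eq_or_ne ((K : ℝ) - 1) 0 with h6 | h6
  · rw [h6]; simp; field_simp
  · field_simp

/-- If a stock is sold in a uniformly random order to a set of total demand `D` (in units of the
stock), the expected share of the stock left to `i` is at least `1 / (2 max(D, 1))`. -/
theorem inv_le_expectation_order (i : α) (d : α → ℝ) (hK : 0 < K) :
    1 / (2 * max (∑ j ∈ Finset.univ.erase i, d j) 1) ≤
      expectation (PMF.uniformOfFintype (Fin K ≃ α)) fun π =>
        max 0 (1 - ∑ t with t < π.symm i, d (π t)) := by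
  set D := ∑ j ∈ Finset.univ.erase i, d j with hD
  set C := max D 1 with hC
  have hC1 : 1 ≤ C := le_max_right _ _
  have hC0 : 0 < C := by linarith
  have hk : (0 : ℝ) ≤ (K : ℝ) - 1 := by
    have : (1 : ℝ) ≤ K := by exact_mod_cast hK
    linarith
  -- the places up to `(K - 1) / C` are those reached before the stock is exhausted on average
  set L := ⌊((K : ℝ) - 1) / C⌋₊ with hLdef
  have hL1 : (L : ℝ) ≤ ((K : ℝ) - 1) / C := Nat.floor_le (div_nonneg hk hC0.le)
  have hL2 : ((K : ℝ) - 1) / C < L + 1 := Nat.lt_floor_add_one _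
  have hL : L < K := by
    have : (L : ℝ) < K := by
      have : ((K : ℝ) - 1) / C ≤ (K : ℝ) - 1 := div_le_self hk hC1
      linarith
    exact_mod_cast this
  refine le_trans ?_ (sum_le_expectation_order i d L hL)
  have hK0 : (0 : ℝ) < K := by exact_mod_cast hK
  rw [le_div_iff₀ hK0]
  have hL0 : (0 : ℝ) ≤ L := Nat.cast_nonneg _
  rcases hk.eq_or_lt with h | h
  · have h0 : (L : ℝ) = 0 := by
      rw [← h, zero_div] at hL1
      linarith
    rw [h0]
    have : (K : ℝ) = 1 := by linarith
    rw [this]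
    simp only [mul_one, zero_add, zero_div, mul_zero, sub_zero]
    rw [div_le_one (by positivity)]
    linarith
  · set u := ((K : ℝ) - 1) / C with hu
    have hu0 : 0 < u := div_pos h hC0
    have h1 : D / ((K : ℝ) - 1) ≤ 1 / u := by
      rw [hu, one_div_div]
      exact div_le_div_of_nonneg_right (le_max_left _ _) h.le
    have h2 : 1 / (2 * C) * K ≤ (u + 1) / 2 := by
      have h3 : (K : ℝ) = u * C + 1 := by
        rw [hu]
        field_simp
        ring
      rw [h3]
      have h4 : 1 / (2 * C) * (u * C + 1) = (u + 1 / C) / 2 := by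
        field_simp
      have h5 : 1 / C ≤ 1 := (div_le_one hC0).2 hC1
      rw [h4]
      linarith
    have h3 : D / ((K : ℝ) - 1) * (L * (L + 1) / 2) ≤ 1 / u * (L * (L + 1) / 2) :=
      mul_le_mul_of_nonneg_right h1 (by positivity)
    have h4 : (u + 1) / 2 ≤ (L + 1) - 1 / u * (L * (L + 1) / 2) := by
      have h5 : (L + 1) - 1 / u * (L * (L + 1) / 2) - (u + 1) / 2 =
          ((u - L) * (1 - (u - L))) / (2 * u) := by
        field_simp
        ring
      have h6 : 0 ≤ ((u - L) * (1 - (u - L))) / (2 * u) :=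
        div_nonneg (mul_nonneg (by linarith) (by linarith)) (by linarith)
      linarith
    linarith

end RandomOrder

section Order

variable {ι : Type}

theorem sumBefore_ofFn (d : ι → ℝ) (i : ι) : ∀ {K : ℕ} (f : Fin K → ι), Function.Injective f →
    ∀ s, f s = i → sumBefore d i (List.ofFn f) = ∑ t with t < s, d (f t) := by
  intro K
  induction K with
  | zero => intro f _ s; exact s.elim0
  | succ K ih =>
    intro f hf s hs
    rw [List.ofFn_succ, sumBefore]
    rw [Finset.sum_filter, Fin.sum_univ_succ]
    refine Fin.cases ?_ (fun s => ?_) s hs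
    · intro h
      simp [h]
    · intro h
      have h0 : f 0 ≠ i := by
        rw [← h]
        exact fun h' => (Fin.succ_ne_zero s).symm (hf h')
      rw [if_neg h0, ih (fun t => f t.succ) (hf.comp (Fin.succ_injective K)) s h,
        if_pos (Fin.succ_pos s), Finset.sum_filter]
      simp only [Fin.succ_lt_succ_iff]

variable [DecidableEq ι]

instance (S : Finset ι) : FinitelySupported (randomOrder S) := ⟨finite_support_randomOrder S⟩

theorem of_mem_support_randomOrder {S : Finset ι} {l : List ι}
    (hl : l ∈ (randomOrder S).support) : l.Nodup ∧ ∀ j, j ∈ l ↔ j ∈ S := by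
  unfold randomOrder at hl
  obtain ⟨π, -, rfl⟩ := (PMF.mem_support_map_iff _ _ _).1 hl
  constructor
  · rw [List.nodup_ofFn]
    exact fun a b h => π.injective (Subtype.ext h)
  · intro j
    rw [List.mem_ofFn]
    constructor
    · rintro ⟨t, rfl⟩
      exact (π t).2
    · intro hj
      exact ⟨π.symm ⟨j, hj⟩, by simp⟩

theorem inv_le_expectation_randomOrder {S : Finset ι} {i : ι} (hi : i ∈ S) (d : ι → ℝ) :
    1 / (2 * max (∑ j ∈ S.erase i, d j) 1) ≤
      expectation (randomOrder S) fun l => max 0 (1 - sumBefore d i l) := by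
  have : Nonempty (Fin S.card ≃ S) := ⟨S.equivFin.symm⟩
  have h := inv_le_expectation_order (K := S.card) (⟨i, hi⟩ : S) (fun j => d j)
    (Finset.card_pos.2 ⟨i, hi⟩)
  unfold randomOrder
  rw [expectation_map]
  have h1 : ∑ j ∈ Finset.univ.erase (⟨i, hi⟩ : S), d j = ∑ j ∈ S.erase i, d j := by
    rw [Finset.sum_erase_eq_sub (Finset.mem_univ _), Finset.sum_erase_eq_sub hi,
      Finset.sum_coe_sort S d]
  rw [h1] at h
  refine h.trans (le_of_eq (expectation_congr fun π _ => ?_))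
  rw [sumBefore_ofFn d i (fun t => (π t : ι)) (fun a b h => π.injective (Subtype.ext h))
    (π.symm ⟨i, hi⟩) (by simp)]

end Order

/-! ### The allocation procedures -/

section Alloc

variable {ι : Type} [DecidableEq ι] {ρ : ℝ → PMF ℝ} {Q : ℝ → Prop} {θ : ι → AgentType} {p : ℝ}

theorem indivAlloc_eq_saleAlloc : indivAlloc (ι := ι) = saleAlloc randomRounding := by
  funext θ S p k
  exact bind_congr_support fun l hl =>
    indivLoop_eq_saleLoop (of_mem_support_randomOrder hl).1 k

theorem divAlloc_eq_saleAlloc : divAlloc (ι := ι) = saleAlloc PMF.pure := by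
  funext θ S p k
  exact bind_congr_support fun l hl => divLoop_eq_saleLoop (of_mem_support_randomOrder hl).1 k

theorem IsRounding.finitelySupported_saleAlloc (hρ : IsRounding ρ Q) (θ : ι → AgentType)
    (S : Finset ι) (p k : ℝ) : FinitelySupported (saleAlloc ρ θ S p k) := by
  have := hρ.finitelySupported_saleLoop (ι := ι)
  unfold saleAlloc
  infer_instance

theorem saleAlloc_congr {θ' : ι → AgentType} {S : Finset ι} (h : ∀ j ∈ S, θ j = θ' j) (k : ℝ) :
    saleAlloc ρ θ S p k = saleAlloc ρ θ' S p k :=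
  bind_congr_support fun _ hl =>
    saleLoop_congr (fun j hj => h j (((of_mem_support_randomOrder hl).2 j).1 hj)) k

theorem IsRounding.of_mem_support_saleAlloc (hρ : IsRounding ρ Q) (hp : 0 < p)
    (hb : ∀ j, 0 ≤ (θ j).budget) {S : Finset ι} {k : ℝ} (hk : Q k) {y : (ι → ℝ) × (ι → ℝ)}
    (hy : y ∈ (saleAlloc ρ θ S p k).support) : (∀ i, Q (y.1 i)) ∧ ∑ i ∈ S, y.1 i ≤ k := by
  obtain ⟨l, hl, hy⟩ := (PMF.mem_support_bind_iff _ _ _).1 hy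
  obtain ⟨h1, h2⟩ := of_mem_support_randomOrder hl
  obtain ⟨h3, h4⟩ := hρ.of_mem_support_saleLoop hp hb h1 hk y hy
  refine ⟨h3, ?_⟩
  have : l.toFinset = S := by
    ext j
    simp [h2]
  rwa [← this, List.sum_toFinset _ h1]

/-- The law of the stock that is left to agent `i` when `k` items are sold to the agents of `S` in
random order. -/
def stockFor (ρ : ℝ → PMF ℝ) (θ : ι → AgentType) (S : Finset ι) (p : ℝ) (i : ι) (k : ℝ) :
    PMF ℝ :=
  (randomOrder S).bind fun l => stockBefore ρ θ p i l k

theorem IsRounding.finitelySupported_stockFor (hρ : IsRounding ρ Q) (θ : ι → AgentType)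
    (S : Finset ι) (p : ℝ) (i : ι) (k : ℝ) : FinitelySupported (stockFor ρ θ S p i k) := by
  have := hρ.finitelySupported_stockBefore (ι := ι)
  unfold stockFor
  infer_instance

theorem stockFor_congr {θ' : ι → AgentType} {S : Finset ι} {i : ι}
    (h : ∀ j ∈ S, j ≠ i → θ j = θ' j) (k : ℝ) :
    stockFor ρ θ S p i k = stockFor ρ θ' S p i k :=
  bind_congr_support fun _ hl =>
    stockBefore_congr (fun j hj => h j (((of_mem_support_randomOrder hl).2 j).1 hj)) k

theorem IsRounding.of_mem_support_stockFor (hρ : IsRounding ρ Q) (hp : 0 < p)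
    (hb : ∀ j, 0 ≤ (θ j).budget) {S : Finset ι} {i : ι} {k : ℝ} (hk : Q k) {k' : ℝ}
    (hk' : k' ∈ (stockFor ρ θ S p i k).support) : Q k' ∧ k' ≤ k := by
  obtain ⟨l, -, hk'⟩ := (PMF.mem_support_bind_iff _ _ _).1 hk'
  exact hρ.mem_of_mem_support_stockBefore hp hb hk k' hk'

/-- The share of agent `i` in an allocation depends on her own report only through what she does
with the stock that is left to her. -/
theorem saleAlloc_map_apply {S : Finset ι} {i : ι} (hi : i ∈ S) (k : ℝ) :
    (saleAlloc ρ θ S p k).map (fun y => (y.1 i, y.2 i)) =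
      (stockFor ρ θ S p i k).bind (sale ρ (θ i) p) := by
  unfold saleAlloc stockFor
  rw [PMF.map_bind, PMF.bind_bind]
  refine bind_congr_support fun l hl => ?_
  obtain ⟨h1, h2⟩ := of_mem_support_randomOrder hl
  exact saleLoop_map_apply h1 ((h2 i).2 hi) k

theorem IsRounding.inv_le_expectation_stockFor (hρ : IsRounding ρ Q) (hp : 0 < p)
    (hb : ∀ j, 0 ≤ (θ j).budget) {S : Finset ι} {i : ι} (hi : i ∈ S) {M : ℝ} (hM : 0 < M)
    (hQ : Q M) :
    1 / (2 * max ((∑ j ∈ S.erase i, demand θ p j) / M) 1) ≤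
      expectation (stockFor ρ θ S p i M) fun k => k / M := by
  have := hρ.finitelySupported_stockBefore (ι := ι)
  have h := inv_le_expectation_randomOrder hi (fun j => demand θ p j / M)
  rw [← Finset.sum_div] at h
  refine h.trans ?_
  unfold stockFor
  rw [expectation_bind]
  refine expectation_mono fun l _ => max_le ?_ ?_
  · exact expectation_nonneg fun k hk => div_nonneg
      (hρ.nonneg _ (hρ.mem_of_mem_support_stockBefore hp hb hQ k hk).1) hM.le
  · have h1 := hρ.sub_sumBefore_le hp hb (i := i) (l := l) hQ
    have h2 : ∀ l : List ι, sumBefore (fun j => demand θ p j / M) i l =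
        sumBefore (demand θ p) i l / M := by
      intro l
      induction l with
      | nil => simp [sumBefore]
      | cons j l ih =>
        unfold sumBefore
        split_ifs
        · simp
        · rw [ih]; ring
    simp only [div_eq_mul_inv, expectation_mul_const]
    rw [← div_eq_mul_inv, le_div_iff₀ hM]
    simp only [← div_eq_mul_inv]
    rw [h2, sub_mul, div_mul_cancel₀ _ hM.ne']
    linarith

/-- Expected amount received by an agent who is added to the set `X`: at least half of her demand
if the stock `M` covers the demand of `X`, and in general half of the corresponding fraction. -/
theorem IsRounding.demand_div_le_expectation (hρ : IsRounding ρ Q) (hp : 0 < p)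
    (hb : ∀ j, 0 ≤ (θ j).budget) {X : Finset ι} {i : ι} (hi : i ∉ X) {M : ℝ} (hM : 0 < M)
    (hQ : Q M) (hiM : demand θ p i ≤ M) :
    demand θ p i / (2 * max ((∑ j ∈ X, demand θ p j) / M) 1) ≤
      expectation (saleAlloc ρ θ (insert i X) p M) fun y => y.1 i := by
  have := hρ.finitelySupported_saleAlloc (ι := ι)
  have := hρ.finitelySupported_stockFor (ι := ι)
  have := hρ.finitelySupported_sale
  have h1 : expectation (saleAlloc ρ θ (insert i X) p M) (fun y => y.1 i) =
      expectation ((saleAlloc ρ θ (insert i X) p M).map fun y => (y.1 i, y.2 i)) fun z => z.1 := by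
    rw [expectation_map]
  rw [h1, saleAlloc_map_apply (Finset.mem_insert_self i X), expectation_bind]
  have h2 := hρ.inv_le_expectation_stockFor hp hb (Finset.mem_insert_self i X) hM hQ
  rw [Finset.erase_insert hi] at h2
  have h3 : demand θ p i * expectation (stockFor ρ θ (insert i X) p i M) (fun k => k / M) ≤
      expectation (stockFor ρ θ (insert i X) p i M)
        fun k => expectation (sale ρ (θ i) p k) fun z => z.1 := by
    rw [← expectation_const_mul]
    refine expectation_mono fun k hk => ?_
    obtain ⟨h4, h5⟩ := hρ.of_mem_support_stockFor hp hb hQ hk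
    rw [hρ.expectation_sale_fst hp (hb i) h4]
    have h6 := hρ.nonneg _ h4
    have h7 := demand_nonneg hp hb i
    -- `min (δ, k)` is concave in `k`
    have h8 : demand θ p i * (k / M) ≤ min (demand θ p i) k := by
      refine le_min ?_ ?_
      · exact mul_le_of_le_one_right h7 ((div_le_one hM).2 h5)
      · calc demand θ p i * (k / M) ≤ M * (k / M) :=
            mul_le_mul_of_nonneg_right hiM (div_nonneg h6 hM.le)
          _ = k := mul_div_cancel₀ _ hM.ne'
    refine h8.trans ?_
    unfold demand charge
    split_ifs
    · exact le_rfl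
    · exact min_le_left _ _
  refine le_trans ?_ h3
  rw [div_eq_mul_one_div]
  exact mul_le_mul_of_nonneg_left h2 (demand_nonneg hp hb i)

end Alloc

/-! ### The revenue collection phase -/

theorem PricingRule.price_congr {ι : Type} (P : PricingRule ι) {θ θ' : ι → AgentType}
    {S : Finset ι} (h : ∀ j ∈ S, θ j = θ' j) : P.price θ S = P.price θ' S := by
  unfold PricingRule.price
  congr 1
  funext j
  exact h j j.2

section Collection

variable {ι : Type} [DecidableEq ι]

/-- The law of the two stocks after the agents of a list have been served in the revenue collection
phase. -/
def stocksAfter (m : ℝ) (P : PricingRule ι) (alloc : AllocationRule ι) (θ : ι → AgentType)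
    (A₁ A₂' : Finset ι) : List ι → ℝ → ℝ → PMF (ℝ × ℝ)
  | [], m₁, m₂ => PMF.pure (m₁, m₂)
  | i :: l, m₁, m₂ => (PMF.uniformOfFintype Bool).bind fun heads =>
      if heads then
        (alloc θ (insert i A₁) (P.price θ A₂') (m / 4)).bind fun x' =>
          stocksAfter m P alloc θ A₁ A₂' l (m₁ - min (x'.1 i) m₁) m₂
      else
        (alloc θ (insert i A₂') (P.price θ A₁) (m / 4)).bind fun x' =>
          stocksAfter m P alloc θ A₁ A₂' l m₁ (m₂ - min (x'.1 i) m₂)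

/-- The law of what agent `i` receives and pays when she adds herself to the set `X` at price `p`
and is served from a remaining stock `c`. -/
def offer (m : ℝ) (alloc : AllocationRule ι) (θ : ι → AgentType) (X : Finset ι) (p : ℝ) (i : ι)
    (c : ℝ) : PMF (ℝ × ℝ) :=
  (alloc θ (insert i X) p (m / 4)).map fun x => (min (x.1 i) c, min (x.2 i) c * p)

/-- The law of what agent `i` receives and pays in the revenue collection phase, given the remaining
stocks. -/
def collectionOffer (m : ℝ) (P : PricingRule ι) (alloc : AllocationRule ι) (θ : ι → AgentType)
    (A₁ A₂' : Finset ι) (i : ι) (s : ℝ × ℝ) : PMF (ℝ × ℝ) :=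
  (PMF.uniformOfFintype Bool).bind fun heads =>
    if heads then offer m alloc θ A₁ (P.price θ A₂') i s.1
    else offer m alloc θ A₂' (P.price θ A₁) i s.2

variable {m : ℝ} {P : PricingRule ι} {alloc : AllocationRule ι} {θ : ι → AgentType}
  {A₁ A₂' : Finset ι}

theorem finitelySupported_collectionPhase [h : ∀ θ S p k, FinitelySupported (alloc θ S p k)]
    (l : List ι) (m₁ m₂ : ℝ) :
    FinitelySupported (collectionPhase m P alloc θ A₁ A₂' l m₁ m₂) :=
  ⟨finite_support_collectionPhase m P alloc (fun θ S p k => (h θ S p k).finite) θ A₁ A₂' l m₁ m₂⟩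

theorem finitelySupported_stocksAfter [h : ∀ θ S p k, FinitelySupported (alloc θ S p k)]
    (l : List ι) : ∀ m₁ m₂ : ℝ, FinitelySupported (stocksAfter m P alloc θ A₁ A₂' l m₁ m₂) := by
  induction l with
  | nil => intro m₁ m₂; unfold stocksAfter; infer_instance
  | cons i l ih => intro m₁ m₂; unfold stocksAfter; infer_instance

theorem finitelySupported_collectionOffer [h : ∀ θ S p k, FinitelySupported (alloc θ S p k)]
    (i : ι) (s : ℝ × ℝ) : FinitelySupported (collectionOffer m P alloc θ A₁ A₂' i s) := by
  unfold collectionOffer offer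
  infer_instance

theorem map_update_of_notMem {f : ι → ℝ} {i : ι} {l : List ι} (hi : i ∉ l) (a : ℝ) :
    l.map (Function.update f i a) = l.map f := by
  refine List.map_congr_left fun j hj => Function.update_of_ne ?_ _ _
  rintro rfl
  exact hi hj

/-- All amounts handed out in the revenue collection phase are admissible, and the stocks
suffice. -/
theorem IsRounding.of_mem_support_collectionPhase {ρ : ℝ → PMF ℝ} {Q : ℝ → Prop}
    (hρ : IsRounding ρ Q) (hb : ∀ j, 0 ≤ (θ j).budget) (hQ : Q (m / 4))
    (hp₁ : 0 < P.price θ A₁) (hp₂ : 0 < P.price θ A₂') {l : List ι} (hl : l.Nodup) :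
    ∀ {m₁ m₂ : ℝ}, Q m₁ → Q m₂ → ∀ {y : (ι → ℝ) × (ι → ℝ)},
      y ∈ (collectionPhase m P (saleAlloc ρ) θ A₁ A₂' l m₁ m₂).support →
      (∀ i, Q (y.1 i)) ∧ (l.map y.1).sum ≤ m₁ + m₂ := by
  induction l with
  | nil =>
    intro m₁ m₂ h₁ h₂ y hy
    simp only [collectionPhase, PMF.support_pure, Set.mem_singleton_iff] at hy
    simp [hy, hρ.zero, add_nonneg (hρ.nonneg _ h₁) (hρ.nonneg _ h₂)]
  | cons j l ih =>
    intro m₁ m₂ h₁ h₂ y hy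
    obtain ⟨hj, hl⟩ := List.nodup_cons.1 hl
    unfold collectionPhase at hy
    obtain ⟨c, -, hy⟩ := (PMF.mem_support_bind_iff _ _ _).1 hy
    split_ifs at hy <;>
    · simp only [PMF.mem_support_bind_iff, PMF.mem_support_pure_iff] at hy
      obtain ⟨x, hx, y', hy', rfl⟩ := hy
      have hx := (hρ.of_mem_support_saleAlloc (by assumption) hb hQ hx).1 j
      have hmin₁ := min_of_mem hx h₁
      have hmin₂ := min_of_mem hx h₂
      obtain ⟨h3, h4⟩ := ih hl (by
          first
          | exact h₁
          | exact hρ.sub _ _ hmin₁ h₁ (min_le_right _ _)) (by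
          first
          | exact h₂
          | exact hρ.sub _ _ hmin₂ h₂ (min_le_right _ _)) hy'
      refine ⟨fun i => ?_, ?_⟩
      · by_cases hij : i = j
        · subst hij
          simp only [Function.update_self]
          assumption
        · simpa only [Function.update_of_ne hij] using h3 i
      · simp only [List.map_cons, List.sum_cons, Function.update_self, map_update_of_notMem hj]
        linarith

/-- The share of agent `i` in the revenue collection phase depends on the agents before her only
through the remaining stocks, and does not depend on the agents after her. -/
theorem collectionPhase_map_apply {i : ι} {l₁ l₂ : List ι} (hi : i ∉ l₁) :
    ∀ m₁ m₂ : ℝ, (collectionPhase m P alloc θ A₁ A₂' (l₁ ++ i :: l₂) m₁ m₂).map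
        (fun y => (y.1 i, y.2 i)) =
      (stocksAfter m P alloc θ A₁ A₂' l₁ m₁ m₂).bind
        (collectionOffer m P alloc θ A₁ A₂' i) := by
  induction l₁ with
  | nil =>
    intro m₁ m₂
    rw [List.nil_append, stocksAfter, PMF.pure_bind, collectionPhase, collectionOffer,
      PMF.map_bind]
    congr 1
    funext c
    split_ifs <;>
    · rw [PMF.map_bind, offer, PMF.map]
      congr 1
      funext x
      rw [PMF.map_bind]
      simp only [PMF.pure_map, Function.update_self]
      rw [PMF.bind_const]
      rfl
  | cons j l ih =>
    intro m₁ m₂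
    have hij : i ≠ j := fun h => hi (h ▸ List.mem_cons_self)
    have hil : i ∉ l := fun h => hi (List.mem_cons_of_mem _ h)
    rw [List.cons_append, stocksAfter, collectionPhase, PMF.map_bind, PMF.bind_bind]
    congr 1
    funext c
    split_ifs <;>
    · rw [PMF.map_bind, PMF.bind_bind]
      congr 1
      funext x
      rw [← ih hil, PMF.map_bind, PMF.map]
      simp only [PMF.pure_map, Function.update_of_ne hij]
      rfl

theorem stocksAfter_append (l₁ l₂ : List ι) : ∀ m₁ m₂ : ℝ,
    stocksAfter m P alloc θ A₁ A₂' (l₁ ++ l₂) m₁ m₂ =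
      (stocksAfter m P alloc θ A₁ A₂' l₁ m₁ m₂).bind fun s =>
        stocksAfter m P alloc θ A₁ A₂' l₂ s.1 s.2 := by
  induction l₁ with
  | nil => intro m₁ m₂; rw [List.nil_append, stocksAfter, PMF.pure_bind]
  | cons j l ih =>
    intro m₁ m₂
    rw [List.cons_append, stocksAfter, stocksAfter, PMF.bind_bind]
    congr 1
    funext c
    split_ifs <;> simp only [PMF.bind_bind, ih]

theorem stocksAfter_congr {ρ : ℝ → PMF ℝ} {θ' : ι → AgentType} (h₁ : ∀ j ∈ A₁, θ j = θ' j)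
    (h₂ : ∀ j ∈ A₂', θ j = θ' j) {l : List ι} (h : ∀ j ∈ l, θ j = θ' j) : ∀ m₁ m₂ : ℝ,
    stocksAfter m P (saleAlloc ρ) θ A₁ A₂' l m₁ m₂ =
      stocksAfter m P (saleAlloc ρ) θ' A₁ A₂' l m₁ m₂ := by
  induction l with
  | nil => intro m₁ m₂; rfl
  | cons j l ih =>
    intro m₁ m₂
    have hj := h j List.mem_cons_self
    rw [stocksAfter, stocksAfter, P.price_congr h₁, P.price_congr h₂]
    simp only [ih fun i hi => h i (List.mem_cons_of_mem _ hi)]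
    rw [saleAlloc_congr (S := insert j A₁) (Finset.forall_mem_insert _ _ _ |>.2 ⟨hj, h₁⟩),
      saleAlloc_congr (S := insert j A₂') (Finset.forall_mem_insert _ _ _ |>.2 ⟨hj, h₂⟩)]

theorem IsRounding.of_mem_support_stocksAfter {ρ : ℝ → PMF ℝ} {Q : ℝ → Prop}
    (hρ : IsRounding ρ Q) (hb : ∀ j, 0 ≤ (θ j).budget) (hQ : Q (m / 4))
    (hp₁ : 0 < P.price θ A₁) (hp₂ : 0 < P.price θ A₂') {l : List ι} :
    ∀ {m₁ m₂ : ℝ}, Q m₁ → Q m₂ → ∀ {s : ℝ × ℝ},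
      s ∈ (stocksAfter m P (saleAlloc ρ) θ A₁ A₂' l m₁ m₂).support →
      (Q s.1 ∧ s.1 ≤ m₁) ∧ Q s.2 ∧ s.2 ≤ m₂ := by
  induction l with
  | nil =>
    intro m₁ m₂ h₁ h₂ s hs
    simp only [stocksAfter, PMF.support_pure, Set.mem_singleton_iff] at hs
    subst hs
    exact ⟨⟨h₁, le_rfl⟩, h₂, le_rfl⟩
  | cons j l ih =>
    intro m₁ m₂ h₁ h₂ s hs
    unfold stocksAfter at hs
    obtain ⟨c, -, hs⟩ := (PMF.mem_support_bind_iff _ _ _).1 hs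
    split_ifs at hs <;>
    · obtain ⟨x, hx, hs⟩ := (PMF.mem_support_bind_iff _ _ _).1 hs
      have hx := (hρ.of_mem_support_saleAlloc (by assumption) hb hQ hx).1 j
      have hmin₁ := min_of_mem hx h₁
      have hmin₂ := min_of_mem hx h₂
      have h0₁ := hρ.nonneg _ hmin₁
      have h0₂ := hρ.nonneg _ hmin₂
      obtain ⟨⟨h3, h4⟩, h5, h6⟩ := ih (by
          first
          | exact h₁
          | exact hρ.sub _ _ hmin₁ h₁ (min_le_right _ _)) (by
          first
          | exact h₂
          | exact hρ.sub _ _ hmin₂ h₂ (min_le_right _ _)) hs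
      exact ⟨⟨h3, by linarith⟩, h5, by linarith⟩

end Collection

/-! ### Revenue of the collection phase -/

section Revenue

variable {ι : Type} [DecidableEq ι] {m : ℝ} {P : PricingRule ι} {θ : ι → AgentType}
  {ρ : ℝ → PMF ℝ} {Q : ℝ → Prop} {p : ℝ}

/-- Received and charged amounts agree in expectation, also when cut off at an admissible
amount. -/
theorem IsRounding.expectation_min_saleAlloc (hρ : IsRounding ρ Q) (hp : 0 < p)
    (hb : ∀ j, 0 ≤ (θ j).budget) {S : Finset ι} {i : ι} (hi : i ∈ S) {k c : ℝ} (hc : Q c) :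
    expectation (saleAlloc ρ θ S p k) (fun x => min (x.2 i) c) =
      expectation (saleAlloc ρ θ S p k) fun x => min (x.1 i) c := by
  have := hρ.finitelySupported_saleAlloc (ι := ι)
  have := hρ.finitelySupported_stockFor (ι := ι)
  have := hρ.finitelySupported_sale
  have h : ∀ f : ℝ × ℝ → ℝ, expectation (saleAlloc ρ θ S p k) (fun x => f (x.1 i, x.2 i)) =
      expectation (stockFor ρ θ S p i k) fun k' => expectation (sale ρ (θ i) p k') f := by
    intro f
    rw [← expectation_bind, ← saleAlloc_map_apply hi, expectation_map]
  rw [h fun z => min z.2 c, h fun z => min z.1 c]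
  refine expectation_congr fun k' _ => ?_
  rw [hρ.expectation_sale hp (hb i) hc,
    ← expectation_const (sale ρ (θ i) p k') (min (charge (θ i) p k') c)]
  exact expectation_congr fun z hz => by rw [snd_of_mem_support_sale hz]

/-- The law of the total amount that a stream of agents, each tossing a fair coin that decides
whether she takes part, would buy at price `p` from unlimited remaining stock. -/
def requested (alloc : AllocationRule ι) (θ : ι → AgentType) (X : Finset ι) (p k : ℝ) :
    List ι → PMF ℝ
  | [] => PMF.pure 0
  | i :: l => (PMF.uniformOfFintype Bool).bind fun heads =>
      if heads then (alloc θ (insert i X) p k).bind fun x =>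
        (requested alloc θ X p k l).map fun z => x.1 i + z
      else requested alloc θ X p k l

theorem finitelySupported_requested {alloc : AllocationRule ι}
    [h : ∀ θ S p k, FinitelySupported (alloc θ S p k)] (X : Finset ι) (k : ℝ) (l : List ι) :
    FinitelySupported (requested alloc θ X p k l) := by
  induction l with
  | nil => unfold requested; infer_instance
  | cons i l ih => unfold requested; infer_instance

theorem expectation_requested_cons {alloc : AllocationRule ι}
    [h : ∀ θ S p k, FinitelySupported (alloc θ S p k)] (X : Finset ι) (k : ℝ) (i : ι)
    (l : List ι) (f : ℝ → ℝ) :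
    expectation (requested alloc θ X p k (i :: l)) f =
      (expectation (alloc θ (insert i X) p k) (fun x =>
        expectation (requested alloc θ X p k l) fun z => f (x.1 i + z)) +
      expectation (requested alloc θ X p k l) f) / 2 := by
  have := fun l => finitelySupported_requested (alloc := alloc) (θ := θ) (p := p) X k l
  rw [requested, expectation_bind, expectation_coin]
  simp only [if_true, Bool.false_eq_true, if_false]
  rw [expectation_bind]
  simp only [expectation_map]

theorem IsRounding.requested_nonneg (hρ : IsRounding ρ Q) (hp : 0 < p)
    (hb : ∀ j, 0 ≤ (θ j).budget) {X : Finset ι} {k : ℝ} (hk : Q k) {l : List ι} :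
    ∀ z ∈ (requested (saleAlloc ρ) θ X p k l).support, 0 ≤ z := by
  induction l with
  | nil =>
    intro z hz
    simp only [requested, PMF.support_pure, Set.mem_singleton_iff] at hz
    exact hz.ge
  | cons i l ih =>
    intro z hz
    unfold requested at hz
    obtain ⟨c, -, hz⟩ := (PMF.mem_support_bind_iff _ _ _).1 hz
    split_ifs at hz
    · simp only [PMF.mem_support_bind_iff, PMF.mem_support_map_iff] at hz
      obtain ⟨x, hx, z', hz', rfl⟩ := hz
      exact add_nonneg (hρ.nonneg _ ((hρ.of_mem_support_saleAlloc hp hb hk hx).1 i)) (ih z' hz')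
    · exact ih z hz

/-- The revenue of the collection phase is that of two separate sales, each of them of what is
requested, as far as the stock lasts. -/
theorem IsRounding.expectation_collectionPhase (hρ : IsRounding ρ Q)
    (hb : ∀ j, 0 ≤ (θ j).budget) (hQ : Q (m / 4)) {A₁ A₂' : Finset ι}
    (hp₁ : 0 < P.price θ A₁) (hp₂ : 0 < P.price θ A₂') {l : List ι} (hl : l.Nodup) :
    ∀ {m₁ m₂ : ℝ}, Q m₁ → Q m₂ →
      expectation (collectionPhase m P (saleAlloc ρ) θ A₁ A₂' l m₁ m₂)
        (fun y => (l.map y.2).sum) =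
      P.price θ A₂' * expectation (requested (saleAlloc ρ) θ A₁ (P.price θ A₂') (m / 4) l)
        (fun z => min z m₁) +
      P.price θ A₁ * expectation (requested (saleAlloc ρ) θ A₂' (P.price θ A₁) (m / 4) l)
        fun z => min z m₂ := by
  have := hρ.finitelySupported_saleAlloc (ι := ι)
  have := fun l m₁ m₂ => finitelySupported_collectionPhase (m := m) (P := P)
    (alloc := saleAlloc ρ) (θ := θ) (A₁ := A₁) (A₂' := A₂') l m₁ m₂
  have := fun X p k l => finitelySupported_requested (alloc := saleAlloc ρ) (θ := θ) (p := p) X k l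
  induction l with
  | nil =>
    intro m₁ m₂ h₁ h₂
    simp [collectionPhase, requested, hρ.nonneg _ h₁, hρ.nonneg _ h₂]
  | cons i l ih =>
    intro m₁ m₂ h₁ h₂
    obtain ⟨hi, hl⟩ := List.nodup_cons.1 hl
    have key : ∀ (X : Finset ι) (p c : ℝ), 0 < p → Q c →
        expectation (saleAlloc ρ θ (insert i X) p (m / 4)) (fun x => min (x.2 i) c * p +
          p * expectation (requested (saleAlloc ρ) θ X p (m / 4) l)
            fun z => min z (c - min (x.1 i) c)) =
        p * expectation (saleAlloc ρ θ (insert i X) p (m / 4)) fun x =>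
          expectation (requested (saleAlloc ρ) θ X p (m / 4) l) fun z => min (x.1 i + z) c := by
      intro X p c hp hc
      rw [expectation_add, expectation_mul_const,
        hρ.expectation_min_saleAlloc hp hb (Finset.mem_insert_self i X) hc, expectation_const_mul,
        mul_comm _ p, ← mul_add, ← expectation_add]
      congr 1
      refine expectation_congr fun x hx => ?_
      have hx0 := hρ.nonneg _ ((hρ.of_mem_support_saleAlloc hp hb hQ hx).1 i)
      rw [← expectation_const (requested (saleAlloc ρ) θ X p (m / 4) l) (min (x.1 i) c),
        ← expectation_add]
      refine expectation_congr fun z hz => ?_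
      have hz0 := hρ.requested_nonneg hp hb hQ z hz
      rw [expectation_const]
      rcases le_total (x.1 i) c with h | h
      · rw [min_eq_left h, ← min_add_add_left, add_sub_cancel]
      · rw [min_eq_right h, sub_self, min_eq_right hz0, add_zero, min_eq_right (by linarith)]
    have hmin₁ : ∀ x ∈ (saleAlloc ρ θ (insert i A₁) (P.price θ A₂') (m / 4)).support,
        Q (m₁ - min (x.1 i) m₁) := fun x hx => hρ.sub _ _
      (min_of_mem ((hρ.of_mem_support_saleAlloc hp₂ hb hQ hx).1 i) h₁) h₁ (min_le_right _ _)
    have hmin₂ : ∀ x ∈ (saleAlloc ρ θ (insert i A₂') (P.price θ A₁) (m / 4)).support,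
        Q (m₂ - min (x.1 i) m₂) := fun x hx => hρ.sub _ _
      (min_of_mem ((hρ.of_mem_support_saleAlloc hp₁ hb hQ hx).1 i) h₂) h₂ (min_le_right _ _)
    rw [collectionPhase, expectation_bind, expectation_coin]
    simp only [if_true, Bool.false_eq_true, if_false, expectation_bind, expectation_pure,
      List.map_cons, List.sum_cons, Function.update_self, map_update_of_notMem hi]
    simp only [expectation_add, expectation_const]
    rw [expectation_requested_cons, expectation_requested_cons]
    have e₁ := (expectation_congr fun x hx => ih hl (hmin₁ x hx) h₂)
    have e₂ := (expectation_congr fun x hx => ih hl h₁ (hmin₂ x hx))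
    rw [e₁, e₂, expectation_add, expectation_add, expectation_const, expectation_const,
      mul_div_assoc', mul_div_assoc', mul_add, mul_add, ← key A₁ _ _ hp₂ h₁, ← key A₂' _ _ hp₁ h₂,
      expectation_add, expectation_add]
    ring

/-- Expectation of the total request. -/
theorem IsRounding.expectation_requested (hρ : IsRounding ρ Q) (X : Finset ι) (k : ℝ)
    (l : List ι) :
    expectation (requested (saleAlloc ρ) θ X p k l) (fun z => z) =
      (l.map fun i => expectation (saleAlloc ρ θ (insert i X) p k) fun x => x.1 i).sum / 2 := by
  have := hρ.finitelySupported_saleAlloc (ι := ι)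
  have := fun l => finitelySupported_requested (alloc := saleAlloc ρ) (θ := θ) (p := p) X k l
  induction l with
  | nil => simp [requested]
  | cons i l ih =>
    rw [expectation_requested_cons]
    simp only [expectation_const_add _ _ fun z : ℝ => z, expectation_add, expectation_const, ih,
      List.map_cons, List.sum_cons]
    ring

/-- The summands of the total request are independent, lie between `0` and `k`, and so have
variance at most `k` times their mean. -/
theorem IsRounding.expectation_requested_sq (hρ : IsRounding ρ Q) (hp : 0 < p)
    (hb : ∀ j, 0 ≤ (θ j).budget) (X : Finset ι) {k : ℝ} (hk : Q k) (l : List ι) :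
    expectation (requested (saleAlloc ρ) θ X p k l) (fun z => z ^ 2) ≤
      expectation (requested (saleAlloc ρ) θ X p k l) (fun z => z) ^ 2 +
        k * expectation (requested (saleAlloc ρ) θ X p k l) fun z => z := by
  have := hρ.finitelySupported_saleAlloc (ι := ι)
  have := fun l => finitelySupported_requested (alloc := saleAlloc ρ) (θ := θ) (p := p) X k l
  induction l with
  | nil => simp [requested]
  | cons i l ih =>
    rw [expectation_requested_cons, expectation_requested_cons]
    set μ := expectation (requested (saleAlloc ρ) θ X p k l) fun z => z with hμ
    set e := expectation (saleAlloc ρ θ (insert i X) p k) fun x => x.1 i with he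
    have h1 : expectation (saleAlloc ρ θ (insert i X) p k) (fun x =>
        expectation (requested (saleAlloc ρ) θ X p k l) fun z => x.1 i + z) = e + μ := by
      simp only [expectation_const_add _ _ fun z : ℝ => z, expectation_add, expectation_const,
        ← hμ, ← he]
    have h2 : expectation (saleAlloc ρ θ (insert i X) p k) (fun x =>
        expectation (requested (saleAlloc ρ) θ X p k l) fun z => (x.1 i + z) ^ 2) =
        expectation (saleAlloc ρ θ (insert i X) p k) (fun x => x.1 i ^ 2) + 2 * e * μ +
          expectation (requested (saleAlloc ρ) θ X p k l) fun z => z ^ 2 := by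
      simp only [add_sq, expectation_add, expectation_const,
        expectation_const_mul _ _ fun z : ℝ => z, expectation_mul_const, expectation_const_mul,
        ← hμ, ← he]
    have h3 : expectation (saleAlloc ρ θ (insert i X) p k) (fun x => x.1 i ^ 2) ≤ k * e := by
      rw [he, ← expectation_const_mul]
      refine expectation_mono fun x hx => ?_
      obtain ⟨h4, h5⟩ := hρ.of_mem_support_saleAlloc hp hb hk hx
      have h6 : x.1 i ≤ k := (Finset.single_le_sum (f := x.1) (fun j _ => hρ.nonneg _ (h4 j))
        (Finset.mem_insert_self i X)).trans h5
      rw [sq]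
      exact mul_le_mul_of_nonneg_right h6 (hρ.nonneg _ (h4 i))
    rw [h1, h2]
    nlinarith [sq_nonneg e]

/-- A lower bound for the number of items sold, by the second moment method: `min (z, k)` is at
least `t z - (t z) ^ 2 / (4 k)` for `0 ≤ t ≤ 1`, and `t` is chosen such that `t z` has mean `y`. -/
theorem IsRounding.le_expectation_min_requested (hρ : IsRounding ρ Q) (hp : 0 < p)
    (hb : ∀ j, 0 ≤ (θ j).budget) (X : Finset ι) {k : ℝ} (hk : Q k) (hk0 : 0 < k) (l : List ι)
    {y : ℝ} (hy0 : 0 ≤ y)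
    (hy : y ≤ expectation (requested (saleAlloc ρ) θ X p k l) fun z => z) :
    y * (3 / 4) - y ^ 2 / (4 * k) ≤
      expectation (requested (saleAlloc ρ) θ X p k l) fun z => min z k := by
  have := hρ.finitelySupported_saleAlloc (ι := ι)
  have := fun l => finitelySupported_requested (alloc := saleAlloc ρ) (θ := θ) (p := p) X k l
  have h0 := hρ.requested_nonneg hp hb hk (X := X) (l := l)
  have h2 := hρ.expectation_requested_sq hp hb X hk l
  set μ := expectation (requested (saleAlloc ρ) θ X p k l) fun z => z with hμ
  rcases hy0.eq_or_lt with rfl | hy1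
  · simp only [zero_mul, ne_eq, OfNat.ofNat_ne_zero, not_false_eq_true, zero_pow, zero_div,
      sub_zero]
    exact expectation_nonneg fun z hz => le_min (h0 z hz) hk0.le
  have hμ0 : 0 < μ := hy1.trans_le hy
  set t := y / μ with ht
  have ht0 : 0 ≤ t := div_nonneg hy0 hμ0.le
  have ht1 : t ≤ 1 := (div_le_one hμ0).2 hy
  have htμ : t * μ = y := div_mul_cancel₀ _ hμ0.ne'
  have h3 : expectation (requested (saleAlloc ρ) θ X p k l)
      (fun z => t * z - t ^ 2 / (4 * k) * z ^ 2) ≤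
      expectation (requested (saleAlloc ρ) θ X p k l) fun z => min z k := by
    refine expectation_mono fun z hz => le_min ?_ ?_
    · have h4 : t * z ≤ z := mul_le_of_le_one_left (h0 z hz) ht1
      have h5 : 0 ≤ t ^ 2 / (4 * k) * z ^ 2 := by positivity
      linarith
    · have h4 : k - (t * z - t ^ 2 / (4 * k) * z ^ 2) = (t * z - 2 * k) ^ 2 / (4 * k) := by
        field_simp
        ring
      have h5 : 0 ≤ (t * z - 2 * k) ^ 2 / (4 * k) := by positivity
      linarith
  refine le_trans ?_ h3
  rw [expectation_sub, expectation_const_mul, expectation_const_mul, ← hμ, htμ]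
  have h4 : t ^ 2 / (4 * k) * expectation (requested (saleAlloc ρ) θ X p k l) (fun z => z ^ 2) ≤
      t ^ 2 / (4 * k) * (μ ^ 2 + k * μ) := mul_le_mul_of_nonneg_left h2 (by positivity)
  have h5 : t ^ 2 / (4 * k) * (μ ^ 2 + k * μ) = y ^ 2 / (4 * k) + t * y / 4 := by
    rw [← htμ]
    field_simp
  have h6 : t * y ≤ y := mul_le_of_le_one_left hy0 ht1
  linarith

/-- The items sold to a stream of agents at a fixed price, in terms of the demand of the agents of
the stream and of the set `X` that they are compared with. -/
theorem IsRounding.le_expectation_min_requested_of_demand (hρ : IsRounding ρ Q) (hp : 0 < p)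
    (hb : ∀ j, 0 ≤ (θ j).budget) {X : Finset ι} {k : ℝ} (hk : Q k) (hk0 : 0 < k) {l : List ι}
    (hlX : ∀ i ∈ l, i ∉ X) (hlk : ∀ i ∈ l, demand θ p i ≤ k) {y : ℝ} (hy0 : 0 ≤ y)
    (hy1 : 4 * y ≤ (l.map (demand θ p)).sum)
    (hy2 : 4 * y * ∑ j ∈ X, demand θ p j ≤ k * (l.map (demand θ p)).sum) :
    y * (3 / 4) - y ^ 2 / (4 * k) ≤
      expectation (requested (saleAlloc ρ) θ X p k l) fun z => min z k := by
  refine hρ.le_expectation_min_requested hp hb X hk hk0 l hy0 ?_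
  rw [hρ.expectation_requested]
  set C := max ((∑ j ∈ X, demand θ p j) / k) 1 with hC
  have hC0 : 0 < C := lt_of_lt_of_le one_pos (le_max_right _ _)
  have h1 : (l.map fun i => demand θ p i / (2 * C)).sum ≤
      (l.map fun i => expectation (saleAlloc ρ θ (insert i X) p k) fun x => x.1 i).sum :=
    List.sum_le_sum fun i hi => hρ.demand_div_le_expectation hp hb (hlX i hi) hk0 hk (hlk i hi)
  have h2 : (l.map fun i => demand θ p i / (2 * C)).sum =
      (l.map (demand θ p)).sum / (2 * C) := by
    simp only [div_eq_mul_inv]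
    rw [List.sum_map_mul_right]
  have h3 : 4 * y * C ≤ (l.map (demand θ p)).sum := by
    rw [hC, mul_max_of_nonneg _ _ (by positivity)]
    refine max_le ?_ (by linarith)
    rw [mul_div_assoc', div_le_iff₀ hk0]
    linarith
  have h4 : 2 * y ≤ (l.map (demand θ p)).sum / (2 * C) := by
    rw [le_div_iff₀ (by positivity)]
    linarith
  linarith

end Revenue

/-! ### The mechanism, given the coins of the partition -/

section Given

variable {n : ℕ}

/-- The sampling set `A` when it consists of the agents in the places up to `T`. -/
def sampleSet (θ : Fin (n + 1) → AgentType) (T : Fin (n + 1)) : Finset (Fin (n + 1)) :=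
  (Finset.univ.filter fun t => t ≤ T).map (arrivalOrder θ).toEmbedding

/-- The agents of `B`, in order of arrival. -/
def collectionList (θ : Fin (n + 1) → AgentType) (T : Fin (n + 1)) : List (Fin (n + 1)) :=
  ((List.finRange (n + 1)).filter fun t => T < t).map (arrivalOrder θ)

/-- The part `A₁` of the sampling set, which does not contain the last agent. -/
def firstHalf (θ : Fin (n + 1) → AgentType) (T : Fin (n + 1)) (side : Fin (n + 1) → Bool) :
    Finset (Fin (n + 1)) :=
  (sampleSet θ T).filter fun i => side i ≠ side (arrivalOrder θ T)

/-- The part `A₂` of the sampling set, which contains the last agent. -/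
def secondHalf (θ : Fin (n + 1) → AgentType) (T : Fin (n + 1)) (side : Fin (n + 1) → Bool) :
    Finset (Fin (n + 1)) :=
  (sampleSet θ T).filter fun i => side i = side (arrivalOrder θ T)

/-- The outcome, given all draws: `x` and `x'` are the allocations of the sampling phase and `y` is
what the collection phase returns. -/
def outcomeOf (P : PricingRule (Fin (n + 1))) (θ : Fin (n + 1) → AgentType) (T : Fin (n + 1))
    (side : Fin (n + 1) → Bool) (x x' y : (Fin (n + 1) → ℝ) × (Fin (n + 1) → ℝ)) :
    Outcome (Fin (n + 1)) where
  amount := fun i =>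
    if i ∈ sampleSet θ T then
      if (θ i).departure < (θ (arrivalOrder θ T)).arrival then 0
      else if i ∈ firstHalf θ T side then x.1 i else x'.1 i
    else y.1 i
  payment := fun i =>
    if i ∈ sampleSet θ T then
      if (θ i).departure < (θ (arrivalOrder θ T)).arrival then 0
      else if i ∈ firstHalf θ T side then x.2 i * P.price θ (secondHalf θ T side)
      else x'.2 i * P.price θ (firstHalf θ T side)
    else y.2 i
  time := fun i =>
    if i ∈ sampleSet θ T then (θ (arrivalOrder θ T)).arrival else (θ i).arrival

/-- The mechanism, given the number `T` of tails and the coins that split the sampling set. -/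
def rsOnlineGiven (m : ℝ) (P : PricingRule (Fin (n + 1))) (alloc : AllocationRule (Fin (n + 1)))
    (θ : Fin (n + 1) → AgentType) (T : Fin (n + 1)) (side : Fin (n + 1) → Bool) :
    PMF (Outcome (Fin (n + 1))) :=
  (alloc θ (firstHalf θ T side) (P.price θ (secondHalf θ T side)) (m / 4)).bind fun x =>
    (alloc θ (secondHalf θ T side) (P.price θ (firstHalf θ T side)) (m / 4)).bind fun x' =>
      (collectionPhase m P alloc θ (firstHalf θ T side)
        ((secondHalf θ T side).erase (arrivalOrder θ T)) (collectionList θ T)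
        (m / 4) (m / 4)).map fun y => outcomeOf P θ T side x x' y

theorem rsOnline_eq (m : ℝ) (P : PricingRule (Fin (n + 1)))
    (alloc : AllocationRule (Fin (n + 1))) (θ : Fin (n + 1) → AgentType) :
    rsOnline m P alloc θ =
      (PMF.uniformOfFintype (Fin n → Bool)).bind fun tosses =>
        (PMF.uniformOfFintype (Fin (n + 1) → Bool)).bind fun side =>
          rsOnlineGiven m P alloc θ (tailCount tosses) side := rfl

variable {m : ℝ} {P : PricingRule (Fin (n + 1))} {alloc : AllocationRule (Fin (n + 1))}
  {θ : Fin (n + 1) → AgentType} {T : Fin (n + 1)} {side : Fin (n + 1) → Bool}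
  {i : Fin (n + 1)}

instance finitelySupported_rsOnlineGiven [h : ∀ θ S p k, FinitelySupported (alloc θ S p k)] :
    FinitelySupported (rsOnlineGiven m P alloc θ T side) := by
  have := fun A₁ A₂' l m₁ m₂ => finitelySupported_collectionPhase (m := m) (P := P)
    (alloc := alloc) (θ := θ) (A₁ := A₁) (A₂' := A₂') l m₁ m₂
  unfold rsOnlineGiven
  infer_instance

theorem mem_sampleSet : i ∈ sampleSet θ T ↔ (arrivalOrder θ).symm i ≤ T := by
  unfold sampleSet
  simp only [Finset.mem_map_equiv, Finset.mem_filter, Finset.mem_univ, true_and]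

theorem arrivalOrder_mem_sampleSet : arrivalOrder θ T ∈ sampleSet θ T := by
  simp [mem_sampleSet]

theorem mem_collectionList : i ∈ collectionList θ T ↔ i ∉ sampleSet θ T := by
  rw [mem_sampleSet, not_le]
  unfold collectionList
  simp only [List.mem_map, List.mem_filter, List.mem_finRange, true_and, decide_eq_true_eq]
  constructor
  · rintro ⟨t, ht, rfl⟩
    simpa using ht
  · intro h
    exact ⟨_, h, by simp⟩

theorem nodup_collectionList : (collectionList θ T).Nodup :=
  ((List.nodup_finRange _).filter _).map (arrivalOrder θ).injective

/-- What agent `i` receives, what she pays, and when. -/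
def view (i : Fin (n + 1)) (o : Outcome (Fin (n + 1))) : ℝ × ℝ × ℝ :=
  (o.amount i, o.payment i, o.time i)

/-- An agent of the sampling set is served at the time of the last arrival in this set, at the price
of the half that she is not in. -/
theorem rsOnlineGiven_map_view_of_mem {ρ : ℝ → PMF ℝ} {Q : ℝ → Prop} (hρ : IsRounding ρ Q)
    (hQ : Q (m / 4)) (hb : ∀ j, 0 ≤ (θ j).budget) (hP : ∀ S, 0 < P.price θ S)
    (hi : i ∈ sampleSet θ T) :
    (rsOnlineGiven m P (saleAlloc ρ) θ T side).map (view i) =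
      if (θ i).departure < (θ (arrivalOrder θ T)).arrival then
        PMF.pure (0, 0, (θ (arrivalOrder θ T)).arrival)
      else (offer m (saleAlloc ρ) θ
          (((sampleSet θ T).erase i).filter fun j => side j = side i)
          (P.price θ (((sampleSet θ T).erase i).filter fun j => side j ≠ side i)) i (m / 4)).map
        fun z => (z.1, z.2, (θ (arrivalOrder θ T)).arrival) := by
  have key : ∀ (X : Finset (Fin (n + 1))) (p : ℝ), 0 < p → i ∉ X →
      (saleAlloc ρ θ (insert i X) p (m / 4)).map
        (fun x => (x.1 i, x.2 i * p, (θ (arrivalOrder θ T)).arrival)) =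
      (offer m (saleAlloc ρ) θ X p i (m / 4)).map
        fun z => (z.1, z.2, (θ (arrivalOrder θ T)).arrival) := by
    intro X p hp hX
    rw [offer, PMF.map_comp]
    refine map_congr_support fun x hx => ?_
    have h1 : (x.1 i, x.2 i) ∈ ((saleAlloc ρ θ (insert i X) p (m / 4)).map
        fun y => (y.1 i, y.2 i)).support := (PMF.mem_support_map_iff _ _ _).2 ⟨x, hx, rfl⟩
    rw [saleAlloc_map_apply (Finset.mem_insert_self i X), PMF.mem_support_bind_iff] at h1
    obtain ⟨k, hk, hz⟩ := h1
    obtain ⟨h2, h3⟩ := hρ.of_mem_support_stockFor hp hb hQ hk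
    have h4 : x.1 i ≤ m / 4 := (hρ.fst_of_mem_support_sale hp (hb i) h2 hz).2.trans h3
    have h5 : x.2 i ≤ m / 4 := by
      have := snd_of_mem_support_sale hz
      simp only at this
      rw [this]
      exact (charge_le (hρ.nonneg _ h2)).trans h3
    simp [min_eq_left h4, min_eq_left h5]
  have hX : ∀ (c : Fin (n + 1) → Prop) [DecidablePred c], c i →
      (sampleSet θ T).filter c = insert i (((sampleSet θ T).erase i).filter c) := by
    intro c _ hc
    ext j
    simp only [Finset.mem_filter, Finset.mem_insert, Finset.mem_erase]
    by_cases hj : j = i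
    · subst hj; simp [hi, hc]
    · simp [hj]
  have hY : ∀ (c : Fin (n + 1) → Prop) [DecidablePred c], ¬ c i →
      (sampleSet θ T).filter c = ((sampleSet θ T).erase i).filter c := by
    intro c _ hc
    ext j
    simp only [Finset.mem_filter, Finset.mem_erase]
    by_cases hj : j = i
    · subst hj; simp [hc]
    · simp [hj]
  unfold rsOnlineGiven
  simp only [PMF.map_bind, PMF.map_comp]
  split_ifs with hd
  · have h : ∀ x x', view i ∘ outcomeOf P θ T side x x' =
        Function.const _ (0, 0, (θ (arrivalOrder θ T)).arrival) := by
      intro x x'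
      funext y
      simp [view, outcomeOf, hi, hd]
    simp only [h, PMF.map_const, PMF.bind_const]
  · by_cases h1 : side i = side (arrivalOrder θ T)
    · have hf : i ∉ firstHalf θ T side := by simp [firstHalf, h1]
      have h : ∀ x x', view i ∘ outcomeOf P θ T side x x' =
          Function.const _ (x'.1 i, x'.2 i * P.price θ (firstHalf θ T side),
            (θ (arrivalOrder θ T)).arrival) := by
        intro x x'
        funext y
        simp [view, outcomeOf, hi, hd, hf]
      simp only [h, PMF.map_const, PMF.bind_const]
      rw [← key _ _ (hP _) (by simp), ← hX (fun j => side j = side i) rfl,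
        ← hY (fun j => side j ≠ side i) (by simp), h1]
      rfl
    · have hf : i ∈ firstHalf θ T side := by simp [firstHalf, h1, hi]
      have h : ∀ x x', view i ∘ outcomeOf P θ T side x x' =
          Function.const _ (x.1 i, x.2 i * P.price θ (secondHalf θ T side),
            (θ (arrivalOrder θ T)).arrival) := by
        intro x x'
        funext y
        simp [view, outcomeOf, hi, hd, hf]
      simp only [h, PMF.map_const, PMF.bind_const]
      have e1 : (sampleSet θ T).filter (fun j => side j = side i) = firstHalf θ T side := by
        refine Finset.filter_congr fun j _ => ?_
        revert h1
        cases side i <;> cases side j <;> cases side (arrivalOrder θ T) <;> simp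
      have e2 : (sampleSet θ T).filter (fun j => side j ≠ side i) = secondHalf θ T side := by
        refine Finset.filter_congr fun j _ => ?_
        revert h1
        cases side i <;> cases side j <;> cases side (arrivalOrder θ T) <;> simp
      rw [← key _ _ (hP _) (by simp), ← hX (fun j => side j = side i) rfl,
        ← hY (fun j => side j ≠ side i) (by simp), e1, e2]
      rfl

theorem rsOnlineGiven_map_view_of_notMem {l₁ l₂ : List (Fin (n + 1))}
    (hi : i ∉ sampleSet θ T) (hl : collectionList θ T = l₁ ++ i :: l₂) :
    (rsOnlineGiven m P alloc θ T side).map (view i) =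
      ((stocksAfter m P alloc θ (firstHalf θ T side)
        ((secondHalf θ T side).erase (arrivalOrder θ T)) l₁ (m / 4) (m / 4)).bind
        (collectionOffer m P alloc θ (firstHalf θ T side)
          ((secondHalf θ T side).erase (arrivalOrder θ T)) i)).map
        fun z => (z.1, z.2, (θ i).arrival) := by
  have hil : i ∉ l₁ := by
    have := nodup_collectionList (θ := θ) (T := T)
    rw [hl] at this
    intro h
    exact (List.nodup_append.1 this).2.2 i h i List.mem_cons_self rfl
  rw [← collectionPhase_map_apply (l₂ := l₂) hil, ← hl, PMF.map_comp]
  unfold rsOnlineGiven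
  simp only [PMF.map_bind, PMF.map_comp]
  have h : ∀ x x', view i ∘ outcomeOf P θ T side x x' =
      fun y => (y.1 i, y.2 i, (θ i).arrival) := by
    intro x x'
    funext y
    simp [view, outcomeOf, hi]
  simp only [h, PMF.bind_const]
  rfl

end Given

/-! ### Feasibility -/

section Feasible

variable {n : ℕ} {m : ℝ} {P : PricingRule (Fin (n + 1))} {θ : Fin (n + 1) → AgentType}
  {T : Fin (n + 1)} {side : Fin (n + 1) → Bool} {ρ : ℝ → PMF ℝ} {Q : ℝ → Prop}

theorem IsRounding.of_mem_support_rsOnlineGiven (hρ : IsRounding ρ Q) (hQ : Q (m / 4))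
    (hb : ∀ j, 0 ≤ (θ j).budget) (hP : ∀ S, 0 < P.price θ S) {o : Outcome (Fin (n + 1))}
    (ho : o ∈ (rsOnlineGiven m P (saleAlloc ρ) θ T side).support) :
    (∀ i, Q (o.amount i)) ∧ ∑ i, o.amount i ≤ m := by
  unfold rsOnlineGiven at ho
  simp only [PMF.mem_support_bind_iff, PMF.mem_support_map_iff] at ho
  obtain ⟨x, hx, x', hx', y, hy, rfl⟩ := ho
  obtain ⟨hx1, hx2⟩ := hρ.of_mem_support_saleAlloc (hP _) hb hQ hx
  obtain ⟨hx'1, hx'2⟩ := hρ.of_mem_support_saleAlloc (hP _) hb hQ hx'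
  obtain ⟨hy1, hy2⟩ := hρ.of_mem_support_collectionPhase hb hQ (hP _) (hP _)
    nodup_collectionList hQ hQ hy
  constructor
  · intro i
    unfold outcomeOf
    dsimp only
    split_ifs
    · exact hρ.zero
    · exact hx1 i
    · exact hx'1 i
    · exact hy1 i
  · have h1 : ∀ i, (outcomeOf P θ T side x x' y).amount i ≤
        (if i ∈ firstHalf θ T side then x.1 i else 0) +
        (if i ∈ secondHalf θ T side then x'.1 i else 0) +
        if i ∈ (collectionList θ T).toFinset then y.1 i else 0 := by
      intro i
      have hx0 := hρ.nonneg _ (hx1 i)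
      have hx'0 := hρ.nonneg _ (hx'1 i)
      unfold outcomeOf
      dsimp only
      simp only [List.mem_toFinset, mem_collectionList]
      by_cases hi : i ∈ sampleSet θ T
      · by_cases hs : side i = side (arrivalOrder θ T)
        · have h1 : i ∉ firstHalf θ T side := by simp [firstHalf, hs]
          have h2 : i ∈ secondHalf θ T side := by simp [secondHalf, hs, hi]
          simp only [hi, h1, h2, if_true, if_false, not_true_eq_false]
          split_ifs <;> linarith
        · have h1 : i ∈ firstHalf θ T side := by simp [firstHalf, hs, hi]
          have h2 : i ∉ secondHalf θ T side := by simp [secondHalf, hs]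
          simp only [hi, h1, h2, if_true, if_false, not_true_eq_false]
          split_ifs <;> linarith
      · simp [hi, firstHalf, secondHalf]
    refine (Finset.sum_le_sum fun i _ => h1 i).trans ?_
    simp only [Finset.sum_add_distrib, Finset.sum_ite_mem, Finset.univ_inter]
    rw [List.sum_toFinset _ nodup_collectionList]
    linarith

theorem IsRevenuePricing.price_pos (h : IsRevenuePricing m P) (hθ : ∀ i, (θ i).Valid)
    (S : Finset (Fin (n + 1))) : 0 < P.price θ S := (h θ hθ S).1

theorem IsRounding.feasible (hρ : IsRounding ρ Q) (hQ : Q (m / 4)) (hP : IsRevenuePricing m P) :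
    Feasible (rsOnline m P (saleAlloc ρ)) m := by
  intro θ hθ o ho
  rw [rsOnline_eq] at ho
  obtain ⟨tosses, -, ho⟩ := (PMF.mem_support_bind_iff _ _ _).1 ho
  obtain ⟨side, -, ho⟩ := (PMF.mem_support_bind_iff _ _ _).1 ho
  obtain ⟨h1, h2⟩ := hρ.of_mem_support_rsOnlineGiven hQ (fun j => (hθ.1 j).2.2)
    (hP.price_pos hθ.1) ho
  exact ⟨fun i => hρ.nonneg _ (h1 i), h2⟩

theorem allocatesIndivisibleItems_revIndiv (hm : ∃ z : ℕ, m / 4 = z) (hP : IsRevenuePricing m P) :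
    AllocatesIndivisibleItems (revIndiv m P) := by
  intro θ hθ o ho
  rw [revIndiv, indivAlloc_eq_saleAlloc, rsOnline_eq] at ho
  obtain ⟨tosses, -, ho⟩ := (PMF.mem_support_bind_iff _ _ _).1 ho
  obtain ⟨side, -, ho⟩ := (PMF.mem_support_bind_iff _ _ _).1 ho
  exact (isRounding_randomRounding.of_mem_support_rsOnlineGiven hm (fun j => (hθ.1 j).2.2)
    (hP.price_pos hθ.1) ho).1

end Feasible

/-! ### A single offer -/

section Offer

variable {ι : Type} [DecidableEq ι] {m : ℝ} {θ : ι → AgentType} {ρ : ℝ → PMF ℝ} {Q : ℝ → Prop}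
  {X : Finset ι} {p c : ℝ} {i : ι}

theorem offer_eq : offer m (saleAlloc ρ) θ X p i c =
    (stockFor ρ θ (insert i X) p i (m / 4)).bind fun k =>
      (sale ρ (θ i) p k).map fun z => (min z.1 c, min z.2 c * p) := by
  have h : offer m (saleAlloc ρ) θ X p i c =
      ((saleAlloc ρ θ (insert i X) p (m / 4)).map fun x => (x.1 i, x.2 i)).map
        fun z => (min z.1 c, min z.2 c * p) := by
    rw [PMF.map_comp]
    rfl
  rw [h, saleAlloc_map_apply (Finset.mem_insert_self i X), PMF.map_bind]

theorem mem_support_offer {z : ℝ × ℝ}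
    (hz : z ∈ (offer m (saleAlloc ρ) θ X p i c).support) :
    ∃ k ∈ (stockFor ρ θ (insert i X) p i (m / 4)).support,
      z.2 = min (charge (θ i) p k) c * p := by
  rw [offer_eq] at hz
  simp only [PMF.mem_support_bind_iff, PMF.mem_support_map_iff] at hz
  obtain ⟨k, hk, y, hy, rfl⟩ := hz
  exact ⟨k, hk, by rw [snd_of_mem_support_sale hy]⟩

theorem exists_mem_support_offer {k : ℝ}
    (hk : k ∈ (stockFor ρ θ (insert i X) p i (m / 4)).support) :
    ∃ z ∈ (offer m (saleAlloc ρ) θ X p i c).support, z.2 = min (charge (θ i) p k) c * p := by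
  obtain ⟨y, hy⟩ := (sale ρ (θ i) p k).support_nonempty
  refine ⟨(min y.1 c, min y.2 c * p), ?_, by simp [snd_of_mem_support_sale hy]⟩
  rw [offer_eq]
  simp only [PMF.mem_support_bind_iff, PMF.mem_support_map_iff]
  exact ⟨k, hk, y, hy, rfl⟩

theorem IsRounding.finitelySupported_offer (hρ : IsRounding ρ Q) (θ : ι → AgentType)
    (X : Finset ι) (p : ℝ) (i : ι) (c : ℝ) :
    FinitelySupported (offer m (saleAlloc ρ) θ X p i c) := by
  have := hρ.finitelySupported_saleAlloc (ι := ι)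
  unfold offer
  infer_instance

/-- An agent who is offered items pays for the items she receives on average. -/
theorem IsRounding.expectation_offer (hρ : IsRounding ρ Q) (hp : 0 < p)
    (hb : ∀ j, 0 ≤ (θ j).budget) (hc : Q c) (v : ℝ) :
    expectation (offer m (saleAlloc ρ) θ X p i c) (fun z => v * z.1 - z.2) =
      expectation (stockFor ρ θ (insert i X) p i (m / 4)) fun k =>
        (v - p) * min (charge (θ i) p k) c := by
  have := hρ.finitelySupported_stockFor (ι := ι)
  have := hρ.finitelySupported_sale
  rw [offer_eq, expectation_bind]
  refine expectation_congr fun k _ => ?_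
  rw [expectation_map, expectation_sub, expectation_const_mul, hρ.expectation_sale hp (hb i) hc]
  have : expectation (sale ρ (θ i) p k) (fun z => min z.2 c * p) =
      min (charge (θ i) p k) c * p := by
    rw [← expectation_const (sale ρ (θ i) p k) (min (charge (θ i) p k) c * p)]
    exact expectation_congr fun z hz => by rw [snd_of_mem_support_sale hz]
  rw [this]
  ring

theorem IsRounding.snd_offer_nonneg (hρ : IsRounding ρ Q) (hp : 0 < p)
    (hb : ∀ j, 0 ≤ (θ j).budget) (hQ : Q (m / 4)) (hc : Q c) {z : ℝ × ℝ}
    (hz : z ∈ (offer m (saleAlloc ρ) θ X p i c).support) : 0 ≤ z.2 := by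
  obtain ⟨k, hk, h⟩ := mem_support_offer hz
  rw [h]
  exact mul_nonneg (le_min (charge_nonneg hp (hb i)
    (hρ.nonneg _ (hρ.of_mem_support_stockFor hp hb hQ hk).1)) (hρ.nonneg _ hc)) hp.le

theorem snd_offer_le (hp : 0 < p) (hb : ∀ j, 0 ≤ (θ j).budget) {z : ℝ × ℝ}
    (hz : z ∈ (offer m (saleAlloc ρ) θ X p i c).support) : z.2 ≤ (θ i).budget := by
  obtain ⟨k, hk, h⟩ := mem_support_offer hz
  rw [h]
  exact (mul_le_mul_of_nonneg_right (min_le_left _ _) hp.le).trans (charge_mul_le hp (hb i))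

theorem IsRounding.expectation_offer_nonneg (hρ : IsRounding ρ Q) (hp : 0 < p)
    (hb : ∀ j, 0 ≤ (θ j).budget) (hQ : Q (m / 4)) (hc : Q c) :
    0 ≤ expectation (offer m (saleAlloc ρ) θ X p i c) fun z => (θ i).value * z.1 - z.2 := by
  rw [hρ.expectation_offer hp hb hc]
  refine expectation_nonneg fun k hk => ?_
  have hk0 := hρ.nonneg _ (hρ.of_mem_support_stockFor hp hb hQ hk).1
  have hc0 := hρ.nonneg _ hc
  unfold charge
  split_ifs with h
  · exact mul_nonneg (by linarith)
      (le_min (le_min (div_nonneg (hb i) hp.le) hk0) hc0)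
  · simp [hc0]

/-- No report of value and budget that keeps all payments within the real budget is better than the
truth, and a larger stock `c'` only helps a truthful agent. -/
theorem IsRounding.expectation_offer_update_le (hρ : IsRounding ρ Q) (hp : 0 < p)
    (hb : ∀ j, 0 ≤ (θ j).budget) (hQ : Q (m / 4)) {c' : ℝ} (hc : Q c) (hc' : Q c')
    (hcc : c ≤ c') {r : AgentType} (hr : 0 ≤ r.budget)
    (h : ∀ z ∈ (offer m (saleAlloc ρ) (Function.update θ i r) X p i c).support,
      z.2 ≤ (θ i).budget) :
    expectation (offer m (saleAlloc ρ) (Function.update θ i r) X p i c)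
        (fun z => (θ i).value * z.1 - z.2) ≤
      expectation (offer m (saleAlloc ρ) θ X p i c') fun z => (θ i).value * z.1 - z.2 := by
  have := hρ.finitelySupported_stockFor (ι := ι)
  have hb' : ∀ j, 0 ≤ (Function.update θ i r j).budget := by
    intro j
    by_cases hj : j = i
    · subst hj; simpa using hr
    · simpa [Function.update_of_ne hj] using hb j
  have hS : stockFor ρ (Function.update θ i r) (insert i X) p i (m / 4) =
      stockFor ρ θ (insert i X) p i (m / 4) :=
    stockFor_congr (fun j _ hj => Function.update_of_ne hj _ _) _
  rw [hρ.expectation_offer hp hb' hc, hρ.expectation_offer hp hb hc', hS]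
  refine expectation_mono fun k hk => ?_
  have hk0 := hρ.nonneg _ (hρ.of_mem_support_stockFor hp hb hQ hk).1
  have hc0 := hρ.nonneg _ hc
  rw [← hS] at hk
  obtain ⟨z, hz, hz2⟩ := exists_mem_support_offer (c := c) hk
  have h1 := h z hz
  rw [hz2, ← le_div_iff₀ hp] at h1
  simp only [Function.update_self] at h1 ⊢
  have h2 : 0 ≤ min (charge r p k) c := le_min (charge_nonneg hp hr hk0) hc0
  have h3 : charge r p k ≤ k := charge_le hk0
  by_cases hv : p ≤ (θ i).value
  · refine mul_le_mul_of_nonneg_left ?_ (by linarith)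
    have : charge (θ i) p k = min ((θ i).budget / p) k := by simp [charge, hv]
    rw [this]
    exact le_min (le_min h1 ((min_le_left _ _).trans h3)) ((min_le_right _ _).trans hcc)
  · have h4 : charge (θ i) p k = 0 := by simp [charge, hv]
    rw [h4, min_eq_left (hρ.nonneg _ hc'), mul_zero]
    exact mul_nonpos_of_nonpos_of_nonneg (by linarith) h2

end Offer

/-! ### Utilities, given the coins of the partition -/

section Utility

variable {n : ℕ}

open scoped Classical in
/-- Utility of an agent of type `t`, apart from the budget, from receiving `w.1` items and paying
`w.2.1` at time `w.2.2`. -/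
def netOf (t : AgentType) (w : ℝ × ℝ × ℝ) : ℝ :=
  (if t.arrival ≤ w.2.2 ∧ w.2.2 ≤ t.departure then t.value * w.1 else 0) - w.2.1

variable {m : ℝ} {P : PricingRule (Fin (n + 1))} {θ : Fin (n + 1) → AgentType}
  {T : Fin (n + 1)} {side : Fin (n + 1) → Bool} {ρ : ℝ → PMF ℝ} {Q : ℝ → Prop}
  {i : Fin (n + 1)}

theorem expectation_map_netOf (t : AgentType) (μ : PMF (Outcome (Fin (n + 1))))
    [FinitelySupported μ] :
    expectation (μ.map (view i)) (netOf t) = expectation μ (netValue t i) := by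
  rw [expectation_map]
  rfl

/-- Expected net value of an agent of type `t` for the offer made to `i`, at the price computed from
the set `Y`, within her time frame. -/
def offerValue (m : ℝ) (P : PricingRule (Fin (n + 1))) (ρ : ℝ → PMF ℝ)
    (θ : Fin (n + 1) → AgentType) (i : Fin (n + 1)) (X Y : Finset (Fin (n + 1))) (c : ℝ) : ℝ :=
  expectation (offer m (saleAlloc ρ) θ X (P.price θ Y) i c) fun z => (θ i).value * z.1 - z.2

theorem IsRounding.offerValue_nonneg (hρ : IsRounding ρ Q) (hQ : Q (m / 4))
    (hb : ∀ j, 0 ≤ (θ j).budget) (hP : ∀ S, 0 < P.price θ S) (X Y : Finset (Fin (n + 1)))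
    {c : ℝ} (hc : Q c) : 0 ≤ offerValue m P ρ θ i X Y c :=
  hρ.expectation_offer_nonneg (hP Y) hb hQ hc

theorem IsRounding.offerValue_mono (hρ : IsRounding ρ Q) (hQ : Q (m / 4))
    (hb : ∀ j, 0 ≤ (θ j).budget) (hP : ∀ S, 0 < P.price θ S) (X Y : Finset (Fin (n + 1)))
    {c c' : ℝ} (hc : Q c) (hc' : Q c') (hcc : c ≤ c') :
    offerValue m P ρ θ i X Y c ≤ offerValue m P ρ θ i X Y c' := by
  have h := hρ.expectation_offer_update_le (θ := θ) (X := X) (i := i) (hP Y) hb hQ hc hc' hcc (hb i)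
  rw [Function.update_eq_self] at h
  exact h fun z hz => snd_offer_le (hP Y) hb hz

/-- Expected net value of a truthful agent of the sampling set. -/
theorem IsRounding.expectation_view_of_mem (hρ : IsRounding ρ Q) (hQ : Q (m / 4))
    (hb : ∀ j, 0 ≤ (θ j).budget) (hP : ∀ S, 0 < P.price θ S) (hi : i ∈ sampleSet θ T)
    (ha : (θ i).arrival ≤ (θ (arrivalOrder θ T)).arrival) :
    expectation ((rsOnlineGiven m P (saleAlloc ρ) θ T side).map (view i)) (netOf (θ i)) =
      if (θ i).departure < (θ (arrivalOrder θ T)).arrival then 0 else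
        offerValue m P ρ θ i (((sampleSet θ T).erase i).filter fun j => side j = side i)
          (((sampleSet θ T).erase i).filter fun j => side j ≠ side i) (m / 4) := by
  have := hρ.finitelySupported_offer (ι := Fin (n + 1)) (m := m)
  rw [rsOnlineGiven_map_view_of_mem hρ hQ hb hP hi]
  split_ifs with hd
  · simp [netOf]
  · rw [expectation_map]
    unfold offerValue
    refine expectation_congr fun z _ => ?_
    simp only [netOf]
    rw [if_pos ⟨ha, not_lt.1 hd⟩]

/-- Expected net value of a truthful agent of the collection phase. -/
theorem IsRounding.expectation_view_of_notMem (hρ : IsRounding ρ Q)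
    (ha : (θ i).arrival ≤ (θ i).departure) {l₁ l₂ : List (Fin (n + 1))}
    (hi : i ∉ sampleSet θ T) (hl : collectionList θ T = l₁ ++ i :: l₂) :
    expectation ((rsOnlineGiven m P (saleAlloc ρ) θ T side).map (view i)) (netOf (θ i)) =
      expectation (stocksAfter m P (saleAlloc ρ) θ (firstHalf θ T side)
        ((secondHalf θ T side).erase (arrivalOrder θ T)) l₁ (m / 4) (m / 4)) fun s =>
          (offerValue m P ρ θ i (firstHalf θ T side)
            ((secondHalf θ T side).erase (arrivalOrder θ T)) s.1 +
          offerValue m P ρ θ i ((secondHalf θ T side).erase (arrivalOrder θ T))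
            (firstHalf θ T side) s.2) / 2 := by
  have := hρ.finitelySupported_saleAlloc (ι := Fin (n + 1))
  have := hρ.finitelySupported_offer (ι := Fin (n + 1)) (m := m)
  have := fun A₁ A₂' l m₁ m₂ => finitelySupported_stocksAfter (m := m) (P := P)
    (alloc := saleAlloc ρ) (θ := θ) (A₁ := A₁) (A₂' := A₂') l m₁ m₂
  have := fun A₁ A₂' s => finitelySupported_collectionOffer (m := m) (P := P)
    (alloc := saleAlloc ρ) (θ := θ) (A₁ := A₁) (A₂' := A₂') i s
  rw [rsOnlineGiven_map_view_of_notMem hi hl, expectation_map, expectation_bind]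
  refine expectation_congr fun s _ => ?_
  unfold collectionOffer
  rw [expectation_bind, expectation_coin]
  simp only [if_true, Bool.false_eq_true, if_false, netOf, ha, le_refl, and_self]
  rfl

/-- A misreporting agent of the sampling set gets at most the value of the truthful offer, and
nothing if she is not served within her time frame. -/
theorem IsRounding.expectation_view_update_of_mem_le (hρ : IsRounding ρ Q) (hQ : Q (m / 4))
    (hb : ∀ j, 0 ≤ (θ j).budget) (hP : ∀ S, 0 < P.price θ S) {r : AgentType}
    (hr : 0 ≤ r.budget) (hP' : ∀ S, 0 < P.price (Function.update θ i r) S)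
    (hi : i ∈ sampleSet (Function.update θ i r) T)
    (h : ∀ w ∈ ((rsOnlineGiven m P (saleAlloc ρ) (Function.update θ i r) T side).map
      (view i)).support, w.2.1 ≤ (θ i).budget) :
    expectation ((rsOnlineGiven m P (saleAlloc ρ) (Function.update θ i r) T side).map (view i))
      (netOf (θ i)) ≤
      if (θ i).arrival ≤ (Function.update θ i r (arrivalOrder (Function.update θ i r) T)).arrival ∧
        (Function.update θ i r (arrivalOrder (Function.update θ i r) T)).arrival ≤
          (θ i).departure then
        offerValue m P ρ θ i
          (((sampleSet (Function.update θ i r) T).erase i).filter fun j => side j = side i)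
          (((sampleSet (Function.update θ i r) T).erase i).filter fun j => side j ≠ side i) (m / 4)
      else 0 := by
  have := hρ.finitelySupported_offer (ι := Fin (n + 1)) (m := m)
  have hb' : ∀ j, 0 ≤ (Function.update θ i r j).budget := by
    intro j
    by_cases hj : j = i
    · subst hj; simpa using hr
    · simpa [Function.update_of_ne hj] using hb j
  rw [rsOnlineGiven_map_view_of_mem hρ hQ hb' hP' hi] at h ⊢
  have hp : P.price (Function.update θ i r) (((sampleSet (Function.update θ i r) T).erase i).filter
      fun j => side j ≠ side i) = P.price θ (((sampleSet (Function.update θ i r) T).erase i).filter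
      fun j => side j ≠ side i) := by
    refine P.price_congr fun j hj => Function.update_of_ne ?_ _ _
    exact Finset.ne_of_mem_erase (Finset.mem_filter.1 hj).1
  have h0 := hρ.offerValue_nonneg (P := P) (i := i) hQ hb hP
    (((sampleSet (Function.update θ i r) T).erase i).filter fun j => side j = side i)
    (((sampleSet (Function.update θ i r) T).erase i).filter fun j => side j ≠ side i) hQ
  by_cases hd : (Function.update θ i r i).departure <
      (Function.update θ i r (arrivalOrder (Function.update θ i r) T)).arrival
  · rw [if_pos hd, expectation_pure]
    simp only [netOf, mul_zero, ite_self, sub_zero]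
    split_ifs
    · exact h0
    · exact le_rfl
  · rw [if_neg hd] at h ⊢
    rw [hp] at h ⊢
    rw [expectation_map]
    simp only [netOf]
    split_ifs with ht
    · refine hρ.expectation_offer_update_le (hP _) hb hQ hQ hQ le_rfl hr fun z hz => ?_
      exact h _ ((PMF.mem_support_map_iff _ _ _).2 ⟨z, hz, rfl⟩)
    · rw [← neg_nonneg, ← neg_one_mul, ← expectation_const_mul]
      refine expectation_nonneg fun z hz => ?_
      have := hρ.snd_offer_nonneg (hP _) hb' hQ hQ hz
      linarith

/-- A misreporting agent of the collection phase gets at most the value of the truthful offer with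
the same remaining stocks, and nothing if she is not served within her time frame. -/
theorem IsRounding.expectation_view_update_of_notMem_le (hρ : IsRounding ρ Q) (hQ : Q (m / 4))
    (hb : ∀ j, 0 ≤ (θ j).budget) (hP : ∀ S, 0 < P.price θ S) {r : AgentType}
    (hr : 0 ≤ r.budget) {A₁ A₂' : Finset (Fin (n + 1))} {l₁ l₂ : List (Fin (n + 1))}
    (hi : i ∉ sampleSet (Function.update θ i r) T)
    (hl : collectionList (Function.update θ i r) T = l₁ ++ i :: l₂)
    (hA₁ : firstHalf (Function.update θ i r) T side = A₁)
    (hA₂ : (secondHalf (Function.update θ i r) T side).erase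
      (arrivalOrder (Function.update θ i r) T) = A₂')
    (h : ∀ w ∈ ((rsOnlineGiven m P (saleAlloc ρ) (Function.update θ i r) T side).map
      (view i)).support, w.2.1 ≤ (θ i).budget) :
    expectation ((rsOnlineGiven m P (saleAlloc ρ) (Function.update θ i r) T side).map (view i))
      (netOf (θ i)) ≤
      if (θ i).arrival ≤ r.arrival ∧ r.arrival ≤ (θ i).departure then
        expectation (stocksAfter m P (saleAlloc ρ) θ A₁ A₂' l₁ (m / 4) (m / 4)) fun s =>
          (offerValue m P ρ θ i A₁ A₂' s.1 + offerValue m P ρ θ i A₂' A₁ s.2) / 2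
      else 0 := by
  have := hρ.finitelySupported_saleAlloc (ι := Fin (n + 1))
  have := hρ.finitelySupported_offer (ι := Fin (n + 1)) (m := m)
  have := fun θ A₁ A₂' l m₁ m₂ => finitelySupported_stocksAfter (m := m) (P := P)
    (alloc := saleAlloc ρ) (θ := θ) (A₁ := A₁) (A₂' := A₂') l m₁ m₂
  have := fun θ A₁ A₂' s => finitelySupported_collectionOffer (m := m) (P := P)
    (alloc := saleAlloc ρ) (θ := θ) (A₁ := A₁) (A₂' := A₂') i s
  have hb' : ∀ j, 0 ≤ (Function.update θ i r j).budget := by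
    intro j
    by_cases hj : j = i
    · subst hj; simpa using hr
    · simpa [Function.update_of_ne hj] using hb j
  have hiA₁ : i ∉ A₁ := by
    rw [← hA₁]
    exact fun h => hi (Finset.mem_filter.1 h).1
  have hiA₂ : i ∉ A₂' := by
    rw [← hA₂]
    exact fun h => hi (Finset.mem_filter.1 (Finset.mem_of_mem_erase h)).1
  have hil : i ∉ l₁ := by
    have := nodup_collectionList (θ := Function.update θ i r) (T := T)
    rw [hl] at this
    intro h
    exact (List.nodup_append.1 this).2.2 i h i List.mem_cons_self rfl
  have hne : ∀ (S : Finset (Fin (n + 1))), i ∉ S → ∀ j ∈ S, Function.update θ i r j = θ j := by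
    intro S hS j hj
    refine Function.update_of_ne ?_ _ _
    rintro rfl
    exact hS hj
  have hp₁ : P.price (Function.update θ i r) A₁ = P.price θ A₁ := P.price_congr (hne _ hiA₁)
  have hp₂ : P.price (Function.update θ i r) A₂' = P.price θ A₂' := P.price_congr (hne _ hiA₂)
  rw [rsOnlineGiven_map_view_of_notMem hi hl, hA₁, hA₂,
    stocksAfter_congr (hne _ hiA₁) (hne _ hiA₂) (θ' := θ) (fun j hj => Function.update_of_ne
      (by rintro rfl; exact hil hj) _ _)] at h ⊢
  simp only [PMF.mem_support_bind_iff, PMF.mem_support_map_iff, collectionOffer] at h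
  rw [expectation_map, expectation_bind]
  simp only [netOf, Function.update_self] at h ⊢
  have hs : ∀ s ∈ (stocksAfter m P (saleAlloc ρ) θ A₁ A₂' l₁ (m / 4) (m / 4)).support,
      Q s.1 ∧ Q s.2 := fun s hs =>
    have h := hρ.of_mem_support_stocksAfter hb hQ (hP _) (hP _) hQ hQ hs
    ⟨h.1.1, h.2.1⟩
  split_ifs with ht
  · refine expectation_mono fun s hs' => ?_
    obtain ⟨h1, h2⟩ := hs s hs'
    unfold collectionOffer
    rw [expectation_bind, expectation_coin]
    simp only [if_true, Bool.false_eq_true, if_false, hp₁, hp₂]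
    refine div_le_div_of_nonneg_right (add_le_add ?_ ?_) zero_le_two
    · refine hρ.expectation_offer_update_le (hP _) hb hQ h1 h1 le_rfl hr fun z hz => ?_
      exact h _ ⟨z, ⟨s, hs', true, by simp, by simpa [hp₂] using hz⟩, rfl⟩
    · refine hρ.expectation_offer_update_le (hP _) hb hQ h2 h2 le_rfl hr fun z hz => ?_
      exact h _ ⟨z, ⟨s, hs', false, by simp, by simpa [hp₁] using hz⟩, rfl⟩
  · simp only [zero_sub]
    rw [← neg_nonneg, ← neg_one_mul, ← expectation_const_mul]
    refine expectation_nonneg fun s hs' => ?_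
    rw [neg_one_mul, neg_nonneg]
    obtain ⟨h1, h2⟩ := hs s hs'
    rw [← neg_nonneg, ← neg_one_mul, ← expectation_const_mul]
    refine expectation_nonneg fun z hz => ?_
    have : 0 ≤ z.2 := by
      unfold collectionOffer at hz
      obtain ⟨c, -, hz⟩ := (PMF.mem_support_bind_iff _ _ _).1 hz
      split_ifs at hz
      · exact hρ.snd_offer_nonneg (by rw [hp₂]; exact hP _) hb' hQ h1 hz
      · exact hρ.snd_offer_nonneg (by rw [hp₁]; exact hP _) hb' hQ h2 hz
    linarith

end Utility

/-! ### The order of arrival under a misreport -/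

section Arrival

variable {n : ℕ} {θ : Fin (n + 1) → AgentType}

theorem monotone_arrival_arrivalOrder (θ : Fin (n + 1) → AgentType) :
    Monotone fun t => (θ (arrivalOrder θ t)).arrival :=
  Tuple.monotone_sort fun i => (θ i).arrival

/-- The agents other than `i`, in order of arrival. -/
def others (θ : Fin (n + 1) → AgentType) (i : Fin (n + 1)) (t : Fin n) : Fin (n + 1) :=
  arrivalOrder θ (((arrivalOrder θ).symm i).succAbove t)

theorem others_ne (i : Fin (n + 1)) (t : Fin n) : others θ i t ≠ i := by
  intro h
  have h1 : ((arrivalOrder θ).symm i).succAbove t = (arrivalOrder θ).symm i := by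
    rw [Equiv.eq_symm_apply]
    exact h
  exact Fin.succAbove_ne _ _ h1

theorem range_others (i : Fin (n + 1)) : Set.range (others θ i) = {i}ᶜ := by
  ext j
  constructor
  · rintro ⟨t, rfl⟩
    exact others_ne i t
  · intro hj
    have : (arrivalOrder θ).symm j ≠ (arrivalOrder θ).symm i := fun h =>
      hj ((arrivalOrder θ).symm.injective h)
    obtain ⟨t, ht⟩ := Fin.exists_succAbove_eq this
    exact ⟨t, by simp [others, ht]⟩

/-- A misreport of agent `i` does not change the order of the others. -/
theorem others_update (hθ : Function.Injective fun i => (θ i).arrival) (i : Fin (n + 1))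
    (r : AgentType) : others (Function.update θ i r) i = others θ i := by
  have key : ∀ φ : Fin (n + 1) → AgentType, (∀ j, j ≠ i → φ j = θ j) →
      StrictMono fun t => (θ (others φ i t)).arrival := by
    intro φ hφ
    refine Monotone.strictMono_of_injective ?_ ?_
    · intro s t hst
      have := monotone_arrival_arrivalOrder φ
        ((Fin.strictMono_succAbove ((arrivalOrder φ).symm i)).monotone hst)
      simp only at this ⊢
      rw [← hφ _ (others_ne i s), ← hφ _ (others_ne i t)]
      exact this
    · intro s t hst
      have h1 := (arrivalOrder φ).injective (hθ hst)
      exact Fin.succAbove_right_injective h1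
  have h1 := key (Function.update θ i r) fun j hj => Function.update_of_ne hj _ _
  have h2 := key θ fun j _ => rfl
  have h3 : Set.range (fun t => (θ (others (Function.update θ i r) i t)).arrival) =
      Set.range fun t => (θ (others θ i t)).arrival := by
    rw [Set.range_comp' (fun j => (θ j).arrival), Set.range_comp' (fun j => (θ j).arrival),
      range_others, range_others]
  have h4 := (StrictMono.range_inj h1 h2).1 h3
  funext t
  exact hθ (congrFun h4 t)

theorem arrivalOrder_castSucc (i : Fin (n + 1)) (t : Fin n)
    (ht : t.castSucc < (arrivalOrder θ).symm i) : arrivalOrder θ t.castSucc = others θ i t := by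
  rw [others, Fin.succAbove_of_castSucc_lt _ _ ht]

theorem arrivalOrder_succ (i : Fin (n + 1)) (t : Fin n)
    (ht : (arrivalOrder θ).symm i ≤ t.castSucc) : arrivalOrder θ t.succ = others θ i t := by
  rw [others, Fin.succAbove_of_le_castSucc _ _ ht]

/-- The first `T` agents other than `i`. -/
def firstOthers (θ : Fin (n + 1) → AgentType) (i T : Fin (n + 1)) : Finset (Fin (n + 1)) :=
  (Finset.univ.filter fun t : Fin n => t.castSucc < T).image (others θ i)

theorem notMem_firstOthers (i T : Fin (n + 1)) : i ∉ firstOthers θ i T := by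
  unfold firstOthers
  simp only [Finset.mem_image, not_exists, not_and]
  exact fun t _ => others_ne i t

theorem others_injective (i : Fin (n + 1)) : Function.Injective (others θ i) := fun _ _ h =>
  Fin.succAbove_right_injective ((arrivalOrder θ).injective h)

theorem others_mem_firstOthers {i T : Fin (n + 1)} {t : Fin n} :
    others θ i t ∈ firstOthers θ i T ↔ t.castSucc < T := by
  unfold firstOthers
  rw [Finset.mem_image]
  constructor
  · rintro ⟨s, hs, h⟩
    rw [← others_injective i h]
    exact (Finset.mem_filter.1 hs).2
  · intro h
    exact ⟨t, by simpa using h, rfl⟩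

theorem exists_others_eq {i j : Fin (n + 1)} (hj : j ≠ i) : ∃ t, others θ i t = j := by
  have : j ∈ Set.range (others θ i) := by
    rw [range_others]
    exact hj
  exact this

theorem others_mem_sampleSet {i T : Fin (n + 1)} {t : Fin n} :
    others θ i t ∈ sampleSet θ T ↔ ((arrivalOrder θ).symm i).succAbove t ≤ T := by
  rw [mem_sampleSet, others, Equiv.symm_apply_apply]

theorem sampleSet_erase_of_mem {i T : Fin (n + 1)} (hi : i ∈ sampleSet θ T) :
    (sampleSet θ T).erase i = firstOthers θ i T := by
  have hs := mem_sampleSet.1 hi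
  ext j
  by_cases hj : j = i
  · subst hj
    simp [notMem_firstOthers]
  · obtain ⟨t, rfl⟩ := exists_others_eq (θ := θ) hj
    rw [Finset.mem_erase, others_mem_firstOthers, others_mem_sampleSet]
    simp only [ne_eq, hj, not_false_eq_true, true_and]
    rcases lt_or_ge t.castSucc ((arrivalOrder θ).symm i) with h | h
    · rw [Fin.succAbove_of_castSucc_lt _ _ h]
      exact ⟨fun _ => h.trans_le hs, fun h => h.le⟩
    · rw [Fin.succAbove_of_le_castSucc _ _ h]
      exact Fin.castSucc_lt_iff_succ_le.symm

theorem sampleSet_erase_of_notMem {i T : Fin (n + 1)} (hi : i ∉ sampleSet θ T) :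
    (sampleSet θ T).erase (arrivalOrder θ T) = firstOthers θ i T := by
  have hs : T < (arrivalOrder θ).symm i := not_le.1 fun h => hi (mem_sampleSet.2 h)
  ext j
  by_cases hj : j = i
  · subst hj
    simp [notMem_firstOthers, hi]
  · obtain ⟨t, rfl⟩ := exists_others_eq (θ := θ) hj
    rw [Finset.mem_erase, others_mem_firstOthers, others_mem_sampleSet, others, ne_eq,
      EmbeddingLike.apply_eq_iff_eq]
    rcases lt_or_ge t.castSucc ((arrivalOrder θ).symm i) with h | h
    · rw [Fin.succAbove_of_castSucc_lt _ _ h]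
      exact ⟨fun h => lt_of_le_of_ne h.2 h.1, fun h => ⟨h.ne, h.le⟩⟩
    · rw [Fin.succAbove_of_le_castSucc _ _ h]
      have h1 : T < t.succ := (hs.trans_le h).trans (Fin.castSucc_lt_succ)
      exact ⟨fun h => absurd h.2 (not_le.2 h1), fun h' => absurd h' (not_lt.2 (hs.le.trans h))⟩

theorem firstHalf_of_notMem {i T : Fin (n + 1)} (hi : i ∉ sampleSet θ T)
    (side : Fin (n + 1) → Bool) : firstHalf θ T side =
      (firstOthers θ i T).filter fun j => side j ≠ side (arrivalOrder θ T) := by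
  rw [← sampleSet_erase_of_notMem hi]
  ext j
  simp only [firstHalf, Finset.mem_filter, Finset.mem_erase]
  constructor
  · rintro ⟨h1, h2⟩
    exact ⟨⟨fun h => h2 (h ▸ rfl), h1⟩, h2⟩
  · rintro ⟨⟨-, h1⟩, h2⟩
    exact ⟨h1, h2⟩

theorem secondHalf_erase_of_notMem {i T : Fin (n + 1)} (hi : i ∉ sampleSet θ T)
    (side : Fin (n + 1) → Bool) : (secondHalf θ T side).erase (arrivalOrder θ T) =
      (firstOthers θ i T).filter fun j => side j = side (arrivalOrder θ T) := by
  rw [← sampleSet_erase_of_notMem hi]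
  ext j
  simp only [secondHalf, Finset.mem_filter, Finset.mem_erase]
  tauto

/-- The agents of `B` who arrive before `i`. -/
def collectionBefore (θ : Fin (n + 1) → AgentType) (T i : Fin (n + 1)) : List (Fin (n + 1)) :=
  ((List.finRange (n + 1)).filter fun t => T < t ∧ t < (arrivalOrder θ).symm i).map
    (arrivalOrder θ)

theorem filter_finRange_split (N : ℕ) (p : Fin N → Prop) [DecidablePred p] (s : Fin N) :
    (List.finRange N).filter (fun t => p t) =
      (List.finRange N).filter (fun t => p t ∧ t < s) ++
        (List.finRange N).filter (fun t => p t ∧ s ≤ t) := by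
  have h : ∀ l : List (Fin N), l.SortedLT → l.filter (fun t => p t) =
      l.filter (fun t => p t ∧ t < s) ++ l.filter (fun t => p t ∧ s ≤ t) := by
    intro l hl
    induction l with
    | nil => rfl
    | cons a l ih =>
      have hl' := List.pairwise_cons.1 hl.pairwise
      have ih := ih hl'.2.sortedLT
      rcases lt_or_ge a s with h | h
      · by_cases ha : p a
        · simp [h, ha, ih]
        · simp [ha, ih]
      · have h0 : l.filter (fun t => p t ∧ t < s) = [] := by
          rw [List.filter_eq_nil_iff]
          intro b hb
          simp only [decide_eq_true_eq, not_and, not_lt]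
          exact fun _ => h.trans (hl'.1 b hb).le
        rw [h0, List.nil_append] at ih
        by_cases ha : p a
        · simp [h, not_lt.2 h, ha, ih]
          simpa using h0
        · simp [ha, ih]
          simpa using h0
  exact h _ (List.pairwise_lt_finRange N).sortedLT

theorem filter_finRange_eq_cons (N : ℕ) (p : Fin N → Prop) [DecidablePred p] (s : Fin N)
    (hs : p s) :
    (List.finRange N).filter (fun t => p t ∧ s ≤ t) =
      s :: (List.finRange N).filter (fun t => p t ∧ s < t) := by
  have h1 : ((List.finRange N).filter (fun t => p t ∧ s ≤ t)).SortedLT :=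
    ((List.pairwise_lt_finRange N).filter _).sortedLT
  have h2 : (s :: (List.finRange N).filter (fun t => p t ∧ s < t)).SortedLT := by
    refine List.Pairwise.sortedLT (List.pairwise_cons.2 ⟨?_, (List.pairwise_lt_finRange N).filter _⟩)
    intro t ht
    have := (List.mem_filter.1 ht).2
    simp only [decide_eq_true_eq] at this
    exact this.2
  refine List.SortedLT.eq_of_mem_iff h1 h2 fun t => ?_
  simp only [List.mem_filter, List.mem_finRange, true_and, decide_eq_true_eq, List.mem_cons]
  constructor
  · rintro ⟨h3, h4⟩
    rcases h4.eq_or_lt with rfl | h5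
    · exact Or.inl rfl
    · exact Or.inr ⟨h3, h5⟩
  · rintro (rfl | ⟨h3, h4⟩)
    · exact ⟨hs, le_rfl⟩
    · exact ⟨h3, h4.le⟩

theorem exists_collectionList_eq {i T : Fin (n + 1)} (hi : i ∉ sampleSet θ T) :
    ∃ l₂, collectionList θ T = collectionBefore θ T i ++ i :: l₂ := by
  have hs : T < (arrivalOrder θ).symm i := not_le.1 fun h => hi (mem_sampleSet.2 h)
  refine ⟨((List.finRange (n + 1)).filter fun t => T < t ∧ (arrivalOrder θ).symm i < t).map
    (arrivalOrder θ), ?_⟩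
  unfold collectionList collectionBefore
  rw [filter_finRange_split (n + 1) (fun t => T < t) ((arrivalOrder θ).symm i), List.map_append,
    filter_finRange_eq_cons (n + 1) (fun t => T < t) _ hs, List.map_cons, Equiv.apply_symm_apply]

/-- If a misreport moves agent `i` to a later place, then she is preceded by the same agents and
possibly some more. -/
theorem exists_collectionBefore_update_eq (hθ : Function.Injective fun i => (θ i).arrival)
    {i T : Fin (n + 1)} {r : AgentType}
    (h : (arrivalOrder θ).symm i ≤ (arrivalOrder (Function.update θ i r)).symm i) :
    ∃ l, collectionBefore (Function.update θ i r) T i = collectionBefore θ T i ++ l := by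
  set θ' := Function.update θ i r with hθ'
  refine ⟨((List.finRange (n + 1)).filter fun t => (T < t ∧ t < (arrivalOrder θ').symm i) ∧
    (arrivalOrder θ).symm i ≤ t).map (arrivalOrder θ'), ?_⟩
  unfold collectionBefore
  rw [filter_finRange_split (n + 1) (fun t => T < t ∧ t < (arrivalOrder θ').symm i)
    ((arrivalOrder θ).symm i), List.map_append]
  congr 1
  have h1 : (List.finRange (n + 1)).filter (fun t => (T < t ∧ t < (arrivalOrder θ').symm i) ∧
      t < (arrivalOrder θ).symm i) =
      (List.finRange (n + 1)).filter fun t => T < t ∧ t < (arrivalOrder θ).symm i := by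
    refine List.filter_congr fun t _ => ?_
    simp only [decide_eq_decide]
    exact ⟨fun h => ⟨h.1.1, h.2⟩, fun h' => ⟨⟨h'.1, h'.2.trans_le h⟩, h'.2⟩⟩
  rw [h1]
  refine List.map_congr_left fun t ht => ?_
  have ht := (List.mem_filter.1 ht).2
  simp only [decide_eq_true_eq] at ht
  have htn : t ≠ Fin.last n := (ht.2.trans_le (Fin.le_last _)).ne
  obtain ⟨u, rfl⟩ := Fin.exists_castSucc_eq.2 htn
  rw [arrivalOrder_castSucc i u ht.2, arrivalOrder_castSucc i u (ht.2.trans_le h),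
    others_update hθ]

theorem arrival_others_le_of_lt {i : Fin (n + 1)} {t : Fin n} {s : Fin (n + 1)}
    (h : t.castSucc < s) :
    (θ (others θ i t)).arrival ≤ (θ (arrivalOrder θ s)).arrival := by
  refine monotone_arrival_arrivalOrder θ ?_
  rcases lt_or_ge t.castSucc ((arrivalOrder θ).symm i) with h1 | h1
  · rw [Fin.succAbove_of_castSucc_lt _ _ h1]
    exact h.le
  · rw [Fin.succAbove_of_le_castSucc _ _ h1]
    exact Fin.castSucc_lt_iff_succ_le.1 h

end Arrival

/-! ### Individual rationality and truthfulness -/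

section Truthful

variable {n : ℕ} {m : ℝ} {P : PricingRule (Fin (n + 1))} {θ : Fin (n + 1) → AgentType}
  {T : Fin (n + 1)} {ρ : ℝ → PMF ℝ} {Q : ℝ → Prop} {i : Fin (n + 1)}

theorem arrival_le_of_mem_sampleSet (hi : i ∈ sampleSet θ T) :
    (θ i).arrival ≤ (θ (arrivalOrder θ T)).arrival := by
  have := monotone_arrival_arrivalOrder θ (mem_sampleSet.1 hi)
  simpa using this

theorem IsRounding.expectation_view_nonneg (hρ : IsRounding ρ Q) (hQ : Q (m / 4))
    (hθ : ∀ j, (θ j).Valid) (hP : ∀ S, 0 < P.price θ S) (side : Fin (n + 1) → Bool) :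
    0 ≤ expectation ((rsOnlineGiven m P (saleAlloc ρ) θ T side).map (view i))
      (netOf (θ i)) := by
  have hb : ∀ j, 0 ≤ (θ j).budget := fun j => (hθ j).2.2
  by_cases hi : i ∈ sampleSet θ T
  · rw [hρ.expectation_view_of_mem hQ hb hP hi (arrival_le_of_mem_sampleSet hi)]
    split_ifs
    · exact le_rfl
    · exact hρ.offerValue_nonneg hQ hb hP _ _ hQ
  · obtain ⟨l₂, hl⟩ := exists_collectionList_eq hi
    rw [hρ.expectation_view_of_notMem (hθ i).1 hi hl]
    refine expectation_nonneg fun s hs => ?_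
    obtain ⟨⟨h1, -⟩, h2, -⟩ := hρ.of_mem_support_stocksAfter hb hQ (hP _) (hP _) hQ hQ hs
    have h3 := hρ.offerValue_nonneg (i := i) hQ hb hP (firstHalf θ T side)
      ((secondHalf θ T side).erase (arrivalOrder θ T)) h1
    have h4 := hρ.offerValue_nonneg (i := i) hQ hb hP
      ((secondHalf θ T side).erase (arrivalOrder θ T)) (firstHalf θ T side) h2
    linarith

theorem IsRounding.payment_le_budget (hρ : IsRounding ρ Q) (hQ : Q (m / 4))
    (hb : ∀ j, 0 ≤ (θ j).budget) (hP : ∀ S, 0 < P.price θ S) (side : Fin (n + 1) → Bool)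
    {w : ℝ × ℝ × ℝ}
    (hw : w ∈ ((rsOnlineGiven m P (saleAlloc ρ) θ T side).map (view i)).support) :
    w.2.1 ≤ (θ i).budget := by
  by_cases hi : i ∈ sampleSet θ T
  · rw [rsOnlineGiven_map_view_of_mem hρ hQ hb hP hi] at hw
    split_ifs at hw
    · simp only [PMF.support_pure, Set.mem_singleton_iff] at hw
      simpa [hw] using hb i
    · obtain ⟨z, hz, rfl⟩ := (PMF.mem_support_map_iff _ _ _).1 hw
      exact snd_offer_le (hP _) hb hz
  · obtain ⟨l₂, hl⟩ := exists_collectionList_eq hi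
    rw [rsOnlineGiven_map_view_of_notMem hi hl] at hw
    obtain ⟨z, hz, rfl⟩ := (PMF.mem_support_map_iff _ _ _).1 hw
    obtain ⟨s, -, hz⟩ := (PMF.mem_support_bind_iff _ _ _).1 hz
    obtain ⟨c, -, hz⟩ := (PMF.mem_support_bind_iff _ _ _).1 hz
    split_ifs at hz
    · exact snd_offer_le (hP _) hb hz
    · exact snd_offer_le (hP _) hb hz

/-- The two halves of `C`, in one of the two orders with equal probability, are distributed like the
half of `C` on the side of `i` and the half on the other side. -/
theorem expectation_halves (F : Finset (Fin (n + 1)) → Finset (Fin (n + 1)) → ℝ)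
    {C : Finset (Fin (n + 1))} (hi : i ∉ C) (j : Fin (n + 1)) :
    expectation (PMF.uniformOfFintype (Fin (n + 1) → Bool)) (fun side =>
      (F (C.filter fun k => side k ≠ side j) (C.filter fun k => side k = side j) +
        F (C.filter fun k => side k = side j) (C.filter fun k => side k ≠ side j)) / 2) =
    expectation (PMF.uniformOfFintype (Fin (n + 1) → Bool)) fun side =>
      F (C.filter fun k => side k = side i) (C.filter fun k => side k ≠ side i) := by
  set G : (Fin (n + 1) → Bool) → ℝ := fun side =>
    F (C.filter fun k => side k = side i) (C.filter fun k => side k ≠ side i) with hG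
  let flip : (Fin (n + 1) → Bool) → (Fin (n + 1) → Bool) := fun side =>
    Function.update side i (!side i)
  have hflip : Function.Involutive flip := by
    intro side
    simp [flip]
  have h1 : ∀ side, (F (C.filter fun k => side k ≠ side j) (C.filter fun k => side k = side j) +
      F (C.filter fun k => side k = side j) (C.filter fun k => side k ≠ side j)) / 2 =
      (G side + G (flip side)) * (1 / 2) := by
    intro side
    have h2 : G (flip side) =
        F (C.filter fun k => side k ≠ side i) (C.filter fun k => side k = side i) := by
      have h3 : ∀ k ∈ C, flip side k = side k := fun k hk =>
        Function.update_of_ne (by rintro rfl; exact hi hk) _ _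
      have h4 : flip side i = !side i := Function.update_self _ _ _
      simp only [hG, h4]
      congr 1
      · refine Finset.filter_congr fun k hk => ?_
        rw [h3 k hk]
        cases side k <;> cases side i <;> simp
      · refine Finset.filter_congr fun k hk => ?_
        rw [h3 k hk]
        cases side k <;> cases side i <;> simp
    rw [h2]
    by_cases hij : side i = side j
    · simp only [hG, hij]
      ring
    · have h5 : ∀ k, (side k = side i) = (side k ≠ side j) := by
        intro k
        revert hij
        cases side k <;> cases side i <;> cases side j <;> simp
      have h6 : ∀ k, (side k ≠ side i) = (side k = side j) := by
        intro k
        revert hij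
        cases side k <;> cases side i <;> cases side j <;> simp
      simp only [hG, h6, h5]
      ring
  simp only [h1]
  rw [expectation_mul_const, expectation_add]
  have h7 := expectation_uniform_equiv hflip.toPerm G
  simp only [Function.Involutive.coe_toPerm] at h7
  rw [h7]
  ring

/-- Given the number of tails, no misreport that respects the budget is better than the truth. The
first `T` of the others belong to the sampling set in any case, and the splitting coins give the
agent the same pair of halves in distribution wherever she is, so that a misreport can only change
when she is served and how much of the stock is left. -/
theorem IsRounding.expectation_view_update_le (hρ : IsRounding ρ Q) (hQ : Q (m / 4))
    (hθ : ValidProfile θ) {r : AgentType} (hr : r.Valid) (hP : ∀ S, 0 < P.price θ S)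
    (hP' : ∀ S, 0 < P.price (Function.update θ i r) S)
    (h : ∀ side, ∀ w ∈ ((rsOnlineGiven m P (saleAlloc ρ) (Function.update θ i r) T side).map
      (view i)).support, w.2.1 ≤ (θ i).budget) :
    expectation (PMF.uniformOfFintype (Fin (n + 1) → Bool)) (fun side => expectation
      ((rsOnlineGiven m P (saleAlloc ρ) (Function.update θ i r) T side).map (view i))
      (netOf (θ i))) ≤
    expectation (PMF.uniformOfFintype (Fin (n + 1) → Bool)) fun side => expectation
      ((rsOnlineGiven m P (saleAlloc ρ) θ T side).map (view i)) (netOf (θ i)) := by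
  have hb : ∀ j, 0 ≤ (θ j).budget := fun j => (hθ.1 j).2.2
  have := hρ.finitelySupported_saleAlloc (ι := Fin (n + 1))
  have hfs := fun A₁ A₂' l m₁ m₂ => finitelySupported_stocksAfter (m := m) (P := P)
    (alloc := saleAlloc ρ) (θ := θ) (A₁ := A₁) (A₂' := A₂') l m₁ m₂
  have hoth := others_update hθ.2 i r
  have hfirst : firstOthers (Function.update θ i r) i T = firstOthers θ i T := by
    unfold firstOthers
    rw [hoth]
  have hne : ∀ t, Function.update θ i r (others θ i t) = θ (others θ i t) := fun t =>
    Function.update_of_ne (others_ne i t) _ _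
  have hnn := hρ.expectation_view_nonneg (P := P) (T := T) (i := i) hQ hθ.1 hP
  by_cases hi : i ∈ sampleSet θ T
  · -- if she departs too early, the last agent of the sampling set is one of the first `T` others
    have hlate : (θ i).departure < (θ (arrivalOrder θ T)).arrival →
        ∃ t : Fin n, t.castSucc < T ∧ others θ i t = arrivalOrder θ T := by
      intro hd
      have h1 : arrivalOrder θ T ≠ i := by
        intro h1
        rw [h1] at hd
        exact absurd (hθ.1 i).1 (not_le.2 hd)
      have h2 : arrivalOrder θ T ∈ (sampleSet θ T).erase i :=
        Finset.mem_erase.2 ⟨h1, arrivalOrder_mem_sampleSet⟩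
      rw [sampleSet_erase_of_mem hi] at h2
      obtain ⟨t, ht, h3⟩ := Finset.mem_image.1 h2
      exact ⟨t, (Finset.mem_filter.1 ht).2, h3⟩
    have htruth := fun side => hρ.expectation_view_of_mem (P := P) (side := side) hQ hb hP hi
      (arrival_le_of_mem_sampleSet hi)
    rw [sampleSet_erase_of_mem hi] at htruth
    by_cases hi' : i ∈ sampleSet (Function.update θ i r) T
    · -- she stays in the sampling set: the offer is the same
      refine expectation_mono fun side _ => ?_
      refine (hρ.expectation_view_update_of_mem_le hQ hb hP hr.2.2 hP' hi' (h side)).trans ?_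
      rw [sampleSet_erase_of_mem hi', hfirst]
      split_ifs with ht
      · rw [htruth side]
        split_ifs with hd
        · exfalso
          obtain ⟨t, ht1, ht2⟩ := hlate hd
          have h1 := arrival_others_le_of_lt (θ := Function.update θ i r) (i := i) ht1
          rw [hoth, hne, ht2] at h1
          linarith [ht.2]
        · exact le_rfl
      · exact hnn side
    · -- she moves to the collection phase: the offer is the same in distribution, but with a stock
      -- that may be smaller
      obtain ⟨l₂, hl⟩ := exists_collectionList_eq hi'
      have hdev := fun side => hρ.expectation_view_update_of_notMem_le hQ hb hP hr.2.2 hi' hl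
        (firstHalf_of_notMem hi' side) (secondHalf_erase_of_notMem hi' side) (h side)
      rw [hfirst] at hdev
      by_cases ht : (θ i).arrival ≤ r.arrival ∧ r.arrival ≤ (θ i).departure
      · simp only [if_pos ht] at hdev
        -- she is served in time if she tells the truth: otherwise the sampling phase ends with one
        -- of the first `T` others, who all arrive before the reported arrival
        have hd : ¬ (θ i).departure < (θ (arrivalOrder θ T)).arrival := by
          intro hd
          obtain ⟨t, ht1, ht2⟩ := hlate hd
          have h0 : T < (arrivalOrder (Function.update θ i r)).symm i :=
            not_le.1 fun h => hi' (mem_sampleSet.2 h)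
          have h1 := arrival_others_le_of_lt (θ := Function.update θ i r) (i := i) (ht1.trans h0)
          rw [hoth, hne, ht2, Equiv.apply_symm_apply, Function.update_self] at h1
          linarith [ht.2]
        simp only [htruth, if_neg hd]
        rw [← expectation_halves (fun X Y => offerValue m P ρ θ i X Y (m / 4))
          (notMem_firstOthers i T) (arrivalOrder (Function.update θ i r) T)]
        refine expectation_mono fun side _ => (hdev side).trans ?_
        refine (expectation_mono (g := fun _ => _) fun s hs => ?_).trans
          (expectation_const _ _).le
        obtain ⟨⟨h1, h2⟩, h3, h4⟩ :=
          hρ.of_mem_support_stocksAfter hb hQ (hP _) (hP _) hQ hQ hs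
        exact div_le_div_of_nonneg_right (add_le_add
          (hρ.offerValue_mono hQ hb hP _ _ h1 hQ h2)
          (hρ.offerValue_mono hQ hb hP _ _ h3 hQ h4)) zero_le_two
      · simp only [if_neg ht] at hdev
        exact expectation_mono fun side _ => (hdev side).trans (hnn side)
  · have hs : T < (arrivalOrder θ).symm i := not_le.1 fun h => hi (mem_sampleSet.2 h)
    obtain ⟨t, rfl⟩ := Fin.exists_castSucc_eq.2 (hs.trans_le (Fin.le_last _)).ne
    have hlast : arrivalOrder θ t.castSucc = others θ i t := arrivalOrder_castSucc i t hs
    have hstrict : ∀ u < (arrivalOrder θ).symm i,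
        (θ (arrivalOrder θ u)).arrival < (θ i).arrival := by
      intro u hu
      refine lt_of_le_of_ne ?_ ?_
      · simpa using monotone_arrival_arrivalOrder θ hu.le
      · intro h1
        rw [← hθ.2 h1, Equiv.symm_apply_apply] at hu
        exact lt_irrefl _ hu
    by_cases hi' : i ∈ sampleSet (Function.update θ i r) t.castSucc
    · refine expectation_mono fun side _ => ?_
      refine (hρ.expectation_view_update_of_mem_le hQ hb hP hr.2.2 hP' hi' (h side)).trans ?_
      rw [if_neg]
      · exact hnn side
      · -- the sampling phase ends before her real arrival
        rintro ⟨h1, -⟩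
        have h2 := monotone_arrival_arrivalOrder (Function.update θ i r)
          (Fin.castSucc_lt_succ (i := t)).le
        simp only at h2
        rw [arrivalOrder_succ i t (mem_sampleSet.1 hi'), hoth, hne, ← hlast] at h2
        linarith [hstrict _ hs]
    · have hs' : t.castSucc < (arrivalOrder (Function.update θ i r)).symm i :=
        not_le.1 fun h => hi' (mem_sampleSet.2 h)
      have hlast' : arrivalOrder (Function.update θ i r) t.castSucc = arrivalOrder θ t.castSucc := by
        rw [hlast, arrivalOrder_castSucc i t hs', hoth]
      obtain ⟨l₂, hl⟩ := exists_collectionList_eq hi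
      obtain ⟨l₂', hl'⟩ := exists_collectionList_eq hi'
      refine expectation_mono fun side _ => ?_
      refine (hρ.expectation_view_update_of_notMem_le hQ hb hP hr.2.2 hi' hl'
        (firstHalf_of_notMem hi' side) (secondHalf_erase_of_notMem hi' side) (h side)).trans ?_
      rw [hfirst, hlast', ← firstHalf_of_notMem hi, ← secondHalf_erase_of_notMem hi]
      split_ifs with ht
      · -- a report of a later arrival only moves her to a later place
        have hss : (arrivalOrder θ).symm i ≤ (arrivalOrder (Function.update θ i r)).symm i := by
          by_contra hlt
          rw [not_le] at hlt
          obtain ⟨u, hu⟩ := Fin.exists_castSucc_eq.2 (hlt.trans_le (Fin.le_last _)).ne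
          have h1 := monotone_arrival_arrivalOrder (Function.update θ i r)
            (Fin.castSucc_lt_succ (i := u)).le
          simp only at h1
          rw [arrivalOrder_succ i u hu.ge, hoth, hne, hu, Equiv.apply_symm_apply,
            Function.update_self, ← arrivalOrder_castSucc i u (hu ▸ hlt)] at h1
          linarith [hstrict _ (hu ▸ hlt), ht.1]
        obtain ⟨l, hl''⟩ := exists_collectionBefore_update_eq (T := t.castSucc) hθ.2 hss
        rw [hρ.expectation_view_of_notMem (hθ.1 i).1 hi hl, hl'', stocksAfter_append,
          expectation_bind]
        refine expectation_mono fun s hs1 => ?_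
        obtain ⟨⟨h1, h2⟩, h3, h4⟩ :=
          hρ.of_mem_support_stocksAfter hb hQ (hP _) (hP _) hQ hQ hs1
        refine (expectation_mono (g := fun _ => _) fun s' hs2 => ?_).trans
          (expectation_const _ _).le
        obtain ⟨⟨h5, h6⟩, h7, h8⟩ :=
          hρ.of_mem_support_stocksAfter hb hQ (hP _) (hP _) h1 h3 hs2
        exact div_le_div_of_nonneg_right (add_le_add
          (hρ.offerValue_mono hQ hb hP _ _ h5 h1 h6)
          (hρ.offerValue_mono hQ hb hP _ _ h7 h3 h8)) zero_le_two
      · exact hnn side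

theorem expectation_rsOnline_netValue (hρ : IsRounding ρ Q) (θ : Fin (n + 1) → AgentType)
    (t : AgentType) (i : Fin (n + 1)) :
    expectation (rsOnline m P (saleAlloc ρ) θ) (netValue t i) =
      expectation (PMF.uniformOfFintype (Fin n → Bool)) fun tosses =>
        expectation (PMF.uniformOfFintype (Fin (n + 1) → Bool)) fun side =>
          expectation ((rsOnlineGiven m P (saleAlloc ρ) θ (tailCount tosses) side).map (view i))
            (netOf t) := by
  have := hρ.finitelySupported_saleAlloc (ι := Fin (n + 1))
  rw [rsOnline_eq, expectation_bind]
  simp only [expectation_bind, expectation_map_netOf]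

theorem mem_support_rsOnline {alloc : AllocationRule (Fin (n + 1))}
    {o : Outcome (Fin (n + 1))} : o ∈ (rsOnline m P alloc θ).support ↔
      ∃ tosses side, o ∈ (rsOnlineGiven m P alloc θ (tailCount tosses) side).support := by
  rw [rsOnline_eq]
  simp only [PMF.mem_support_bind_iff, PMF.mem_support_uniformOfFintype, true_and]

theorem IsRounding.not_exceeds_budget (hρ : IsRounding ρ Q) (hQ : Q (m / 4))
    (hθ : ∀ j, (θ j).Valid) (hP : ∀ S, 0 < P.price θ S) (i : Fin (n + 1)) :
    ¬ ∃ o ∈ (rsOnline m P (saleAlloc ρ) θ).support, (θ i).budget < o.payment i := by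
  rintro ⟨o, ho, h⟩
  obtain ⟨tosses, side, ho⟩ := mem_support_rsOnline.1 ho
  refine absurd (hρ.payment_le_budget (w := view i o) hQ (fun j => (hθ j).2.2) hP side
    ((PMF.mem_support_map_iff _ _ _).2 ⟨o, ho, rfl⟩)) (not_le.2 h)

theorem IsRounding.individuallyRational (hρ : IsRounding ρ Q) (hQ : Q (m / 4))
    (hP : IsRevenuePricing m P) : IndividuallyRational (rsOnline m P (saleAlloc ρ)) := by
  intro θ hθ i
  have hP0 := hP.price_pos hθ.1
  unfold expectedUtility
  rw [if_neg (hρ.not_exceeds_budget hQ hθ.1 hP0 i), expectation_rsOnline_netValue hρ]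
  refine EReal.coe_nonneg.2 (expectation_nonneg fun tosses _ => expectation_nonneg fun side _ => ?_)
  exact hρ.expectation_view_nonneg hQ hθ.1 hP0 side

theorem IsRounding.truthful (hρ : IsRounding ρ Q) (hQ : Q (m / 4))
    (hP : IsRevenuePricing m P) : Truthful (rsOnline m P (saleAlloc ρ)) := by
  intro θ hθ i r hr
  have hθ' : ∀ j, (Function.update θ i r j).Valid := by
    intro j
    by_cases hj : j = i
    · subst hj; simpa using hr
    · simpa [Function.update_of_ne hj] using hθ.1 j
  have hP0 := hP.price_pos hθ.1
  have hP0' := hP.price_pos hθ'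
  unfold expectedUtility
  rw [if_neg (hρ.not_exceeds_budget hQ hθ.1 hP0 i)]
  split_ifs with h
  · exact bot_le
  · push Not at h
    rw [expectation_rsOnline_netValue hρ, expectation_rsOnline_netValue hρ]
    refine EReal.coe_le_coe_iff.2 (expectation_mono fun tosses _ => ?_)
    refine hρ.expectation_view_update_le hQ hθ hr hP0 hP0' fun side w hw => ?_
    obtain ⟨o, ho, rfl⟩ := (PMF.mem_support_map_iff _ _ _).1 hw
    exact h o (mem_support_rsOnline.2 ⟨tosses, side, ho⟩)

end Truthful

/-! ### The heterogeneous benchmark -/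

section Benchmark

open scoped Classical in
/-- What the agents with value at least `p` can spend in total, for the agents in `S`. -/
def wealth {ι : Type} (v b : ι → ℝ) (S : Finset ι) (p : ℝ) : ℝ :=
  ∑ i ∈ S, if p ≤ v i then b i else 0

variable {ι : Type} {v b : ι → ℝ} {S : Finset ι} {k p : ℝ}

theorem uniformRevenue_eq (hp : 0 < p) :
    uniformRevenue v b S k p = min (wealth v b S p) (k * p) := by
  unfold uniformRevenue wealth
  rw [min_mul_of_nonneg _ _ hp.le, ← Finset.sum_div, div_mul_cancel₀ _ hp.ne', Finset.sum_filter]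

theorem wealth_anti (hb : ∀ i, 0 ≤ b i) : Antitone (wealth v b S) := by
  intro p q hpq
  refine Finset.sum_le_sum fun i _ => ?_
  split_ifs with h1 h2
  · exact le_rfl
  · exact absurd (hpq.trans h1) h2
  · exact hb i
  · exact le_rfl

open scoped Classical in
/-- If agents with values above `c` have positive wealth, then it is their wealth at some price
above `c`, namely at the lowest of their values. -/
theorem exists_wealth_eq (c : ℝ) (h : 0 < ∑ i ∈ S, if c < v i then b i else 0) :
    ∃ j, c < v j ∧ wealth v b S (v j) = ∑ i ∈ S, if c < v i then b i else 0 := by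
  have hne : (S.filter fun i => c < v i).Nonempty := by
    by_contra h0
    rw [Finset.not_nonempty_iff_eq_empty] at h0
    rw [← Finset.sum_filter, h0] at h
    simp at h
  obtain ⟨j, hj, hmin⟩ := Finset.exists_min_image _ v hne
  obtain ⟨hjS, hcj⟩ := Finset.mem_filter.1 hj
  refine ⟨j, hcj, Finset.sum_congr rfl fun i hi => ?_⟩
  by_cases hci : c < v i
  · rw [if_pos hci, if_pos (hmin i (Finset.mem_filter.2 ⟨hi, hci⟩))]
  · rw [if_neg hci, if_neg fun h => hci (hcj.trans_le h)]

theorem heterogeneousOPT_nonneg : 0 ≤ heterogeneousOPT v b S k := by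
  refine Real.sSup_nonneg ?_
  rintro _ ⟨q, x, h, -, rfl⟩
  exact Finset.sum_nonneg fun i hi => mul_nonneg (h i hi).2.2.1 (h i hi).1

/-- Discriminating between agents at most doubles the revenue: agents with values above
`OPT / k` have wealth at most `OPT`, and the others pay at most `OPT / k` for each item. -/
theorem heterogeneousOPT_le (hv : ∀ i, 0 ≤ v i) (hb : ∀ i, 0 ≤ b i) (hk : 0 < k) :
    heterogeneousOPT v b S k ≤ 2 * uniformOPT v b S k := by
  classical
  obtain ⟨p, hp⟩ := exists_isOptimalPrice v b S k (fun i _ => hb i) hk.le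
  set R := uniformOPT v b S k with hR
  have hRp : R = uniformRevenue v b S k p := uniformOPT_eq_of_isOptimalPrice hp
  have hle : ∀ q, 0 < q → min (wealth v b S q) (k * q) ≤ R := fun q hq => by
    rw [← uniformRevenue_eq hq, hRp]
    exact hp.2 q hq
  have hwealth : ∀ q, 0 ≤ wealth v b S q := fun q =>
    Finset.sum_nonneg fun i _ => by split_ifs <;> [exact hb i; exact le_rfl]
  have hR0 : 0 ≤ R := (le_min (hwealth p) (by have := hp.1; positivity)).trans (hle p hp.1)
  have hrich : ∑ i ∈ S, (if R / k < v i then b i else 0) ≤ R := by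
    by_contra h
    rw [not_le] at h
    obtain ⟨j, hj, hw⟩ := exists_wealth_eq (R / k) (hR0.trans_lt h)
    have h1 := hle (v j) ((div_nonneg hR0 hk.le).trans_lt hj)
    rw [div_lt_iff₀ hk] at hj
    rw [hw, min_le_iff] at h1
    rcases h1 with h1 | h1 <;> linarith
  refine csSup_le ⟨0, 0, 0, fun i _ => ⟨le_rfl, hv i, le_rfl, by simpa using hb i⟩,
    by simpa using hk.le, by simp⟩ ?_
  rintro _ ⟨q, x, h1, h2, rfl⟩
  have h3 : ∀ i ∈ S, x i * q i ≤ (if R / k < v i then b i else 0) + R / k * x i := by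
    intro i hi
    obtain ⟨hq0, hqv, hx0, hxq⟩ := h1 i hi
    have h4 : 0 ≤ R / k * x i := mul_nonneg (div_nonneg hR0 hk.le) hx0
    split_ifs with h
    · linarith
    · rw [zero_add, mul_comm]
      exact mul_le_mul_of_nonneg_right (hqv.trans (not_lt.1 h)) hx0
  calc ∑ i ∈ S, x i * q i ≤ ∑ i ∈ S, ((if R / k < v i then b i else 0) + R / k * x i) :=
        Finset.sum_le_sum h3
    _ = ∑ i ∈ S, (if R / k < v i then b i else 0) + R / k * ∑ i ∈ S, x i := by
        rw [Finset.sum_add_distrib, Finset.mul_sum]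
    _ ≤ R + R / k * k :=
        add_le_add hrich (mul_le_mul_of_nonneg_left h2 (div_nonneg hR0 hk.le))
    _ = 2 * R := by
        rw [div_mul_cancel₀ _ hk.ne']
        ring

end Benchmark

/-! ### Concentration -/

section Concentration

variable {α : Type} [Fintype α] [DecidableEq α]

/-- Variance of a sum over a sample drawn without replacement. The covariance of two draws is not
positive, since the draws of all elements have a constant sum. -/
theorem expectation_perm_sq_le (A : Finset α) (g : α → ℝ) {c : ℝ} (hg : ∀ j, 0 ≤ g j)
    (hgc : ∀ j, g j ≤ c) :
    expectation (PMF.uniformOfFintype (Equiv.Perm α)) (fun τ =>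
      (∑ t ∈ A, g (τ t) - A.card / Fintype.card α * ∑ j, g j) ^ 2) ≤ c * ∑ j, g j := by
  set G := ∑ j, g j with hG
  set h : α → ℝ := fun j => g j - G / Fintype.card α with hh
  have hsum : ∑ j, h j = 0 := by
    simp only [hh, Finset.sum_sub_distrib, Finset.sum_const, Finset.card_univ, nsmul_eq_mul]
    rcases isEmpty_or_nonempty α with hα | hα
    · simp [hG]
    · have : (Fintype.card α : ℝ) ≠ 0 := by exact_mod_cast Fintype.card_ne_zero
      rw [mul_div_cancel₀ _ this, hG, sub_self]
  set e : α → α → ℝ := fun t u =>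
    expectation (PMF.uniformOfFintype (Equiv.Perm α)) fun τ => h (τ t) * h (τ u) with he
  have hdiag : ∀ t, 0 ≤ e t t := fun t => expectation_nonneg fun τ _ => mul_self_nonneg _
  have hoff : ∀ t u, t ≠ u → e t u ≤ 0 := by
    intro t u htu
    have h1 : ∀ u' ∈ Finset.univ.erase t, e t u' = e t u := by
      intro u' hu'
      have hu' := Finset.ne_of_mem_erase hu'
      have := expectation_uniform_equiv (Equiv.mulRight (Equiv.swap u' u))
        (fun τ : Equiv.Perm α => h (τ t) * h (τ u))
      simpa [he, Equiv.swap_apply_of_ne_of_ne hu'.symm htu] using this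
    have h2 : ∑ u', e t u' = 0 := by
      rw [he, ← expectation_sum]
      refine (expectation_congr fun τ _ => ?_).trans
        (expectation_const (PMF.uniformOfFintype (Equiv.Perm α)) 0)
      rw [← Finset.mul_sum, Equiv.sum_comp τ h, hsum, mul_zero]
    rw [← Finset.add_sum_erase _ _ (Finset.mem_univ t), Finset.sum_congr rfl h1, Finset.sum_const,
      nsmul_eq_mul] at h2
    have h3 : (0 : ℝ) < (Finset.univ.erase t).card := by
      exact_mod_cast Finset.card_pos.2 ⟨u, Finset.mem_erase.2 ⟨htu.symm, Finset.mem_univ _⟩⟩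
    nlinarith [hdiag t]
  have h1 : ∀ τ : Equiv.Perm α, (∑ t ∈ A, g (τ t) - A.card / Fintype.card α * G) ^ 2 =
      ∑ t ∈ A, ∑ u ∈ A, h (τ t) * h (τ u) := by
    intro τ
    rw [← Finset.sum_mul_sum, ← sq]
    congr 1
    simp only [hh, Finset.sum_sub_distrib, Finset.sum_const, nsmul_eq_mul]
    ring
  simp only [h1]
  rw [expectation_sum]
  simp only [expectation_sum]
  calc ∑ t ∈ A, ∑ u ∈ A, e t u ≤ ∑ t ∈ A, e t t := by
        refine Finset.sum_le_sum fun t ht => ?_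
        rw [← Finset.add_sum_erase _ _ ht]
        have : ∑ u ∈ A.erase t, e t u ≤ 0 :=
          Finset.sum_nonpos fun u hu => hoff t u (Finset.ne_of_mem_erase hu).symm
        linarith
    _ ≤ ∑ t, e t t := Finset.sum_le_sum_of_subset_of_nonneg (Finset.subset_univ _)
        fun t _ _ => hdiag t
    _ = ∑ j, h j * h j := by
        rw [he, ← expectation_sum, ← expectation_const (PMF.uniformOfFintype (Equiv.Perm α))
          (∑ j, h j * h j)]
        exact expectation_congr fun τ _ => Equiv.sum_comp τ fun j => h j * h j
    _ = ∑ j, (g j * g j) - G / Fintype.card α * G := by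
        have : ∀ j, h j * h j = g j * g j - G / Fintype.card α * g j -
            G / Fintype.card α * h j := by
          intro j
          simp only [hh]
          ring
        simp only [this, Finset.sum_sub_distrib, ← Finset.mul_sum, hsum]
        ring
    _ ≤ ∑ j, g j * g j := by
        have : 0 ≤ G / Fintype.card α * G := by
          have : 0 ≤ G := Finset.sum_nonneg fun j _ => hg j
          positivity
        linarith
    _ ≤ ∑ j, c * g j :=
        Finset.sum_le_sum fun j _ => mul_le_mul_of_nonneg_right (hgc j) (hg j)
    _ = c * G := by rw [← Finset.mul_sum]

open scoped Classical in
/-- Chebyshev's inequality for samples drawn without replacement. -/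
theorem expectation_perm_deviation_le (A : Finset α) (g : α → ℝ) {ε κ R : ℝ} (hκ : 0 < κ)
    (hR : 0 < R) (hε : 0 ≤ ε) (hg : ∀ j, 0 ≤ g j) (hgc : ∀ j, g j ≤ ε * R) :
    expectation (PMF.uniformOfFintype (Equiv.Perm α)) (fun τ =>
      if κ * R * ∑ j, g j < (∑ t ∈ A, g (τ t) - A.card / Fintype.card α * ∑ j, g j) ^ 2
      then (1 : ℝ) else 0) ≤ ε / κ := by
  set G := ∑ j, g j with hG
  have hG0 : 0 ≤ G := Finset.sum_nonneg fun j _ => hg j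
  rcases hG0.eq_or_lt with h0 | h0
  · have h1 : ∀ j, g j = 0 := fun j =>
      (Finset.sum_eq_zero_iff_of_nonneg fun j _ => hg j).1 h0.symm j (Finset.mem_univ j)
    simp only [h1, ← h0, Finset.sum_const_zero, mul_zero, sub_zero, ne_eq, OfNat.ofNat_ne_zero,
      not_false_eq_true, zero_pow, lt_irrefl, if_false, expectation_const]
    positivity
  · have h1 := expectation_perm_sq_le A g hg hgc
    have hpos : 0 < κ * R * G := by positivity
    have h2 : ∀ x : ℝ, (if κ * R * G < x ^ 2 then (1 : ℝ) else 0) ≤ 1 / (κ * R * G) * x ^ 2 := by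
      intro x
      split_ifs with h
      · rw [one_div_mul_eq_div, le_div_iff₀ hpos]
        linarith
      · positivity
    refine (expectation_mono fun τ _ => h2 _).trans ?_
    rw [expectation_const_mul, one_div_mul_eq_div, div_le_iff₀ hpos]
    refine h1.trans (le_of_eq ?_)
    rw [← hG]
    field_simp

/-- The sign of a coin. -/
def sign (c : Bool) : ℝ := if c then 1 else -1

theorem sign_mul_self (c : Bool) : sign c * sign c = 1 := by
  cases c <;> simp [sign]

/-- The square of a sum of independent signs has expectation the number of signs. -/
theorem expectation_sum_sign_sq (A : Finset α) :
    expectation (PMF.uniformOfFintype (α → Bool)) (fun s => (∑ t ∈ A, sign (s t)) ^ 2) =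
      A.card := by
  have h1 : ∀ t u, t ≠ u → expectation (PMF.uniformOfFintype (α → Bool))
      (fun s => sign (s t) * sign (s u)) = 0 := by
    intro t u htu
    let flip : (α → Bool) → (α → Bool) := fun s => Function.update s t (!s t)
    have hflip : Function.Involutive flip := fun s => by simp [flip]
    have h2 := expectation_uniform_equiv hflip.toPerm fun s => sign (s t) * sign (s u)
    have h3 : ∀ s : α → Bool, sign (flip s t) * sign (flip s u) =
        (-1) * (sign (s t) * sign (s u)) := by
      intro s
      simp only [flip, Function.update_self, Function.update_of_ne htu.symm]
      cases s t <;> simp [sign]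
    simp only [Function.Involutive.coe_toPerm, h3] at h2
    rw [expectation_const_mul] at h2
    linarith
  simp only [sq, Finset.sum_mul_sum, expectation_sum]
  have h2 : ∀ t ∈ A, ∑ u ∈ A, expectation (PMF.uniformOfFintype (α → Bool))
      (fun s => sign (s t) * sign (s u)) = 1 := by
    intro t ht
    rw [Finset.sum_eq_single_of_mem t ht fun u _ hu => h1 t u hu.symm]
    simp only [sign_mul_self, expectation_const]
  rw [Finset.sum_congr rfl h2]
  simp

open scoped Classical in
theorem expectation_sum_sign_deviation_le (A : Finset α) {c : ℝ} (hc : 0 < c) :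
    expectation (PMF.uniformOfFintype (α → Bool))
      (fun s => if c ^ 2 < (∑ t ∈ A, sign (s t)) ^ 2 then (1 : ℝ) else 0) ≤ A.card / c ^ 2 := by
  have h2 : ∀ x : ℝ, (if c ^ 2 < x ^ 2 then (1 : ℝ) else 0) ≤ 1 / c ^ 2 * x ^ 2 := by
    intro x
    split_ifs with h
    · rw [one_div_mul_eq_div, le_div_iff₀ (by positivity)]
      linarith
    · positivity
  refine (expectation_mono fun τ _ => h2 _).trans ?_
  rw [expectation_const_mul, expectation_sum_sign_sq, one_div_mul_eq_div]

end Concentration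

/-! ### Revenue of one channel for given positions -/

section Channel

variable {n : ℕ}

open scoped Classical in
/-- Chebyshev's inequality for a random matching, conditional on what happens in the places in `Y`:
the weights `g π` may depend on the matching through the places in `Y`. -/
theorem expectation_conditional_deviation_le {N : ℕ} {Y A : Finset (Fin N)} (hA : Disjoint A Y)
    (g : Equiv.Perm (Fin N) → Fin N → ℝ)
    (hgY : ∀ π π' : Equiv.Perm (Fin N), (∀ t ∈ Y, π t = π' t) → g π = g π') {ε κ R : ℝ}
    (hκ : 0 < κ) (hR : 0 < R) (hε : 0 ≤ ε) (hg : ∀ π j, 0 ≤ g π j)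
    (hgc : ∀ π j, g π j ≤ ε * R) :
    expectation (PMF.uniformOfFintype (Equiv.Perm (Fin N))) (fun π =>
      if κ * R * ∑ t ∈ Yᶜ, g π (π t) <
        (∑ t ∈ A, g π (π t) - A.card / (Yᶜ).card * ∑ t ∈ Yᶜ, g π (π t)) ^ 2
      then (1 : ℝ) else 0) ≤ ε / κ := by
  set F : Equiv.Perm (Fin N) → ℝ := fun π =>
    if κ * R * ∑ t ∈ Yᶜ, g π (π t) <
        (∑ t ∈ A, g π (π t) - A.card / (Yᶜ).card * ∑ t ∈ Yᶜ, g π (π t)) ^ 2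
      then (1 : ℝ) else 0 with hF
  let α := {t : Fin N // t ∉ Y}
  let ext : Equiv.Perm α → Equiv.Perm (Fin N) := fun τ => Equiv.Perm.ofSubtype τ
  have h1 : expectation (PMF.uniformOfFintype (Equiv.Perm (Fin N))) F =
      expectation (PMF.uniformOfFintype (Equiv.Perm (Fin N))) fun π =>
        expectation (PMF.uniformOfFintype (Equiv.Perm α)) fun τ => F (π * ext τ) := by
    rw [expectation_comm, ← expectation_const (PMF.uniformOfFintype (Equiv.Perm α))
      (expectation (PMF.uniformOfFintype (Equiv.Perm (Fin N))) F)]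
    exact expectation_congr fun τ _ => (expectation_uniform_equiv (Equiv.mulRight (ext τ)) F).symm
  rw [h1, ← expectation_const (PMF.uniformOfFintype (Equiv.Perm (Fin N))) (ε / κ)]
  refine expectation_mono fun π _ => ?_
  have h2 := expectation_perm_deviation_le (α := α) (A.subtype fun t => t ∉ Y)
    (fun t => g π (π t)) hκ hR hε (fun j => hg _ _) fun j => hgc _ _
  refine le_trans (le_of_eq (expectation_congr fun τ _ => ?_)) h2
  have h3 : g (π * ext τ) = g π := by
    refine hgY _ _ fun t ht => ?_
    simp only [ext, Equiv.Perm.mul_apply]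
    rw [Equiv.Perm.ofSubtype_apply_of_not_mem τ (not_not.2 ht)]
  have h4 : ∀ t : α, (π * ext τ) t = π (τ t) := fun t => by
    simp only [ext, Equiv.Perm.mul_apply, Equiv.Perm.ofSubtype_apply_coe]
  have h5 : ∀ f : Fin N → ℝ, ∑ t ∈ Yᶜ, f t = ∑ t : α, f t := fun f =>
    Finset.sum_subtype _ (fun t => by simp) f
  have h6 : ∀ f : Fin N → ℝ, ∑ t ∈ A, f t = ∑ t ∈ A.subtype (fun t => t ∉ Y), f t := fun f =>
    (Finset.sum_subtype_of_mem f fun t ht => Finset.disjoint_left.1 hA ht).symm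
  have h7 : (A.subtype fun t => t ∉ Y).card = A.card := by
    rw [Finset.card_subtype, Finset.filter_true_of_mem fun t ht => Finset.disjoint_left.1 hA ht]
  have h8 : Fintype.card α = (Yᶜ).card := by
    rw [Fintype.card_subtype]
    congr 1
    ext t
    simp
  simp only [hF, h3, h5, h6, h4]
  rw [h7, h8, Equiv.sum_comp τ fun t : α => g π (π t)]

/-- What the agents in the places in `A` can spend in total at price `q`, when `π` is the
matching. -/
def Market.wealthAt (E : Market n) (π : Equiv.Perm (Fin (n + 1))) (A : Finset (Fin (n + 1)))
    (q : ℝ) : ℝ :=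
  wealth (fun t => E.value (π t)) (fun t => E.budget (π t)) A q

/-- Expected revenue in one of the two channels of the collection phase: the price comes from the
agents in the places in `Y`, and the arriving agents are compared with those in `X`. -/
def Market.channelRevenue (E : Market n) (ρ : ℝ → PMF ℝ) (m : ℝ) (P : PricingRule (Fin (n + 1)))
    (X Y : Finset (Fin (n + 1))) (l : List (Fin (n + 1))) (π : Equiv.Perm (Fin (n + 1))) : ℝ :=
  P.price (E.profile π) Y * expectation (requested (saleAlloc ρ) (E.profile π) X
    (P.price (E.profile π) Y) (m / 4) l) fun z => min z (m / 4)

variable {E : Market n} {m R : ℝ} {P : PricingRule (Fin (n + 1))} {ρ : ℝ → PMF ℝ} {Q : ℝ → Prop}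
  {X Y : Finset (Fin (n + 1))} {l : List (Fin (n + 1))} {π : Equiv.Perm (Fin (n + 1))}

theorem Market.profile_valid (E : Market n) (π : Equiv.Perm (Fin (n + 1))) (i : Fin (n + 1)) :
    (E.profile π i).Valid :=
  ⟨E.arrival_le_departure i, E.value_nonneg _, E.budget_nonneg _⟩

theorem Market.wealthAt_add_compl (E : Market n) (π : Equiv.Perm (Fin (n + 1)))
    (A : Finset (Fin (n + 1))) (q : ℝ) :
    E.wealthAt π A q + E.wealthAt π Aᶜ q = wealth E.value E.budget Finset.univ q := by
  classical
  unfold Market.wealthAt wealth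
  rw [Finset.sum_add_sum_compl,
    Equiv.sum_comp π fun i => if q ≤ E.value i then E.budget i else 0]

theorem Market.sum_demand_profile (E : Market n) (π : Equiv.Perm (Fin (n + 1)))
    (A : Finset (Fin (n + 1))) (p : ℝ) :
    ∑ t ∈ A, demand (E.profile π) p t = E.wealthAt π A p / p := by
  unfold Market.wealthAt wealth
  rw [Finset.sum_div]
  refine Finset.sum_congr rfl fun t _ => ?_
  unfold demand Market.profile
  dsimp only
  split_ifs <;> simp

theorem Market.channelRevenue_nonneg (E : Market n) (hρ : IsRounding ρ Q) (hQ : Q (m / 4))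
    (hP : IsRevenuePricing m P) : 0 ≤ E.channelRevenue ρ m P X Y l π := by
  have hp := hP.price_pos (E.profile_valid π) Y
  refine mul_nonneg hp.le (expectation_nonneg fun z hz => le_min ?_ (hρ.nonneg _ hQ))
  exact hρ.requested_nonneg hp (fun j => (E.profile_valid π j).2.2) hQ z hz

/-- The revenue of a channel in which the price is not too low, the arriving agents are wealthy
at this price, and they have about twice the wealth of the agents they are compared with. -/
theorem Market.le_channelRevenue_of_wealth (E : Market n) (hρ : IsRounding ρ Q) (hQ : Q (m / 4))
    (hm : 0 < m) (hR : 0 < R) {p β : ℝ} (hp : P.price (E.profile π) Y = p) (hp0 : 0 < p)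
    (hb : ∀ i, E.budget i ≤ R / 10 ^ 9) (hl : l.Nodup) (hlX : ∀ i ∈ l, i ∉ X)
    (hmp : 2465 / 10000 * R ≤ m / 4 * p) (hβR : 70 / 100 * R ≤ β)
    (hBX : E.wealthAt π X p ≤ 34 / 100 * β)
    (hBL : 656 / 1000 * β ≤ E.wealthAt π l.toFinset p) :
    72 / 1000 * R ≤ E.channelRevenue ρ m P X Y l π := by
  have hbud : ∀ j, 0 ≤ (E.profile π j).budget := fun j => (E.profile_valid π j).2.2
  unfold Market.channelRevenue
  rw [hp]
  have hk0 : 0 < m / 4 := by linarith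
  have hlsum : (l.map (demand (E.profile π) p)).sum = E.wealthAt π l.toFinset p / p := by
    rw [← List.sum_toFinset _ hl, E.sum_demand_profile]
  -- `w / p` items yield the revenue `w`; the agents of the list can spend `4 * w`, because
  -- `656 / 1000 * (70 / 100)` is just above `4 * (114 / 1000)`
  set w := 114 / 1000 * R with hw
  have hw0 : 0 < w := by positivity
  have key := hρ.le_expectation_min_requested_of_demand hp0 hbud hQ hk0 hlX (y := w / p)
    (by
      intro i _
      unfold demand
      split_ifs
      · rw [div_le_iff₀ hp0]
        change E.budget (π i) ≤ _
        linarith [hb (π i)]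
      · exact hk0.le)
    (div_nonneg hw0.le hp0.le)
    (by
      rw [hlsum, mul_div_assoc']
      refine div_le_div_of_nonneg_right ?_ hp0.le
      linarith)
    (by
      rw [hlsum, E.sum_demand_profile]
      have e1 : 4 * w * E.wealthAt π X p ≤ m / 4 * p * E.wealthAt π l.toFinset p := by
        have e2 : 4 * w * E.wealthAt π X p ≤ 4 * w * (34 / 100 * β) :=
          mul_le_mul_of_nonneg_left hBX (by positivity)
        have e3 : 2465 / 10000 * R * (656 / 1000 * β) ≤ m / 4 * p * E.wealthAt π l.toFinset p :=
          mul_le_mul hmp hBL (by linarith) (by linarith)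
        have e4 : 4 * w * (34 / 100 * β) ≤ 2465 / 10000 * R * (656 / 1000 * β) := by
          have : 0 ≤ R * β := mul_nonneg hR.le (by linarith)
          have e5 : 4 * w * (34 / 100 * β) = 15504 / 100000 * (R * β) := by
            rw [hw]
            ring
          have e6 : 2465 / 10000 * R * (656 / 1000 * β) = 1617040 / 10000000 * (R * β) := by ring
          rw [e5, e6]
          exact mul_le_mul_of_nonneg_right (by norm_num) this
        linarith
      have e5 : 4 * (w / p) * (E.wealthAt π X p / p) = 4 * w * E.wealthAt π X p / p ^ 2 := by
        field_simp
      have e6 : m / 4 * (E.wealthAt π l.toFinset p / p) =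
          m / 4 * p * E.wealthAt π l.toFinset p / p ^ 2 := by
        field_simp
      rw [e5, e6]
      exact div_le_div_of_nonneg_right e1 (by positivity))
  have e1 : p * (w / p * (3 / 4) - (w / p) ^ 2 / (4 * (m / 4))) =
      3 / 4 * w - w ^ 2 / (4 * (m / 4 * p)) := by
    field_simp
  have e2 : w ^ 2 / (4 * (m / 4 * p)) ≤ 1342 / 100000 * R := by
    rw [div_le_iff₀ (by positivity)]
    have : 1342 / 100000 * R * (4 * (2465 / 10000 * R)) ≤
        1342 / 100000 * R * (4 * (m / 4 * p)) :=
      mul_le_mul_of_nonneg_left (by linarith) (by positivity)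
    have e3 : 0 ≤ R * R := by positivity
    have e4 : w ^ 2 = 12996 / 1000000 * (R * R) := by
      rw [hw]
      ring
    have e5 : 1342 / 100000 * R * (4 * (2465 / 10000 * R)) = 1323212 / 100000000 * (R * R) := by
      ring
    rw [e4]
    refine le_trans ?_ this
    rw [e5]
    exact mul_le_mul_of_nonneg_right (by norm_num) e3
  calc 72 / 1000 * R ≤ p * (w / p * (3 / 4) - (w / p) ^ 2 / (4 * (m / 4))) := by
        rw [e1]
        linarith
    _ ≤ _ := mul_le_mul_of_nonneg_left key hp0.le

open scoped Classical in
/-- The revenue of a channel when all samples are close to their expectations: `Y` and `X` are about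
a quarter of the places, and the list about a half. The prices `p₀` and `c` do not depend on the
samples: `p₀` is an optimal price for all agents, and `c` separates the prices at which the wealth is
a substantial part of `R` from the others. -/
theorem Market.le_channelRevenue (E : Market n) (hρ : IsRounding ρ Q) (hQ : Q (m / 4))
    (hP : IsRevenuePricing m P) (hm : 0 < m) (hR : 0 < R) {p₀ c : ℝ} (hp₀ : 0 < p₀)
    (hRw : R ≤ wealth E.value E.budget Finset.univ p₀) (hRm : R ≤ m * p₀)
    (hc : 95 / 100 * R ≤ wealth E.value E.budget Finset.univ c)
    (hc' : ∑ i, (if c < E.value i then E.budget i else 0) ≤ 95 / 100 * R)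
    (hb : ∀ i, E.budget i ≤ R / 10 ^ 9) (hl : l.Nodup) (hlX : ∀ i ∈ l, i ∉ X)
    (hY1 : 2475 / 10000 * ((n : ℝ) + 1) ≤ Y.card) (hY2 : Y.card ≤ 2525 / 10000 * ((n : ℝ) + 1))
    (hX : X.card ≤ 2525 / 10000 * ((n : ℝ) + 1))
    (hL : 495 / 1000 * ((n : ℝ) + 1) ≤ l.toFinset.card)
    (h1 : (E.wealthAt π Y p₀ - Y.card / ((n : ℝ) + 1) * wealth E.value E.budget Finset.univ p₀) ^ 2
      ≤ 1 / 10 ^ 6 * R * wealth E.value E.budget Finset.univ p₀)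
    (h2 : (∑ t ∈ Y, (if c < E.value (π t) then E.budget (π t) else 0) - Y.card / ((n : ℝ) + 1) *
      ∑ i, (if c < E.value i then E.budget i else 0)) ^ 2
      ≤ 1 / 10 ^ 6 * R * ∑ i, (if c < E.value i then E.budget i else 0))
    (h3 : (E.wealthAt π Y c - Y.card / ((n : ℝ) + 1) * wealth E.value E.budget Finset.univ c) ^ 2
      ≤ 1 / 10 ^ 6 * R * wealth E.value E.budget Finset.univ c)
    (h4 : (E.wealthAt π X (P.price (E.profile π) Y) - X.card / (Yᶜ).card *
      E.wealthAt π Yᶜ (P.price (E.profile π) Y)) ^ 2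
      ≤ 1 / 10 ^ 6 * R * E.wealthAt π Yᶜ (P.price (E.profile π) Y))
    (h5 : (E.wealthAt π l.toFinset (P.price (E.profile π) Y) - l.toFinset.card / (Yᶜ).card *
      E.wealthAt π Yᶜ (P.price (E.profile π) Y)) ^ 2
      ≤ 1 / 10 ^ 6 * R * E.wealthAt π Yᶜ (P.price (E.profile π) Y)) :
    72 / 1000 * R ≤ E.channelRevenue ρ m P X Y l π := by
  have hopt := hP (E.profile π) (E.profile_valid π) Y
  set p := P.price (E.profile π) Y with hp
  have hp0 : 0 < p := hopt.1
  have hN : (0 : ℝ) < (n : ℝ) + 1 := by positivity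
  -- bounds for the absolute deviation in place of bounds for its square
  have dev : ∀ {x G c : ℝ}, 0 ≤ c → c ^ 2 * G ≥ 1 / 10 ^ 6 * R → 0 ≤ G →
      x ^ 2 ≤ 1 / 10 ^ 6 * R * G → -(c * G) ≤ x ∧ x ≤ c * G := by
    intro x G c hc0 hcG hG hx
    refine abs_le_of_sq_le_sq' ?_ (mul_nonneg hc0 hG)
    nlinarith
  have hy1 : 2475 / 10000 ≤ (Y.card : ℝ) / ((n : ℝ) + 1) := by
    rw [le_div_iff₀ hN]
    exact hY1
  have hy2 : (Y.card : ℝ) / ((n : ℝ) + 1) ≤ 2525 / 10000 := by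
    rw [div_le_iff₀ hN]
    exact hY2
  set G1 := wealth E.value E.budget Finset.univ p₀ with hG1
  set G3 := wealth E.value E.budget Finset.univ c with hG3
  set G2 := ∑ i, (if c < E.value i then E.budget i else 0) with hG2
  set y := (Y.card : ℝ) / ((n : ℝ) + 1) with hy
  have hG2nonneg : 0 ≤ G2 :=
    Finset.sum_nonneg fun i _ => by split_ifs <;> [exact E.budget_nonneg _; exact le_rfl]
  -- the price `p₀` yields almost a quarter of `R` from `Y`, hence so does `p`
  have hYopt : 2465 / 10000 * R ≤ min (E.wealthAt π Y p) (m / 4 * p) := by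
    have e1 := hopt.2 p₀ hp₀
    rw [uniformRevenue_eq hp₀, uniformRevenue_eq hp0] at e1
    refine le_trans (le_min ?_ (by linarith)) e1
    have e2 := (dev (c := 1 / 1000) (by norm_num) (by linarith) (by linarith) h1).1
    have e3 : 2475 / 10000 * G1 ≤ y * G1 := mul_le_mul_of_nonneg_right hy1 (by linarith)
    change _ ≤ E.wealthAt π Y p₀
    linarith
  obtain ⟨hYp, hmp⟩ := le_min_iff.1 hYopt
  -- the wealth in `Y` at prices above `c` is at most about `95 / 400 * R`, which is not enough
  have hpc : p ≤ c := by
    by_contra hpc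
    rw [not_le] at hpc
    have e1 : E.wealthAt π Y p ≤
        ∑ t ∈ Y, (if c < E.value (π t) then E.budget (π t) else 0) := by
      refine Finset.sum_le_sum fun t _ => ?_
      split_ifs with h h'
      · exact le_rfl
      · exact absurd (hpc.trans_le h) h'
      · exact E.budget_nonneg _
      · exact le_rfl
    have e2 : (∑ t ∈ Y, (if c < E.value (π t) then E.budget (π t) else 0) - y * G2) ^ 2 ≤
        (1 / 1000 * R) ^ 2 := h2.trans (by nlinarith)
    have e3 := (abs_le_of_sq_le_sq' e2 (by positivity)).2
    have e4 : y * G2 ≤ 2525 / 10000 * (95 / 100 * R) :=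
      mul_le_mul hy2 hc' hG2nonneg (by norm_num)
    linarith
  -- hence the wealth outside of `Y` at the price `p` is at least about `3 / 4 * (95 / 100) * R`
  set β := E.wealthAt π Yᶜ p with hβ
  have hβR : 70 / 100 * R ≤ β := by
    have e1 : E.wealthAt π Yᶜ c ≤ β := wealth_anti (fun t => E.budget_nonneg _) hpc
    have e2 := E.wealthAt_add_compl π Y c
    have e3 := (dev (c := 11 / 10000) (by norm_num) (by linarith) (by linarith) h3).2
    have e4 : y * G3 ≤ 2525 / 10000 * G3 := mul_le_mul_of_nonneg_right hy2 (by linarith)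
    linarith
  have hr : ((Yᶜ).card : ℝ) = (n : ℝ) + 1 - Y.card := by
    rw [Finset.card_compl, Fintype.card_fin, Nat.cast_sub (by
      simpa using Finset.card_le_univ Y)]
    push_cast
    ring
  have hr0 : (0 : ℝ) < (Yᶜ).card := by
    rw [hr]
    linarith
  have hBX : E.wealthAt π X p ≤ 34 / 100 * β := by
    have e1 := (dev (c := 12 / 10000) (by norm_num) (by linarith) (by linarith) h4).2
    have e2 : (X.card : ℝ) / (Yᶜ).card ≤ 338 / 1000 := by
      rw [div_le_iff₀ hr0, hr]
      linarith
    have e3 : (X.card : ℝ) / (Yᶜ).card * β ≤ 338 / 1000 * β :=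
      mul_le_mul_of_nonneg_right e2 (by linarith)
    linarith
  have hBL : 656 / 1000 * β ≤ E.wealthAt π l.toFinset p := by
    have e1 := (dev (c := 12 / 10000) (by norm_num) (by linarith) (by linarith) h5).1
    have e2 : 6576 / 10000 ≤ (l.toFinset.card : ℝ) / (Yᶜ).card := by
      rw [le_div_iff₀ hr0, hr]
      linarith
    have e3 : 6576 / 10000 * β ≤ (l.toFinset.card : ℝ) / (Yᶜ).card * β :=
      mul_le_mul_of_nonneg_right e2 (by linarith)
    linarith
  exact E.le_channelRevenue_of_wealth hρ hQ hm hR hp.symm hp0 hb hl hlX hmp hβR hBX hBL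

end Channel

/-! ### Expected revenue of one channel -/

section ExpectedChannel

variable {n : ℕ} {E : Market n} {m R : ℝ} {P : PricingRule (Fin (n + 1))} {ρ : ℝ → PMF ℝ}
  {Q : ℝ → Prop} {X Y : Finset (Fin (n + 1))} {l : List (Fin (n + 1))}

open scoped Classical in
/-- The highest price at which the wealth is a substantial part of the optimal revenue. Above this
price the wealth is smaller. -/
theorem Market.exists_threshold (E : Market n) (hm : 0 < m) (hR : 0 < E.OPT m) :
    ∃ p₀ c : ℝ, 0 < p₀ ∧ E.OPT m ≤ wealth E.value E.budget Finset.univ p₀ ∧ E.OPT m ≤ m * p₀ ∧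
      95 / 100 * E.OPT m ≤ wealth E.value E.budget Finset.univ c ∧
      ∑ i, (if c < E.value i then E.budget i else 0) ≤ 95 / 100 * E.OPT m := by
  obtain ⟨p₀, hp₀⟩ := exists_isOptimalPrice E.value E.budget Finset.univ m
    (fun i _ => E.budget_nonneg i) hm.le
  have h1 : E.OPT m = uniformRevenue E.value E.budget Finset.univ m p₀ :=
    uniformOPT_eq_of_isOptimalPrice hp₀
  rw [uniformRevenue_eq hp₀.1] at h1
  obtain ⟨hw, hmp⟩ := le_min_iff.1 h1.le
  obtain ⟨c, hc, hmax⟩ := ((insert p₀ (Finset.univ.image E.value)).filter fun q =>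
    95 / 100 * E.OPT m ≤ wealth E.value E.budget Finset.univ q).exists_max_image id
    ⟨p₀, Finset.mem_filter.2 ⟨Finset.mem_insert_self _ _, by linarith⟩⟩
  refine ⟨p₀, c, hp₀.1, hw, hmp, (Finset.mem_filter.1 hc).2, ?_⟩
  by_contra h
  rw [not_le] at h
  obtain ⟨j, hj, hwj⟩ := exists_wealth_eq (b := E.budget) c (lt_trans (by linarith) h)
  have h2 := hmax (E.value j) (Finset.mem_filter.2 ⟨Finset.mem_insert_of_mem
    (Finset.mem_image_of_mem _ (Finset.mem_univ j)), by rw [hwj]; exact h.le⟩)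
  exact absurd hj (not_lt.2 h2)

open scoped Classical in
/-- For places of typical sizes, the revenue of a channel is a constant part of the optimal revenue.
-/
theorem Market.le_expectation_channelRevenue (E : Market n) (hρ : IsRounding ρ Q) (hQ : Q (m / 4))
    (hP : IsRevenuePricing m P) (hm : 0 < m) (hR : 0 < E.OPT m)
    (hb : ∀ i, E.budget i ≤ E.OPT m / 10 ^ 9) (hl : l.Nodup) (hlX : ∀ i ∈ l, i ∉ X)
    (hXY : Disjoint X Y) (hlY : Disjoint l.toFinset Y)
    (hY1 : 2475 / 10000 * ((n : ℝ) + 1) ≤ Y.card) (hY2 : Y.card ≤ 2525 / 10000 * ((n : ℝ) + 1))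
    (hX : X.card ≤ 2525 / 10000 * ((n : ℝ) + 1))
    (hL : 495 / 1000 * ((n : ℝ) + 1) ≤ l.toFinset.card) :
    71 / 1000 * E.OPT m ≤ expectation (PMF.uniformOfFintype (Equiv.Perm (Fin (n + 1))))
      (E.channelRevenue ρ m P X Y l) := by
  obtain ⟨p₀, c, hp₀, hRw, hRm, hc, hc'⟩ := E.exists_threshold hm hR
  set R := E.OPT m with hRdef
  -- each of the five deviations has probability at most `10⁻⁹ / 10⁻⁶`
  have hκ : (0 : ℝ) < 1 / 10 ^ 6 := by norm_num
  have hε : (0 : ℝ) ≤ 1 / 10 ^ 9 := by norm_num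
  have hb' : ∀ (q : Prop) [Decidable q] (i : Fin (n + 1)),
      0 ≤ (if q then E.budget i else 0) ∧ (if q then E.budget i else 0) ≤ 1 / 10 ^ 9 * R := by
    intro q _ i
    have h1 := E.budget_nonneg i
    have h2 := hb i
    split_ifs
    · exact ⟨h1, by linarith⟩
    · exact ⟨le_rfl, by positivity⟩
  -- the five events in which a sample is far from its expectation
  have k1 := expectation_perm_deviation_le Y (fun i => if p₀ ≤ E.value i then E.budget i else 0)
    hκ hR hε (fun i => (hb' _ i).1) fun i => (hb' _ i).2
  have k2 := expectation_perm_deviation_le Y (fun i => if c < E.value i then E.budget i else 0)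
    hκ hR hε (fun i => (hb' _ i).1) fun i => (hb' _ i).2
  have k3 := expectation_perm_deviation_le Y (fun i => if c ≤ E.value i then E.budget i else 0)
    hκ hR hε (fun i => (hb' _ i).1) fun i => (hb' _ i).2
  have hgY : ∀ π π' : Equiv.Perm (Fin (n + 1)), (∀ t ∈ Y, π t = π' t) →
      (fun i => if P.price (E.profile π) Y ≤ E.value i then E.budget i else 0) =
      fun i => if P.price (E.profile π') Y ≤ E.value i then E.budget i else 0 := by
    intro π π' h
    rw [P.price_congr (θ := E.profile π) (θ' := E.profile π') fun t ht => by
      simp only [Market.profile, h t ht]]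
  have k4 := expectation_conditional_deviation_le hXY
    (fun π i => if P.price (E.profile π) Y ≤ E.value i then E.budget i else 0) hgY
    hκ hR hε (fun π i => (hb' _ i).1) fun π i => (hb' _ i).2
  have k5 := expectation_conditional_deviation_le hlY
    (fun π i => if P.price (E.profile π) Y ≤ E.value i then E.budget i else 0) hgY
    hκ hR hε (fun π i => (hb' _ i).1) fun π i => (hb' _ i).2
  rw [Fintype.card_fin, Nat.cast_add, Nat.cast_one] at k1 k2 k3
  set U := PMF.uniformOfFintype (Equiv.Perm (Fin (n + 1))) with hU
  let ind : Prop → ℝ := fun q => if q then 1 else 0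
  have hind : ∀ q, 0 ≤ ind q := fun q => by
    simp only [ind]
    split_ifs <;> norm_num
  have hind1 : ∀ q, q → ind q = 1 := fun q hq => if_pos hq
  let e1 : Equiv.Perm (Fin (n + 1)) → Prop := fun π =>
    1 / 10 ^ 6 * R * wealth E.value E.budget Finset.univ p₀ < (E.wealthAt π Y p₀ -
      Y.card / ((n : ℝ) + 1) * wealth E.value E.budget Finset.univ p₀) ^ 2
  let e2 : Equiv.Perm (Fin (n + 1)) → Prop := fun π =>
    1 / 10 ^ 6 * R * ∑ i, (if c < E.value i then E.budget i else 0) <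
      (∑ t ∈ Y, (if c < E.value (π t) then E.budget (π t) else 0) - Y.card / ((n : ℝ) + 1) *
        ∑ i, (if c < E.value i then E.budget i else 0)) ^ 2
  let e3 : Equiv.Perm (Fin (n + 1)) → Prop := fun π =>
    1 / 10 ^ 6 * R * wealth E.value E.budget Finset.univ c < (E.wealthAt π Y c -
      Y.card / ((n : ℝ) + 1) * wealth E.value E.budget Finset.univ c) ^ 2
  let e4 : Equiv.Perm (Fin (n + 1)) → Prop := fun π =>
    1 / 10 ^ 6 * R * E.wealthAt π Yᶜ (P.price (E.profile π) Y) <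
      (E.wealthAt π X (P.price (E.profile π) Y) - X.card / (Yᶜ).card *
        E.wealthAt π Yᶜ (P.price (E.profile π) Y)) ^ 2
  let e5 : Equiv.Perm (Fin (n + 1)) → Prop := fun π =>
    1 / 10 ^ 6 * R * E.wealthAt π Yᶜ (P.price (E.profile π) Y) <
      (E.wealthAt π l.toFinset (P.price (E.profile π) Y) - l.toFinset.card / (Yᶜ).card *
        E.wealthAt π Yᶜ (P.price (E.profile π) Y)) ^ 2
  have key : ∀ π, 72 / 1000 * R * (1 - (ind (e1 π) + ind (e2 π) + ind (e3 π) + ind (e4 π) +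
      ind (e5 π))) ≤ E.channelRevenue ρ m P X Y l π := by
    intro π
    have hbad : 1 ≤ ind (e1 π) + ind (e2 π) + ind (e3 π) + ind (e4 π) + ind (e5 π) →
        72 / 1000 * R * (1 - (ind (e1 π) + ind (e2 π) + ind (e3 π) + ind (e4 π) +
          ind (e5 π))) ≤ E.channelRevenue ρ m P X Y l π := fun h =>
      (mul_nonpos_of_nonneg_of_nonpos (by positivity) (by linarith)).trans
        (E.channelRevenue_nonneg hρ hQ hP)
    have i1 := hind (e1 π)
    have i2 := hind (e2 π)
    have i3 := hind (e3 π)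
    have i4 := hind (e4 π)
    have i5 := hind (e5 π)
    by_cases h1 : e1 π
    · exact hbad (by linarith [hind1 _ h1])
    by_cases h2 : e2 π
    · exact hbad (by linarith [hind1 _ h2])
    by_cases h3 : e3 π
    · exact hbad (by linarith [hind1 _ h3])
    by_cases h4 : e4 π
    · exact hbad (by linarith [hind1 _ h4])
    by_cases h5 : e5 π
    · exact hbad (by linarith [hind1 _ h5])
    refine le_trans ?_ (E.le_channelRevenue hρ hQ hP hm hR hp₀ hRw hRm hc hc' hb hl hlX hY1 hY2 hX
      hL (not_lt.1 h1) (not_lt.1 h2) (not_lt.1 h3) (not_lt.1 h4) (not_lt.1 h5))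
    exact mul_le_of_le_one_right (by positivity) (by linarith)
  refine le_trans ?_ (expectation_mono fun π _ => key π)
  rw [expectation_const_mul, expectation_sub, expectation_const, expectation_add, expectation_add,
    expectation_add, expectation_add]
  have j1 : expectation U (fun π => ind (e1 π)) ≤ 1 / 10 ^ 9 / (1 / 10 ^ 6) := k1
  have j2 : expectation U (fun π => ind (e2 π)) ≤ 1 / 10 ^ 9 / (1 / 10 ^ 6) := k2
  have j3 : expectation U (fun π => ind (e3 π)) ≤ 1 / 10 ^ 9 / (1 / 10 ^ 6) := k3
  have j4 : expectation U (fun π => ind (e4 π)) ≤ 1 / 10 ^ 9 / (1 / 10 ^ 6) := k4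
  have j5 : expectation U (fun π => ind (e5 π)) ≤ 1 / 10 ^ 9 / (1 / 10 ^ 6) := k5
  have h : 71 / 1000 * R = 72 / 1000 * R * (71 / 72) := by ring
  rw [h]
  refine mul_le_mul_of_nonneg_left ?_ (by positivity)
  norm_num at j1 j2 j3 j4 j5 ⊢
  linarith

end ExpectedChannel

/-! ### Revenue given the coins of the partition -/

section RevenueGiven

variable {n : ℕ} {E : Market n} {m : ℝ} {P : PricingRule (Fin (n + 1))} {ρ : ℝ → PMF ℝ}
  {Q : ℝ → Prop} {θ : Fin (n + 1) → AgentType} {T : Fin (n + 1)} {side : Fin (n + 1) → Bool}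

theorem IsRounding.snd_nonneg_of_mem_support_saleAlloc {ι : Type} [DecidableEq ι]
    {θ : ι → AgentType} {p k : ℝ} (hρ : IsRounding ρ Q)
    (hp : 0 < p) (hb : ∀ j, 0 ≤ (θ j).budget) {S : Finset ι} {i : ι} (hi : i ∈ S) (hk : Q k)
    {x : (ι → ℝ) × (ι → ℝ)} (hx : x ∈ (saleAlloc ρ θ S p k).support) : 0 ≤ x.2 i := by
  have h1 : (x.1 i, x.2 i) ∈ ((saleAlloc ρ θ S p k).map fun y => (y.1 i, y.2 i)).support :=
    (PMF.mem_support_map_iff _ _ _).2 ⟨x, hx, rfl⟩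
  rw [saleAlloc_map_apply hi, PMF.mem_support_bind_iff] at h1
  obtain ⟨k', hk', hz⟩ := h1
  have h2 := snd_of_mem_support_sale hz
  simp only at h2
  rw [h2]
  exact charge_nonneg hp (hb i) (hρ.nonneg _ (hρ.of_mem_support_stockFor hp hb hk hk').1)

/-- The revenue is at least that of the collection phase. -/
theorem IsRounding.expectation_collectionPhase_le (hρ : IsRounding ρ Q) (hQ : Q (m / 4))
    (hb : ∀ j, 0 ≤ (θ j).budget) (hP : ∀ S, 0 < P.price θ S) :
    expectation (collectionPhase m P (saleAlloc ρ) θ (firstHalf θ T side)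
        ((secondHalf θ T side).erase (arrivalOrder θ T)) (collectionList θ T) (m / 4) (m / 4))
        (fun y => ((collectionList θ T).map y.2).sum) ≤
      expectation (rsOnlineGiven m P (saleAlloc ρ) θ T side) fun o => ∑ i, o.payment i := by
  have := hρ.finitelySupported_saleAlloc (ι := Fin (n + 1))
  have := fun A₁ A₂' l m₁ m₂ => finitelySupported_collectionPhase (m := m) (P := P)
    (alloc := saleAlloc ρ) (θ := θ) (A₁ := A₁) (A₂' := A₂') l m₁ m₂
  unfold rsOnlineGiven
  rw [expectation_bind]
  set V := expectation (collectionPhase m P (saleAlloc ρ) θ (firstHalf θ T side)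
    ((secondHalf θ T side).erase (arrivalOrder θ T)) (collectionList θ T) (m / 4) (m / 4))
    (fun y => ((collectionList θ T).map y.2).sum) with hV
  rw [← expectation_const (saleAlloc ρ θ (firstHalf θ T side) (P.price θ (secondHalf θ T side))
    (m / 4)) V]
  refine expectation_mono fun x hx => ?_
  rw [expectation_bind, ← expectation_const (saleAlloc ρ θ (secondHalf θ T side)
    (P.price θ (firstHalf θ T side)) (m / 4)) V]
  refine expectation_mono fun x' hx' => ?_
  rw [expectation_map]
  refine expectation_mono fun y hy => ?_
  rw [← List.sum_toFinset _ nodup_collectionList]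
  have h1 : ∀ i ∈ (collectionList θ T).toFinset, y.2 i = (outcomeOf P θ T side x x' y).payment i := by
    intro i hi
    rw [List.mem_toFinset, mem_collectionList] at hi
    simp [outcomeOf, hi]
  rw [Finset.sum_congr rfl h1]
  -- the payments of the sampling phase are not negative
  refine Finset.sum_le_sum_of_subset_of_nonneg (Finset.subset_univ _) fun i _ hi => ?_
  rw [List.mem_toFinset, mem_collectionList, not_not] at hi
  simp only [outcomeOf, hi, if_true]
  split_ifs with h2 h3
  · exact le_rfl
  · exact mul_nonneg (hρ.snd_nonneg_of_mem_support_saleAlloc (hP _) hb h3 hQ hx) (hP _).le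
  · refine mul_nonneg (hρ.snd_nonneg_of_mem_support_saleAlloc (hP _) hb ?_ hQ hx') (hP _).le
    simp only [firstHalf, secondHalf, Finset.mem_filter, not_and, not_not] at h3 ⊢
    exact ⟨hi, h3 hi⟩

/-- The places before `T` of agents in the other half of the sampling set than the agent in place
`T`. -/
def otherSide (T : Fin (n + 1)) (side : Fin (n + 1) → Bool) : Finset (Fin (n + 1)) :=
  Finset.univ.filter fun t => t < T ∧ side t ≠ side T

/-- The places before `T` of agents in the same half of the sampling set as the agent in place `T`.
-/
def sameSide (T : Fin (n + 1)) (side : Fin (n + 1) → Bool) : Finset (Fin (n + 1)) :=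
  Finset.univ.filter fun t => t < T ∧ side t = side T

/-- The places after `T`. -/
def laterPlaces (T : Fin (n + 1)) : List (Fin (n + 1)) :=
  (List.finRange (n + 1)).filter fun t => T < t

theorem Market.arrivalOrder_profile (E : Market n) (π : Equiv.Perm (Fin (n + 1))) :
    arrivalOrder (E.profile π) = Equiv.refl _ :=
  Tuple.sort_eq_refl_iff_monotone.2 E.arrival_strictMono.monotone

theorem Market.mem_sampleSet_profile {π : Equiv.Perm (Fin (n + 1))} {i : Fin (n + 1)} :
    i ∈ sampleSet (E.profile π) T ↔ i ≤ T := by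
  rw [mem_sampleSet, E.arrivalOrder_profile]
  rfl

theorem Market.channelRevenue_add_le (E : Market n) (hρ : IsRounding ρ Q) (hQ : Q (m / 4))
    (hP : IsRevenuePricing m P) (π : Equiv.Perm (Fin (n + 1))) :
    E.channelRevenue ρ m P (otherSide T side) (sameSide T side) (laterPlaces T) π +
      E.channelRevenue ρ m P (sameSide T side) (otherSide T side) (laterPlaces T) π ≤
    expectation (rsOnlineGiven m P (saleAlloc ρ) (E.profile π) T side)
      fun o => ∑ i, o.payment i := by
  have hb : ∀ j, 0 ≤ (E.profile π j).budget := fun j => (E.profile_valid π j).2.2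
  have hp := hP.price_pos (E.profile_valid π)
  refine le_trans (le_of_eq ?_) (hρ.expectation_collectionPhase_le hQ hb hp)
  rw [hρ.expectation_collectionPhase hb hQ (hp _) (hp _) nodup_collectionList hQ hQ]
  have h1 : firstHalf (E.profile π) T side = otherSide T side := by
    ext i
    simp only [firstHalf, otherSide, Finset.mem_filter, Market.mem_sampleSet_profile,
      E.arrivalOrder_profile, Equiv.refl_apply, Finset.mem_univ, true_and]
    refine and_congr_left fun h => ⟨fun h' => h'.lt_of_ne ?_, le_of_lt⟩
    rintro rfl
    exact h rfl
  have h2 : (secondHalf (E.profile π) T side).erase (arrivalOrder (E.profile π) T) =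
      sameSide T side := by
    ext i
    simp only [secondHalf, sameSide, Finset.mem_erase, Finset.mem_filter,
      Market.mem_sampleSet_profile, E.arrivalOrder_profile, Equiv.refl_apply, Finset.mem_univ,
      true_and, lt_iff_le_and_ne]
    tauto
  have h3 : collectionList (E.profile π) T = laterPlaces T := by
    unfold collectionList laterPlaces
    rw [E.arrivalOrder_profile]
    exact List.map_id _
  rw [h1, h2, h3]
  rfl

theorem disjoint_otherSide_sameSide : Disjoint (otherSide T side) (sameSide T side) := by
  unfold otherSide sameSide
  refine Finset.disjoint_filter.2 fun t _ h h' => h.2 h'.2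

theorem card_otherSide_add_card_sameSide :
    ((otherSide T side).card : ℝ) + (sameSide T side).card = (T : ℕ) := by
  rw [← Nat.cast_add, ← Finset.card_union_of_disjoint disjoint_otherSide_sameSide]
  have h : otherSide T side ∪ sameSide T side = Finset.Iio T := by
    ext t
    simp only [otherSide, sameSide, Finset.mem_union, Finset.mem_filter, Finset.mem_univ, true_and,
      Finset.mem_Iio]
    tauto
  rw [h, Fin.card_Iio]

theorem sq_card_sub_card : (((sameSide T side).card : ℝ) - (otherSide T side).card) ^ 2 =
    (∑ t ∈ Finset.Iio T, sign (side t)) ^ 2 := by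
  have h1 : ((sameSide T side).card : ℝ) - (otherSide T side).card =
      sign (side T) * ∑ t ∈ Finset.Iio T, sign (side t) := by
    have h2 : ∀ c : Fin (n + 1) → Prop, ∀ [DecidablePred c],
        (((Finset.univ.filter fun t => t < T ∧ c t).card : ℕ) : ℝ) =
          ∑ t ∈ Finset.Iio T, if c t then 1 else 0 := by
      intro c _
      rw [← Finset.sum_filter, Finset.sum_const, nsmul_eq_mul, mul_one]
      congr 2
      ext t
      simp
    unfold sameSide otherSide
    rw [h2 fun t => side t = side T, h2 fun t => side t ≠ side T, ← Finset.sum_sub_distrib,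
      Finset.mul_sum]
    refine Finset.sum_congr rfl fun t _ => ?_
    cases side t <;> cases side T <;> simp [sign]
  rw [h1, mul_pow, sq (sign _), sign_mul_self, one_mul]

theorem mem_laterPlaces {t : Fin (n + 1)} : t ∈ laterPlaces T ↔ T < t := by
  simp [laterPlaces]

theorem nodup_laterPlaces : (laterPlaces T).Nodup := (List.nodup_finRange _).filter _

theorem card_laterPlaces : ((laterPlaces T).toFinset.card : ℝ) = n - (T : ℕ) := by
  have h : (laterPlaces T).toFinset = Finset.Ioi T := by
    ext t
    simp [mem_laterPlaces]
  rw [h, Fin.card_Ioi, Nat.add_sub_cancel, Nat.cast_sub (Nat.lt_succ_iff.1 T.isLt)]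

theorem sub_two_mul_tailCount (tosses : Fin n → Bool) :
    (n : ℝ) - 2 * (tailCount tosses : ℕ) = ∑ t, sign (tosses t) := by
  have h : ∀ c : Bool, sign c = 1 - 2 * if c = false then 1 else 0 := by
    intro c
    cases c <;> norm_num [sign]
  simp only [h, Finset.sum_sub_distrib, ← Finset.mul_sum, tailCount, Finset.sum_boole]
  simp

end RevenueGiven

/-! ### Expected revenue of the mechanism -/

section Revenue

variable {n : ℕ} {m : ℝ} {P : PricingRule (Fin (n + 1))} {ρ : ℝ → PMF ℝ} {Q : ℝ → Prop}

open scoped Classical in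
/-- In a large market the mechanism collects at least an eighth of the optimal revenue at a uniform
price. -/
theorem Market.OPT_div_eight_le_expectedRevenue (E : Market n) (hρ : IsRounding ρ Q)
    (hQ : Q (m / 4)) (hP : IsRevenuePricing m P) (hm : 0 < m) (hR : 0 < E.OPT m)
    (hε : E.eps m ≤ 1 / 10 ^ 9) :
    E.OPT m / 8 ≤ E.expectedRevenue (rsOnline m P (saleAlloc ρ)) := by
  have := hρ.finitelySupported_saleAlloc (ι := Fin (n + 1))
  set R := E.OPT m with hRdef
  have hb : ∀ i, E.budget i ≤ R / 10 ^ 9 := by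
    intro i
    have h1 : E.budget i ≤ Finset.univ.sup' Finset.univ_nonempty E.budget :=
      Finset.le_sup' _ (Finset.mem_univ i)
    rw [Market.eps, div_le_iff₀ hR] at hε
    linarith
  -- the market is large because no agent alone contributes much
  have hN : (10 : ℝ) ^ 9 ≤ (n : ℝ) + 1 := by
    obtain ⟨p₀, -, -, hw, -⟩ := E.exists_threshold hm hR
    have h1 : wealth E.value E.budget Finset.univ p₀ ≤ ∑ _i : Fin (n + 1), R / 10 ^ 9 :=
      Finset.sum_le_sum fun i _ => by
        split_ifs
        · exact hb i
        · positivity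
    rw [Finset.sum_const, Finset.card_univ, Fintype.card_fin, nsmul_eq_mul] at h1
    push_cast at h1
    by_contra h
    rw [not_le] at h
    have h2 : ((n : ℝ) + 1) * (R / 10 ^ 9) < 10 ^ 9 * (R / 10 ^ 9) :=
      mul_lt_mul_of_pos_right h (by positivity)
    rw [mul_div_cancel₀ _ (by norm_num)] at h2
    linarith
  set N : ℝ := (n : ℝ) + 1 with hNdef
  have hN0 : 0 < N := by positivity
  set Uπ := PMF.uniformOfFintype (Equiv.Perm (Fin (n + 1))) with hUπ
  set Ut := PMF.uniformOfFintype (Fin n → Bool) with hUt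
  set Us := PMF.uniformOfFintype (Fin (n + 1) → Bool) with hUs
  set c : ℝ := 2 / 1000 * N with hc
  have hc0 : 0 < c := by positivity
  let W : Fin (n + 1) → (Fin (n + 1) → Bool) → ℝ := fun T side => expectation Uπ fun π =>
    expectation (rsOnlineGiven m P (saleAlloc ρ) (E.profile π) T side) fun o => ∑ i, o.payment i
  have hrev : E.expectedRevenue (rsOnline m P (saleAlloc ρ)) =
      expectation Ut fun tosses => expectation Us fun side => W (tailCount tosses) side := by
    have := fun π => (inferInstance : FinitelySupported (Ut.bind fun tosses => Us.bind fun side =>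
      rsOnlineGiven m P (saleAlloc ρ) (E.profile π) (tailCount tosses) side))
    unfold Market.expectedRevenue
    simp only [rsOnline_eq]
    rw [expectation_bind]
    simp only [expectation_bind]
    rw [expectation_comm]
    refine expectation_congr fun tosses _ => ?_
    rw [expectation_comm]
  have hW : ∀ T side, expectation Uπ (E.channelRevenue ρ m P (otherSide T side) (sameSide T side)
        (laterPlaces T)) + expectation Uπ (E.channelRevenue ρ m P (sameSide T side)
        (otherSide T side) (laterPlaces T)) ≤ W T side := by
    intro T side
    rw [← expectation_add]
    exact expectation_mono fun π _ => E.channelRevenue_add_le hρ hQ hP π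
  have hW0 : ∀ T side, 0 ≤ W T side := fun T side =>
    (add_nonneg (expectation_nonneg fun π _ => E.channelRevenue_nonneg hρ hQ hP)
      (expectation_nonneg fun π _ => E.channelRevenue_nonneg hρ hQ hP)).trans (hW T side)
  -- if the coins of the partition are balanced up to `c`, then both channels have typical sizes
  have good : ∀ tosses side, (∑ t, sign (tosses t)) ^ 2 ≤ c ^ 2 →
      (∑ t ∈ Finset.Iio (tailCount tosses), sign (side t)) ^ 2 ≤ c ^ 2 →
      142 / 1000 * R ≤ W (tailCount tosses) side := by
    intro tosses side h1 h2
    rw [← sub_two_mul_tailCount] at h1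
    rw [← sq_card_sub_card] at h2
    set T := tailCount tosses
    obtain ⟨h1, h1'⟩ := abs_le_of_sq_le_sq' h1 hc0.le
    obtain ⟨h2, h2'⟩ := abs_le_of_sq_le_sq' h2 hc0.le
    have h3 := card_otherSide_add_card_sameSide (T := T) (side := side)
    have h4 := card_laterPlaces (T := T)
    have hX : ∀ t ∈ laterPlaces T, t ∉ otherSide T side := fun t ht h =>
      absurd (mem_laterPlaces.1 ht) (Finset.mem_filter.1 h).2.1.asymm
    have hY : ∀ t ∈ laterPlaces T, t ∉ sameSide T side := fun t ht h =>
      absurd (mem_laterPlaces.1 ht) (Finset.mem_filter.1 h).2.1.asymm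
    have h5 := E.le_expectation_channelRevenue hρ hQ hP hm hR hb nodup_laterPlaces hX
      disjoint_otherSide_sameSide
      (Finset.disjoint_left.2 fun t ht => hY t (List.mem_toFinset.1 ht))
      (by linarith) (by linarith) (by linarith) (by linarith)
    have h6 := E.le_expectation_channelRevenue hρ hQ hP hm hR hb nodup_laterPlaces hY
      disjoint_otherSide_sameSide.symm
      (Finset.disjoint_left.2 fun t ht => hX t (List.mem_toFinset.1 ht))
      (by linarith) (by linarith) (by linarith) (by linarith)
    linarith [hW T side]
  let ind : Prop → ℝ := fun q => if q then 1 else 0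
  have hind : ∀ q, 0 ≤ ind q := fun q => by
    simp only [ind]
    split_ifs <;> norm_num
  have hind1 : ∀ q, q → ind q = 1 := fun q hq => if_pos hq
  let e1 : (Fin n → Bool) → Prop := fun tosses => c ^ 2 < (∑ t, sign (tosses t)) ^ 2
  let e2 : Fin (n + 1) → (Fin (n + 1) → Bool) → Prop := fun T side =>
    c ^ 2 < (∑ t ∈ Finset.Iio T, sign (side t)) ^ 2
  have key : ∀ tosses side, 142 / 1000 * R * (1 - (ind (e1 tosses) +
      ind (e2 (tailCount tosses) side))) ≤ W (tailCount tosses) side := by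
    intro tosses side
    have i1 := hind (e1 tosses)
    have i2 := hind (e2 (tailCount tosses) side)
    have hbad : 1 ≤ ind (e1 tosses) + ind (e2 (tailCount tosses) side) → 142 / 1000 * R *
        (1 - (ind (e1 tosses) + ind (e2 (tailCount tosses) side))) ≤ W (tailCount tosses) side :=
      fun h => (mul_nonpos_of_nonneg_of_nonpos (by positivity) (by linarith)).trans (hW0 _ _)
    by_cases h1 : e1 tosses
    · exact hbad (by linarith [hind1 _ h1])
    by_cases h2 : e2 (tailCount tosses) side
    · exact hbad (by linarith [hind1 _ h2])
    refine le_trans ?_ (good tosses side (not_lt.1 h1) (not_lt.1 h2))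
    exact mul_le_of_le_one_right (by positivity) (by linarith)
  have hNc : ∀ k : ℝ, k ≤ N → k / c ^ 2 ≤ 1 / 4000 := by
    intro k hk
    have h1 : N * 10 ^ 9 ≤ N * N := mul_le_mul_of_nonneg_left hN hN0.le
    have h2 : c ^ 2 = 4 / 10 ^ 6 * (N * N) := by
      rw [hc]
      ring
    rw [div_le_iff₀ (by positivity), h2]
    linarith
  have j1 : expectation Ut (fun tosses => ind (e1 tosses)) ≤ 1 / 4000 := by
    refine (expectation_sum_sign_deviation_le Finset.univ hc0).trans (hNc _ ?_)
    rw [Finset.card_univ, Fintype.card_fin]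
    linarith
  have j2 : ∀ T, expectation Us (fun side => ind (e2 T side)) ≤ 1 / 4000 := by
    intro T
    refine (expectation_sum_sign_deviation_le (Finset.Iio T) hc0).trans (hNc _ ?_)
    rw [Fin.card_Iio]
    have : ((T : ℕ) : ℝ) ≤ n := Nat.cast_le.2 (Nat.lt_succ_iff.1 T.isLt)
    linarith
  have h1 : ∀ tosses, 142 / 1000 * R * (1 - (ind (e1 tosses) + 1 / 4000)) ≤
      expectation Us fun side => W (tailCount tosses) side := by
    intro tosses
    refine le_trans ?_ (expectation_mono fun side _ => key tosses side)
    rw [expectation_const_mul, expectation_sub, expectation_const, expectation_const_add]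
    refine mul_le_mul_of_nonneg_left ?_ (by positivity)
    linarith [j2 (tailCount tosses)]
  rw [hrev]
  refine le_trans ?_ (expectation_mono fun tosses _ => h1 tosses)
  rw [expectation_const_mul, expectation_sub, expectation_const, expectation_add,
    expectation_const]
  have h : R / 8 = 142 / 1000 * R * (125 / 142) := by ring
  rw [h]
  refine mul_le_mul_of_nonneg_left ?_ (by positivity)
  linarith

/-- In a large market the mechanism collects at least a sixteenth of the optimal revenue at
heterogeneous prices. -/
theorem Market.mul_OPTstar_le_expectedRevenue (E : Market n) (hρ : IsRounding ρ Q)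
    (hQ : Q (m / 4)) (hP : IsRevenuePricing m P) (hm : 0 < m) (hR : 0 < E.OPT m)
    (hε : E.eps m ≤ 1 / 10 ^ 9) {η : ℝ} (hη : 0 < η) :
    (1 - η) * E.OPTstar m / 16 ≤ E.expectedRevenue (rsOnline m P (saleAlloc ρ)) ∧
    (1 - η) * E.OPTstar m / 32 ≤ E.expectedRevenue (rsOnline m P (saleAlloc ρ)) := by
  have h1 := E.OPT_div_eight_le_expectedRevenue hρ hQ hP hm hR hε
  have h2 : E.OPTstar m ≤ 2 * E.OPT m := heterogeneousOPT_le E.value_nonneg E.budget_nonneg hm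
  have h3 : 0 ≤ η * E.OPTstar m := mul_nonneg hη.le heterogeneousOPT_nonneg
  have h4 : (1 - η) * E.OPTstar m = E.OPTstar m - η * E.OPTstar m := by ring
  rw [h4]
  constructor <;> linarith

end Revenue

end BudgetAuction

end

theorem mainTheorem1 :
    -- indivisible items
    ((∀ (n m : ℕ), 0 < m → 4 ∣ m →
        ∀ P : BudgetAuction.PricingRule (Fin (n + 1)), BudgetAuction.IsRevenuePricing (m : ℝ) P →
          BudgetAuction.Feasible (BudgetAuction.revIndiv (m : ℝ) P) (m : ℝ) ∧
          BudgetAuction.AllocatesIndivisibleItems (BudgetAuction.revIndiv (m : ℝ) P) ∧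
          BudgetAuction.IndividuallyRational (BudgetAuction.revIndiv (m : ℝ) P) ∧
          BudgetAuction.Truthful (BudgetAuction.revIndiv (m : ℝ) P)) ∧
      (∀ η : ℝ, 0 < η → ∃ ε₀ : ℝ, 0 < ε₀ ∧
        ∀ (n m : ℕ), 0 < m → 4 ∣ m →
        ∀ P : BudgetAuction.PricingRule (Fin (n + 1)), BudgetAuction.IsRevenuePricing (m : ℝ) P →
        ∀ E : BudgetAuction.Market n, 0 < E.OPT (m : ℝ) → E.eps (m : ℝ) ≤ ε₀ →
          (1 - η) * E.OPTstar (m : ℝ) / 32 ≤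
            E.expectedRevenue (BudgetAuction.revIndiv (m : ℝ) P))) ∧
    -- divisible items
    ((∀ (n : ℕ) (m : ℝ), 0 < m →
        ∀ P : BudgetAuction.PricingRule (Fin (n + 1)), BudgetAuction.IsRevenuePricing m P →
          BudgetAuction.Feasible (BudgetAuction.revDiv m P) m ∧
          BudgetAuction.IndividuallyRational (BudgetAuction.revDiv m P) ∧
          BudgetAuction.Truthful (BudgetAuction.revDiv m P)) ∧
      (∀ η : ℝ, 0 < η → ∃ ε₀ : ℝ, 0 < ε₀ ∧
        ∀ (n : ℕ) (m : ℝ), 0 < m →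
        ∀ P : BudgetAuction.PricingRule (Fin (n + 1)), BudgetAuction.IsRevenuePricing m P →
        ∀ E : BudgetAuction.Market n, 0 < E.OPT m → E.eps m ≤ ε₀ →
          (1 - η) * E.OPTstar m / 16 ≤
            E.expectedRevenue (BudgetAuction.revDiv m P))) := by
  have hdiv : ∀ m : ℕ, 4 ∣ m → ∃ z : ℕ, (m : ℝ) / 4 = z := by
    rintro _ ⟨z, rfl⟩
    exact ⟨z, by push_cast; ring⟩
  refine ⟨⟨fun n m hm h4 P hP => ?_, fun η hη => ⟨1 / 10 ^ 9, by norm_num,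
    fun n m hm h4 P hP E hR hε => ?_⟩⟩, ⟨fun n m hm P hP => ?_, fun η hη => ⟨1 / 10 ^ 9,
    by norm_num, fun n m hm P hP E hR hε => ?_⟩⟩⟩
  · refine ⟨?_, BudgetAuction.allocatesIndivisibleItems_revIndiv (hdiv m h4) hP, ?_⟩
    all_goals rw [BudgetAuction.revIndiv, BudgetAuction.indivAlloc_eq_saleAlloc]
    · exact BudgetAuction.isRounding_randomRounding.feasible (hdiv m h4) hP
    · exact ⟨BudgetAuction.isRounding_randomRounding.individuallyRational (hdiv m h4) hP,
        BudgetAuction.isRounding_randomRounding.truthful (hdiv m h4) hP⟩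
  · rw [BudgetAuction.revIndiv, BudgetAuction.indivAlloc_eq_saleAlloc]
    exact (E.mul_OPTstar_le_expectedRevenue BudgetAuction.isRounding_randomRounding (hdiv m h4) hP
      (Nat.cast_pos.2 hm) hR hε hη).2
  · have hQ : 0 ≤ m / 4 := by positivity
    rw [BudgetAuction.revDiv, BudgetAuction.divAlloc_eq_saleAlloc]
    exact ⟨BudgetAuction.isRounding_pure.feasible hQ hP,
      BudgetAuction.isRounding_pure.individuallyRational hQ hP,
      BudgetAuction.isRounding_pure.truthful hQ hP⟩
  · have hQ : 0 ≤ m / 4 := by positivity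
    rw [BudgetAuction.revDiv, BudgetAuction.divAlloc_eq_saleAlloc]
    exact (E.mul_OPTstar_le_expectedRevenue BudgetAuction.isRounding_pure hQ hP hm hR hε hη).1
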